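/- Let $\mathbb F$ be a field of characteristic $p>3$, let $m,n\ge 3$ be integers, and let $\underline t=(t_1,\dots,t_m)$ be positive integers. Let $\mathfrak A(m,n)$ be the tensor product of the divided power algebra in $m$ (even) variables, with basis $x^{(\alpha)}$, $\alpha\in\mathbb N_0^m$, and product $x^{(\alpha)}x^{(\beta)}=\binom{\alpha+\beta}{\alpha}x^{(\alpha+\beta)}$, and of the exterior algebra $\Lambda(n)$ in the odd variables $x_{m+1},\dots,x_{m+n}$. Let $D_1,\dots,D_{m+n}$ be its standard partial superderivations: $D_r(x^{(\alpha)}x^u)=x^{(\alpha-\varepsilon_r)}x^u$ for $r\le m$ (zero if $\alpha_r=0$), and $D_r(x^{(\alpha)}x^u)=x^{(\alpha)}\,\partial x^u/\partial x_r$ for $r>m$. Put $\tau(r)=\bar 0$ for $r\le m$ and $\tau(r)=\bar 1$ for $r>m$. Let $\mathfrak A=\mathfrak A(m,n;\underline t)$ be the span of the $x^{(\alpha)}x^u$ with $0\le\alpha_i\le p^{t_i}-1$ for all $i$. For $1\le r,s\le m+n$ and $f\in\mathfrak A$ homogeneous of parity $\mathrm p(f)$ put $$D_{rs}(f)=(-1)^{\tau(r)\tau(s)}D_r(f)D_s-(-1)^{(\tau(r)+\tau(s))\mathrm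 p(f)}D_s(f)D_r ,$$ extended linearly in $f$. Let $S=S(m,n;\underline t)$ be the Lie superalgebra spanned by all $D_{rs}(f)$, and let $\mathcal S=S_{\bar 0}$ be its even part, a Lie algebra under the commutator. Then the space $\mathrm{Der}(\mathcal S)$ of all derivations of the Lie algebra $\mathcal S$ satisfies $$\dim_{\mathbb F}\mathrm{Der}(\mathcal S)=\begin{cases}(m+n-1)\,2^{n-1}p^{\sum_{i=1}^m t_i}+\sum_{i=1}^m t_i-m+2,& n\text{ even},\\ (m+n-1)\,2^{n-1}p^{\sum_{i=1}^m t_i}+\sum_{i=1}^m t_i-m+1,& n\text{ odd}.\end{cases}$$ -/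

import Mathlib

noncomputable section

open Finset

attribute [local instance] LieRing.ofAssociativeRing

namespace ModularCartan

/-- Exponents `(α, u)` of the monomials `x^(α) x^u`: a multi-index `α` for the divided powers in the
even variables, and a set `u` of odd variables (multiplied in increasing order). -/
abbrev Expo (m n : ℕ) : Type := (Fin m → ℕ) × Finset (Fin n)

/-- The underlying space of the tensor product of the divided power algebra in `m` even variables
and the exterior algebra in `n` odd variables: the free module on the monomials `x^(α) x^u`. -/
def Alg (F : Type*) [CommRing F] (m n : ℕ) : Type _ := Expo m n →₀ F

instance (F : Type*) [CommRing F] (m n : ℕ) : AddCommGroup (Alg F m n) :=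
  inferInstanceAs (AddCommGroup (Expo m n →₀ F))

instance (F : Type*) [CommRing F] (m n : ℕ) : Module F (Alg F m n) :=
  inferInstanceAs (Module F (Expo m n →₀ F))

/-- The index set of all variables: `Sum.inl i` is even, `Sum.inr k` is odd. -/
abbrev Var (m n : ℕ) : Type := Fin m ⊕ Fin n

variable {F : Type*} [CommRing F] {m n : ℕ}

/-- The number of pairs `(i, j)` in `u × v` with `j < i`. -/
def inversions (u v : Finset (Fin n)) : ℕ := ∑ i ∈ u, ∑ j ∈ v, if j < i then 1 else 0

/-- The standard basis of monomials `x^(α) x^u`. -/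
def monoBasis (F : Type*) [CommRing F] (m n : ℕ) : Module.Basis (Expo m n) F (Alg F m n) :=
  .ofRepr (LinearEquiv.refl F (Expo m n →₀ F))

variable (F) in
/-- The monomial `x^(α) x^u`. -/
def mono (a : Expo m n) : Alg F m n := monoBasis F m n a

variable (F) in
/-- The structure constants of the product: a product of binomial coefficients times the sign of the
exterior product, and zero when an odd variable is repeated. -/
def coeff (a b : Expo m n) : F :=
  if Disjoint a.2 b.2 then
    (-1) ^ inversions a.2 b.2 * ∏ i, (((a.1 i + b.1 i).choose (a.1 i) : ℕ) : F)
  else 0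

/-- The product of the superalgebra, as a bilinear map:
`(x^(α) x^u) (x^(β) x^v) = binom(α+β, α) x^(α+β) (x^u x^v)`. -/
def mul : Alg F m n →ₗ[F] Module.End F (Alg F m n) :=
  (monoBasis F m n).constr F fun a =>
    (monoBasis F m n).constr F fun b => coeff F a b • mono F (a.1 + b.1, a.2 ∪ b.2)

/-- The parity of a variable. -/
def tau : Var m n → ℕ
  | Sum.inl _ => 0
  | Sum.inr _ => 1

/-- The partial (super)derivations `D_r`. -/
def D : Var m n → Module.End F (Alg F m n)
  | Sum.inl i => (monoBasis F m n).constr F fun a =>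
      if a.1 i = 0 then 0 else mono F (a.1 - Pi.single i 1, a.2)
  | Sum.inr k => (monoBasis F m n).constr F fun a =>
      if k ∈ a.2 then (-1 : F) ^ #{j ∈ a.2 | j < k} • mono F (a.1, a.2.erase k) else 0

/-- The linear map `f ↦ (-1)^(q p(f)) f` (for `f` homogeneous of parity `p(f)`). -/
def twist (q : ℕ) : Module.End F (Alg F m n) :=
  (monoBasis F m n).constr F fun a => (-1 : F) ^ (q * #a.2) • mono F a

/-- The elements of parity `q` mod 2. -/
def homog (F : Type*) [CommRing F] (m n : ℕ) (q : ℕ) : Submodule F (Alg F m n) :=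
  Submodule.span F (mono F '' {a | #a.2 ≡ q [MOD 2]})

/-- The endomorphisms of the superspace that preserve parity. -/
def evenEnd (F : Type*) [CommRing F] (m n : ℕ) : Submodule F (Module.End F (Alg F m n)) where
  carrier := {T | ∀ q, ∀ f ∈ homog F m n q, T f ∈ homog F m n q}
  add_mem' hS hT q f hf := add_mem (hS q f hf) (hT q f hf)
  zero_mem' q _ _ := (homog F m n q).zero_mem
  smul_mem' c _ hT q f hf := (homog F m n q).smul_mem c (hT q f hf)

/-- The truncated subalgebra, spanned by the `x^(α) x^u` with `α_i ≤ p^{t_i} - 1`. -/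
def trunc (F : Type*) [CommRing F] {m : ℕ} (n p : ℕ) (t : Fin m → ℕ) :
    Submodule F (Alg F m n) :=
  Submodule.span F (mono F '' {a | ∀ i, a.1 i < p ^ t i})

/-- The linear map `D_{rs}`: for `f` homogeneous,
`D_{rs}(f) = (-1)^{τ(r)τ(s)} D_r(f) D_s - (-1)^{(τ(r)+τ(s))p(f)} D_s(f) D_r`, where `g D_r` is the
endomorphism `h ↦ g D_r(h)`. -/
def Drs (r s : Var m n) (f : Alg F m n) : Module.End F (Alg F m n) :=
  (-1 : F) ^ (tau r * tau s) • (mul (D r f) ∘ₗ D s) -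
    mul (D s (twist (tau r + tau s) f)) ∘ₗ D r

/-- The special Lie superalgebra `S(m,n;t)` (as a superspace of endomorphisms). -/
def special (F : Type*) [CommRing F] {m : ℕ} (n p : ℕ) (t : Fin m → ℕ) :
    Submodule F (Module.End F (Alg F m n)) :=
  Submodule.span F {T | ∃ r s : Var m n, ∃ f ∈ trunc F n p t, T = Drs r s f}

/-! ### Closure of the even part under the bracket -/

section Basic

lemma mul_mono (a b : Expo m n) :
    mul (mono F a) (mono F b) = coeff F a b • mono F (a.1 + b.1, a.2 ∪ b.2) := by
  simp [mul, mono]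

lemma twist_mono (q : ℕ) (a : Expo m n) :
    twist q (mono F a) = (-1 : F) ^ (q * #a.2) • mono F a := by
  simp [twist, mono]

lemma D_inl_mono (i : Fin m) (a : Expo m n) : D (Sum.inl i) (mono F a) =
    if a.1 i = 0 then 0 else mono F (a.1 - Pi.single i 1, a.2) := by
  simp [D, mono]

lemma D_inr_mono (k : Fin n) (a : Expo m n) : D (Sum.inr k) (mono F a) =
    if k ∈ a.2 then (-1 : F) ^ #{j ∈ a.2 | j < k} • mono F (a.1, a.2.erase k) else 0 := by
  simp [D, mono]

lemma ext_mono {M : Type*} [AddCommMonoid M] [Module F M] {S T : Alg F m n →ₗ[F] M}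
    (h : ∀ a, S (mono F a) = T (mono F a)) : S = T := by
  exact (monoBasis F m n).ext h

lemma inv_union_left {u v : Finset (Fin n)} (h : Disjoint u v) (w : Finset (Fin n)) :
    inversions (u ∪ v) w = inversions u w + inversions v w := by
  simp [inversions, sum_union h]

lemma inv_union_right {u v : Finset (Fin n)} (h : Disjoint u v) (w : Finset (Fin n)) :
    inversions w (u ∪ v) = inversions w u + inversions w v := by
  simp [inversions, sum_union h, sum_add_distrib]

lemma inv_comm {u v : Finset (Fin n)} (h : Disjoint u v) :
    inversions u v + inversions v u = #u * #v := by
  unfold inversions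
  rw [sum_comm (s := v), ← sum_add_distrib]
  have : ∀ i ∈ u, (∑ j ∈ v, if j < i then 1 else 0) + (∑ j ∈ v, if i < j then 1 else 0) = #v := by
    intro i hi
    rw [← sum_add_distrib, card_eq_sum_ones]
    refine sum_congr rfl fun j hj => ?_
    have hne : i ≠ j := fun e => (Finset.disjoint_left.mp h hi) (e ▸ hj)
    rcases lt_or_gt_of_ne hne with hlt | hlt
    · simp [hlt, hlt.not_gt]
    · simp [hlt, hlt.not_gt]
  rw [sum_congr rfl this]
  simp

lemma card_lt_eq (k : Fin n) (u : Finset (Fin n)) : #{j ∈ u | j < k} = inversions {k} u := by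
  simp [inversions]

lemma coeff_assoc (a b c : Expo m n) :
    coeff F a b * coeff F (a.1 + b.1, a.2 ∪ b.2) c =
      coeff F b c * coeff F a (b.1 + c.1, b.2 ∪ c.2) := by
  unfold coeff
  by_cases hab : Disjoint a.2 b.2 <;> by_cases hbc : Disjoint b.2 c.2 <;>
    by_cases hac : Disjoint a.2 c.2 <;>
    simp only [hab, hbc, hac, disjoint_union_left, disjoint_union_right, if_true, if_false,
      and_true, and_false, and_self, zero_mul, mul_zero]
  rw [inv_union_left hab, inv_union_right hbc]
  have : ∀ x y z w P Q R S : F, P * Q = R * S → x * y = z * w →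
      x * P * (y * Q) = z * R * (w * S) := by
    intro x y z w P Q R S h1 h2
    linear_combination x * y * h1 + R * S * h2
  apply this
  · rw [← prod_mul_distrib, ← prod_mul_distrib]
    refine prod_congr rfl fun i _ => ?_
    rw [← Nat.cast_mul, ← Nat.cast_mul]
    congr 1
    simp only [Pi.add_apply]
    have := Nat.choose_mul (n := a.1 i + b.1 i + c.1 i) (k := a.1 i + b.1 i) (s := a.1 i)
      (by omega)
    rw [show a.1 i + b.1 i + c.1 i - a.1 i = b.1 i + c.1 i by omega,
      show a.1 i + b.1 i - a.1 i = b.1 i by omega] at this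
    rw [← add_assoc, mul_comm, this, mul_comm]
  · rw [← pow_add, ← pow_add]
    congr 1
    omega

lemma mul_assoc' (f g h : Alg F m n) : mul (mul f g) h = mul f (mul g h) := by
  have key : ∀ a b c, mul (mul (mono F a) (mono F b)) (mono F c) =
      mul (mono F a) (mul (mono F b) (mono (m := m) (n := n) F c)) := by
    intro a b c
    simp only [mul_mono, map_smul, LinearMap.smul_apply, smul_smul]
    rw [coeff_assoc, add_assoc, union_assoc]
  have h1 : (mul.compr₂ mul : Alg F m n →ₗ[F] _ →ₗ[F] Module.End F _) =
      LinearMap.mk₂ F (fun f g => mul f ∘ₗ mul g) (by intros; ext; simp) (by intros; ext; simp)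
        (by intros; ext; simp) (by intros; ext; simp) := by
    refine ext_mono fun a => ext_mono fun b => ext_mono fun c => ?_
    simpa using key a b c
  exact LinearMap.congr_fun (LinearMap.congr_fun (LinearMap.congr_fun h1 f) g) h

lemma mul_comp (f g : Alg F m n) : mul f ∘ₗ mul g = mul (mul f g) := by
  exact LinearMap.ext fun h => (mul_assoc' f g h).symm

lemma coeff_comm (a b : Expo m n) : coeff F a b = (-1) ^ (#a.2 * #b.2) * coeff F b a := by
  unfold coeff
  by_cases h : Disjoint a.2 b.2
  · rw [if_pos h, if_pos h.symm, ← inv_comm h, ← mul_assoc, ← pow_add]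
    congr 1
    · rw [show inversions a.2 b.2 + inversions b.2 a.2 + inversions b.2 a.2 =
        inversions a.2 b.2 + 2 * inversions b.2 a.2 by ring, pow_add, pow_mul]
      simp
    · refine prod_congr rfl fun i _ => ?_
      rw [add_comm (b.1 i), Nat.choose_symm_add]
  · rw [if_neg h, if_neg (fun h' => h h'.symm), mul_zero]

lemma mul_mono_comm (a b : Expo m n) :
    mul (mono F a) (mono F b) = (-1 : F) ^ (#a.2 * #b.2) • mul (mono F b) (mono F a) := by
  rw [mul_mono, mul_mono, smul_smul, ← coeff_comm, add_comm a.1, union_comm a.2]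

lemma coeff_zero_of_not_disjoint {a b : Expo m n} (h : ¬ Disjoint a.2 b.2) : coeff F a b = 0 :=
  if_neg h

lemma leibniz_inl_mono (i : Fin m) (a b : Expo m n) :
    D (Sum.inl i) (mul (mono F a) (mono F b)) =
      mul (D (Sum.inl i) (mono F a)) (mono F b) + mul (mono F a) (D (Sum.inl i) (mono F b)) := by
  have hP : ∀ α β : Fin m → ℕ, ∏ j, (((α j + β j).choose (α j) : ℕ) : F) =
      ((α i + β i).choose (α i) : ℕ) *
        ∏ j ∈ {i}ᶜ, (((α j + β j).choose (α j) : ℕ) : F) := fun α β => by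
    rw [Fintype.prod_eq_mul_prod_compl i]
  have hc : ∀ α : Fin m → ℕ, ∀ j ∈ ({i}ᶜ : Finset (Fin m)), (α - Pi.single i 1 : Fin m → ℕ) j = α j := by
    intro α j hj
    have : j ≠ i := by simpa using hj
    simp [this]
  have hi : ∀ α : Fin m → ℕ, (α - Pi.single i 1 : Fin m → ℕ) i = α i - 1 := by intro α; simp
  have hR1 : ∀ α β : Fin m → ℕ,
      ∏ j ∈ ({i}ᶜ : Finset (Fin m)), (((((α - Pi.single i 1 : Fin m → ℕ) j) + β j).choose
        ((α - Pi.single i 1 : Fin m → ℕ) j) : ℕ) : F) =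
      ∏ j ∈ ({i}ᶜ : Finset (Fin m)), (((α j + β j).choose (α j) : ℕ) : F) := by
    intro α β
    refine prod_congr rfl fun j hj => by rw [hc α j hj]
  have hR2 : ∀ α β : Fin m → ℕ,
      ∏ j ∈ ({i}ᶜ : Finset (Fin m)), (((α j + (β - Pi.single i 1 : Fin m → ℕ) j).choose
        (α j) : ℕ) : F) =
      ∏ j ∈ ({i}ᶜ : Finset (Fin m)), (((α j + β j).choose (α j) : ℕ) : F) := by
    intro α β
    refine prod_congr rfl fun j hj => by rw [hc β j hj]
  have e1 : ∀ α β : Fin m → ℕ, α i ≠ 0 → α - Pi.single i 1 + β = α + β - Pi.single i 1 := by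
    intro α β h
    funext j
    by_cases hj : j = i
    · subst hj; simp; omega
    · simp [hj]
  have e2 : ∀ α β : Fin m → ℕ, β i ≠ 0 → α + (β - Pi.single i 1) = α + β - Pi.single i 1 := by
    intro α β h
    rw [add_comm, e1 β α h, add_comm]
  by_cases hd : Disjoint a.2 b.2
  · rw [mul_mono, map_smul, D_inl_mono, D_inl_mono, D_inl_mono]
    by_cases ha : a.1 i = 0 <;> by_cases hb : b.1 i = 0
    · simp [ha, hb]
    · simp only [Pi.add_apply, ha, hb, zero_add, if_true, if_false, map_zero, LinearMap.zero_apply,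
        mul_mono, e2 _ _ hb]
      congr 1
      simp only [coeff, hd, if_true]
      rw [hP, hP a.1, hR2]
      simp [ha]
    · simp only [Pi.add_apply, ha, hb, add_zero, if_true, if_false, map_zero,
        mul_mono, e1 _ _ ha]
      congr 1
      simp only [coeff, hd, if_true]
      rw [hP, hP _ b.1, hR1]
      simp [hb]
    · have hab : a.1 i + b.1 i ≠ 0 := by omega
      simp only [Pi.add_apply, ha, hb, hab, if_false, mul_mono, e1 _ _ ha, e2 _ _ hb, ← add_smul]
      congr 1
      simp only [coeff, hd, if_true]
      rw [hP, hP _ b.1, hR1, hP _ (b.1 - _), hR2, hi, hi, ← mul_add, ← add_mul]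
      congr 2
      rw [← Nat.cast_add]
      congr 1
      obtain ⟨x, hx⟩ := Nat.exists_eq_succ_of_ne_zero ha
      obtain ⟨y, hy⟩ := Nat.exists_eq_succ_of_ne_zero hb
      rw [hx, hy]
      rw [show x.succ + y.succ = (x + y + 1) + 1 by omega, Nat.succ_eq_add_one,
        Nat.choose_succ_succ]
      congr 2; omega
  · rw [mul_mono, coeff_zero_of_not_disjoint hd, D_inl_mono, D_inl_mono]
    split_ifs <;> simp [mul_mono, coeff, hd]

lemma neg_one_pow_eq {x y : ℕ} (h : x % 2 = y % 2) : (-1 : F) ^ x = (-1) ^ y := by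
  rw [← Nat.div_add_mod x 2, ← Nat.div_add_mod y 2, h, pow_add, pow_add, pow_mul, pow_mul]
  simp

lemma leibniz_inr_mono (k : Fin n) (a b : Expo m n) :
    D (Sum.inr k) (mul (mono F a) (mono F b)) =
      mul (D (Sum.inr k) (mono F a)) (mono F b) +
        (-1 : F) ^ #a.2 • mul (mono F a) (D (Sum.inr k) (mono F b)) := by
  obtain ⟨α, u⟩ := a
  obtain ⟨β, v⟩ := b
  have self0 : inversions {k} {k} = 0 := by simp [inversions]
  -- `k` is not in `u'`
  have hk : ∀ u' : Finset (Fin n), k ∉ u' → inversions {k} u' + inversions u' {k} = #u' := by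
    intro u' h
    simpa using inv_comm (u := {k}) (v := u') (by simpa using h)
  rw [mul_mono, map_smul, D_inr_mono, D_inr_mono, D_inr_mono]
  simp only [card_lt_eq]
  by_cases hu : k ∈ u
  · obtain ⟨u', hu', rfl⟩ : ∃ u', k ∉ u' ∧ {k} ∪ u' = u :=
      ⟨u.erase k, by simp, by rw [← insert_eq, insert_erase hu]⟩
    have eu : ({k} ∪ u').erase k = u' := by rw [← insert_eq, erase_insert hu']
    have du : Disjoint {k} u' := by simpa using hu'
    have cu : #({k} ∪ u') = 1 + #u' := by rw [card_union_of_disjoint du]; simp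
    by_cases hv : k ∈ v
    · obtain ⟨v', hv', rfl⟩ : ∃ v', k ∉ v' ∧ {k} ∪ v' = v :=
        ⟨v.erase k, by simp, by rw [← insert_eq, insert_erase hv]⟩
      have ev : ({k} ∪ v').erase k = v' := by rw [← insert_eq, erase_insert hv']
      have dv : Disjoint {k} v' := by simpa using hv'
      have hnd : ¬ Disjoint ({k} ∪ u') ({k} ∪ v') := by simp
      rw [coeff_zero_of_not_disjoint hnd, zero_smul, if_pos hu, if_pos hv, eu, ev,
        map_smul, map_smul, LinearMap.smul_apply, mul_mono, mul_mono]
      have hun : {k} ∪ u' ∪ v' = u' ∪ ({k} ∪ v') := by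
        rw [union_comm {k} u', union_assoc]
      simp only [hun, smul_smul, ← add_smul]
      symm
      convert zero_smul F _
      unfold coeff
      by_cases hd : Disjoint u' v'
      · have d1 : Disjoint u' ({k} ∪ v') := by
          rw [disjoint_union_right]; exact ⟨du.symm, hd⟩
        have d2 : Disjoint ({k} ∪ u') v' := by
          rw [disjoint_union_left]; exact ⟨dv, hd⟩
        simp only [d1, d2, if_true, inv_union_left du, inv_union_right du, inv_union_right dv,
          self0, zero_add, ← mul_assoc, ← pow_add, cu]
        rw [← add_mul]
        convert zero_mul _
        have := hk u' hu'
        rw [neg_one_pow_eq (F := F) (y := inversions {k} u' + (inversions u' {k} +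
          inversions u' v') + 1) (x := 1 + #u' + (inversions {k} v' + (inversions {k} v' +
          inversions u' v'))) (by omega), pow_succ]
        ring
      · have d1 : ¬ Disjoint u' ({k} ∪ v') := by
          rw [disjoint_union_right]; exact fun h => hd h.2
        have d2 : ¬ Disjoint ({k} ∪ u') v' := by
          rw [disjoint_union_left]; exact fun h => hd h.2
        rw [if_neg d2, if_neg d1]; simp
    · have dv : Disjoint {k} v := by simpa using hv
      have hun : ({k} ∪ u' ∪ v).erase k = u' ∪ v := by
        rw [union_assoc, ← insert_eq, erase_insert]; simp [hu', hv]
      have huv : k ∈ {k} ∪ u' ∪ v := by simp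
      rw [if_pos hu, if_neg hv, if_pos huv, hun, eu, map_zero, smul_zero, add_zero,
        map_smul, LinearMap.smul_apply, mul_mono, smul_smul, smul_smul]
      congr 1
      unfold coeff
      by_cases hd : Disjoint u' v
      · have d2 : Disjoint ({k} ∪ u') v := by
          rw [disjoint_union_left]; exact ⟨dv, hd⟩
        have d3 : Disjoint {k} (u' ∪ v) := by
          rw [disjoint_union_right]; exact ⟨du, dv⟩
        simp only [hd, d2, if_true]
        rw [union_assoc, inv_union_left du, inv_union_right d3, inv_union_right hd, inv_union_right du,
          self0, mul_right_comm, ← pow_add, ← mul_assoc, ← pow_add]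
        congr 1
        apply neg_one_pow_eq
        omega
      · simp [hd]
  · have du : Disjoint u {k} := by simpa using hu
    by_cases hv : k ∈ v
    · obtain ⟨v', hv', rfl⟩ : ∃ v', k ∉ v' ∧ {k} ∪ v' = v :=
        ⟨v.erase k, by simp, by rw [← insert_eq, insert_erase hv]⟩
      have ev : ({k} ∪ v').erase k = v' := by rw [← insert_eq, erase_insert hv']
      have dv : Disjoint {k} v' := by simpa using hv'
      have hun : (u ∪ ({k} ∪ v')).erase k = u ∪ v' := by
        rw [union_left_comm, ← insert_eq, erase_insert]; simp [hu, hv']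
      have huv : k ∈ u ∪ ({k} ∪ v') := by simp
      rw [if_neg hu, if_pos hv, if_pos huv, hun, ev, map_zero, LinearMap.zero_apply, zero_add,
        map_smul, mul_mono, smul_smul, smul_smul, smul_smul]
      congr 1
      unfold coeff
      by_cases hd : Disjoint u v'
      · have d2 : Disjoint u ({k} ∪ v') := by
          rw [disjoint_union_right]; exact ⟨du, hd⟩
        simp only [hd, d2, if_true]
        rw [inv_union_right d2, inv_union_right dv, inv_union_right dv, self0,
          mul_right_comm, ← pow_add, ← mul_assoc, ← pow_add, ← pow_add]
        congr 1
        apply neg_one_pow_eq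
        have := hk u hu
        omega
      · simp [hd]
    · have huv : k ∉ u ∪ v := by simp [hu, hv]
      simp [hu, hv, huv]

lemma leibniz (r : Var m n) (f g : Alg F m n) :
    D r (mul f g) = mul (D r f) g + mul (twist (tau r) f) (D r g) := by
  have h1 : (mul.compr₂ (D r) : Alg F m n →ₗ[F] _ →ₗ[F] _) =
      mul ∘ₗ D r + (mul ∘ₗ twist (tau r)).compl₂ (D r) := by
    refine ext_mono fun a => ext_mono fun b => ?_
    cases r with
    | inl i => simpa [twist_mono, tau] using leibniz_inl_mono i a b
    | inr k => simpa [twist_mono, tau] using leibniz_inr_mono k a b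
  exact LinearMap.congr_fun (LinearMap.congr_fun h1 f) g

lemma D_comm (r s : Var m n) :
    D (F := F) r ∘ₗ D s = (-1 : F) ^ (tau r * tau s) • (D s ∘ₗ D r) := by
  refine ext_mono fun a => ?_
  obtain ⟨α, u⟩ := a
  rcases r with i | k <;> rcases s with j | l
  · simp only [LinearMap.comp_apply, tau, zero_mul, pow_zero, one_smul]
    by_cases hij : i = j
    · rw [hij]
    · have hji : ¬ j = i := fun h => hij h.symm
      by_cases h1 : α i = 0 <;> by_cases h2 : α j = 0 <;>
        simp [D_inl_mono, h1, h2, hij, hji]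
      rw [tsub_right_comm]
  · simp only [LinearMap.comp_apply, tau, zero_mul, pow_zero, one_smul]
    by_cases h1 : α i = 0 <;> by_cases h2 : l ∈ u <;> simp [D_inl_mono, D_inr_mono, h1, h2]
  · simp only [LinearMap.comp_apply, tau, mul_zero, pow_zero, one_smul]
    by_cases h1 : α j = 0 <;> by_cases h2 : k ∈ u <;> simp [D_inl_mono, D_inr_mono, h1, h2]
  · simp only [LinearMap.comp_apply, tau, LinearMap.smul_apply, mul_one, pow_one]
    by_cases hkl : k = l
    · subst hkl
      by_cases hk : k ∈ u <;> simp [D_inr_mono, hk]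
    have hlk : ¬ l = k := fun h => hkl h.symm
    by_cases hk : k ∈ u
    swap
    · by_cases hl : l ∈ u <;> simp [D_inr_mono, hk, hl]
    by_cases hl : l ∈ u
    swap
    · simp [D_inr_mono, hk, hl]
    have hk' : k ∈ u.erase l := by simp [hkl, hk]
    have hl' : l ∈ u.erase k := by simp [hlk, hl]
    simp only [D_inr_mono, hk, hl, hk', hl', if_true, map_smul, smul_smul]
    rw [erase_right_comm, card_lt_eq, card_lt_eq, card_lt_eq, card_lt_eq]
    congr 1
    have ek : ({k} : Finset (Fin n)) ∪ u.erase k = u := by rw [← insert_eq, insert_erase hk]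
    have el : ({l} : Finset (Fin n)) ∪ u.erase l = u := by rw [← insert_eq, insert_erase hl]
    have h1 : inversions {l} u = inversions {l} {k} + inversions {l} (u.erase k) := by
      rw [← inv_union_right (by simp), ek]
    have h2 : inversions {k} u = inversions {k} {l} + inversions {k} (u.erase l) := by
      rw [← inv_union_right (by simp), el]
    have h3 := inv_comm (u := {k}) (v := {l}) (by simpa using hkl)
    rw [h1, h2, ← pow_add, ← pow_add, ← pow_succ']
    apply neg_one_pow_eq
    simp only [card_singleton, mul_one] at h3
    omega

end Basic

section Graded

lemma map_mem_of_supported {M : Type*} [AddCommMonoid M] [Module F M] {s : Set (Expo m n)}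
    {N : Submodule F M} (T : Alg F m n →ₗ[F] M) (h : ∀ a ∈ s, T (mono F a) ∈ N)
    {f : Alg F m n} (hf : f ∈ Submodule.span F (mono F '' s)) : T f ∈ N := by
  have : Submodule.span F (mono F '' s) ≤ N.comap T := by
    rw [Submodule.span_le]
    rintro _ ⟨a, ha, rfl⟩
    exact h a ha
  exact this hf

lemma mono_mem {s : Set (Expo m n)} {a : Expo m n} (h : a ∈ s) :
    mono F a ∈ Submodule.span F (mono F '' s) :=
  Submodule.subset_span ⟨a, h, rfl⟩

lemma homog_congr {q q' : ℕ} (h : q % 2 = q' % 2) : homog F m n q = homog F m n q' := by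
  simp [homog, Nat.ModEq, h]

lemma twist_homog {q : ℕ} {f : Alg F m n} (hf : f ∈ homog F m n q) (r : ℕ) :
    twist r f = (-1 : F) ^ (r * q) • f := by
  have : (twist r - (-1 : F) ^ (r * q) • LinearMap.id : Module.End F (Alg F m n)) f ∈
      (⊥ : Submodule F (Alg F m n)) := by
    refine map_mem_of_supported _ (fun a ha => ?_) hf
    have h : #a.2 ≡ q [MOD 2] := ha
    simp only [Submodule.mem_bot, LinearMap.sub_apply, LinearMap.smul_apply, LinearMap.id_apply,
      twist_mono]
    rw [neg_one_pow_eq (h.mul_left r), sub_self]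
  simpa [sub_eq_zero] using this

lemma D_homog (r : Var m n) {q : ℕ} {f : Alg F m n} (hf : f ∈ homog F m n q) :
    D r f ∈ homog F m n (tau r + q) := by
  refine map_mem_of_supported _ (fun a ha => ?_) hf
  have h : #a.2 ≡ q [MOD 2] := ha
  rcases r with i | k
  · rw [D_inl_mono]
    split_ifs
    · exact zero_mem _
    · exact mono_mem (by simpa [tau] using h)
  · rw [D_inr_mono]
    split_ifs with hk
    · refine Submodule.smul_mem _ _ (mono_mem ?_)
      have := card_erase_add_one hk
      simp only [Nat.ModEq, tau, Set.mem_ofPred_eq] at h ⊢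
      omega
    · exact zero_mem _

lemma D_trunc {p : ℕ} {t : Fin m → ℕ} (r : Var m n) {f : Alg F m n} (hf : f ∈ trunc F n p t) :
    D r f ∈ trunc F n p t := by
  refine map_mem_of_supported _ (fun a ha => ?_) hf
  rcases r with i | k
  · rw [D_inl_mono]
    split_ifs
    · exact zero_mem _
    · exact mono_mem fun j => lt_of_le_of_lt (Nat.sub_le _ _) (ha j)
  · rw [D_inr_mono]
    split_ifs with hk
    · exact Submodule.smul_mem _ _ (mono_mem ha)
    · exact zero_mem _

lemma mul_homog {q q' : ℕ} {f g : Alg F m n} (hf : f ∈ homog F m n q) (hg : g ∈ homog F m n q') :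
    mul f g ∈ homog F m n (q + q') := by
  refine map_mem_of_supported (mul f) (fun b hb => ?_) hg
  refine map_mem_of_supported (mul.flip (mono F b)) (fun a ha => ?_) hf
  rw [LinearMap.flip_apply, mul_mono]
  by_cases hd : Disjoint a.2 b.2
  · refine Submodule.smul_mem _ _ (mono_mem ?_)
    change #(a.2 ∪ b.2) ≡ _ [MOD 2]
    rw [card_union_of_disjoint hd]
    exact Nat.ModEq.add ha hb
  · rw [coeff_zero_of_not_disjoint hd, zero_smul]; exact zero_mem _

lemma dvd_choose_of_carry {p : ℕ} (hp : p.Prime) {t a b : ℕ} (ha : a < p ^ t) (hb : b < p ^ t)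
    (hab : p ^ t ≤ a + b) : p ∣ (a + b).choose a := by
  have ht : t ≠ 0 := by rintro rfl; simp at ha hb hab; omega
  have hne : (a + b).choose a ≠ 0 := (Nat.choose_pos (Nat.le_add_right a b)).ne'
  rw [hp.dvd_iff_one_le_factorization hne, Nat.choose_symm_add, add_comm a b] 
  rw [Nat.add_comm b a, Nat.factorization_choose' hp (Nat.lt_succ_self _), Nat.one_le_iff_ne_zero,
    ← Nat.pos_iff_ne_zero, card_pos]
  refine ⟨t, ?_⟩
  rw [mem_filter, mem_Ico, Nat.mod_eq_of_lt ha, Nat.mod_eq_of_lt hb]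
  refine ⟨⟨Nat.one_le_iff_ne_zero.2 ht, Nat.lt_succ_of_le ?_⟩, by omega⟩
  exact Nat.le_log_of_pow_le hp.one_lt hab

lemma mul_trunc {p : ℕ} [Fact p.Prime] [CharP F p] {t : Fin m → ℕ} {f g : Alg F m n}
    (hf : f ∈ trunc F n p t) (hg : g ∈ trunc F n p t) : mul f g ∈ trunc F n p t := by
  refine map_mem_of_supported (mul f) (fun b hb => ?_) hg
  refine map_mem_of_supported (mul.flip (mono F b)) (fun a ha => ?_) hf
  rw [LinearMap.flip_apply, mul_mono]
  by_cases hd : ∀ i, a.1 i + b.1 i < p ^ t i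
  · exact Submodule.smul_mem _ _ (mono_mem hd)
  · push Not at hd
    obtain ⟨i, hi⟩ := hd
    have : coeff F a b = 0 := by
      unfold coeff
      split_ifs
      · rw [prod_eq_zero (mem_univ i), mul_zero]
        rw [CharP.cast_eq_zero_iff F p]
        exact dvd_choose_of_carry Fact.out (ha i) (hb i) hi
      · rfl
    rw [this, zero_smul]; exact zero_mem _

lemma mul_comm_homog {q q' : ℕ} {f g : Alg F m n} (hf : f ∈ homog F m n q)
    (hg : g ∈ homog F m n q') : mul f g = (-1 : F) ^ (q * q') • mul g f := by
  have : (mul f - (-1 : F) ^ (q * q') • mul.flip f : Module.End F (Alg F m n)) g ∈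
      (⊥ : Submodule F (Alg F m n)) := by
    refine map_mem_of_supported _ (fun b hb => ?_) hg
    have : (mul.flip (mono F b) - (-1 : F) ^ (q * q') • mul (mono F b) :
        Module.End F (Alg F m n)) f ∈ (⊥ : Submodule F (Alg F m n)) := by
      refine map_mem_of_supported _ (fun a ha => ?_) hf
      have h1 : #a.2 ≡ q [MOD 2] := ha
      have h2 : #b.2 ≡ q' [MOD 2] := hb
      simp only [Submodule.mem_bot, LinearMap.sub_apply, LinearMap.smul_apply,
        LinearMap.flip_apply]
      rw [mul_mono_comm, neg_one_pow_eq (h1.mul h2), sub_self]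
    simpa using this
  simpa [sub_eq_zero] using this

lemma homog_disjoint {q : ℕ} {f : Alg F m n} (h : f ∈ homog F m n q)
    (h' : f ∈ homog F m n (q + 1)) : f = 0 := by
  have h1 := (monoBasis F m n).mem_span_image.1 h
  have h2 := (monoBasis F m n).mem_span_image.1 h'
  rw [← (monoBasis F m n).repr.map_eq_zero_iff]
  ext a
  by_contra ha
  have hs : a ∈ ((monoBasis F m n).repr f).support := Finsupp.mem_support_iff.2 ha
  have h3 : #a.2 ≡ q [MOD 2] := h1 hs
  have h4 : #a.2 ≡ q + 1 [MOD 2] := h2 hs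
  simp only [Nat.ModEq] at h3 h4
  omega

end Graded

section Closure

lemma Drs_homog (r s : Var m n) {f : Alg F m n} {q : ℕ} (hf : f ∈ homog F m n q) :
    Drs r s f = (-1 : F) ^ (tau r * tau s) • (mul (D r f) ∘ₗ D s) -
      (-1 : F) ^ ((tau r + tau s) * q) • (mul (D s f) ∘ₗ D r) := by
  rw [Drs, twist_homog hf, map_smul, map_smul, LinearMap.smul_comp]

lemma Drs_apply_homog (r s : Var m n) {f : Alg F m n} {q q' : ℕ} (hf : f ∈ homog F m n q)
    {h : Alg F m n} (hh : h ∈ homog F m n q') :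
    Drs r s f h ∈ homog F m n (tau r + tau s + q + q') := by
  rw [Drs_homog r s hf]
  simp only [LinearMap.sub_apply, LinearMap.smul_apply, LinearMap.comp_apply]
  refine sub_mem (Submodule.smul_mem _ _ ?_) (Submodule.smul_mem _ _ ?_)
  · rw [homog_congr (q' := tau r + q + (tau s + q')) (by omega)]
    exact mul_homog (D_homog r hf) (D_homog s hh)
  · rw [homog_congr (q' := tau s + q + (tau r + q')) (by omega)]
    exact mul_homog (D_homog s hf) (D_homog r hh)

lemma Drs_add (r s : Var m n) (f g : Alg F m n) : Drs r s (f + g) = Drs r s f + Drs r s g := by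
  refine LinearMap.ext fun h => ?_
  simp [Drs]
  module

lemma Drs_smul (r s : Var m n) (c : F) (f : Alg F m n) : Drs r s (c • f) = c • Drs r s f := by
  refine LinearMap.ext fun h => ?_
  simp [Drs]
  module

/-- The `D_{rs}(f)` that are even endomorphisms, with `f` homogeneous. -/
def evenGens (F : Type*) [CommRing F] {m : ℕ} (n p : ℕ) (t : Fin m → ℕ) :
    Set (Module.End F (Alg F m n)) :=
  {T | ∃ r s : Var m n, ∃ f ∈ trunc F n p t, f ∈ homog F m n (tau r + tau s) ∧ T = Drs r s f}

lemma mem_span_evenGens {p : ℕ} {t : Fin m → ℕ} {T : Module.End F (Alg F m n)}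
    (hT : T ∈ special F n p t) (hE : T ∈ evenEnd F m n) :
    T ∈ Submodule.span F (evenGens F n p t) := by
  let odd : Submodule F (Module.End F (Alg F m n)) :=
    { carrier := {T | ∀ q, ∀ f ∈ homog F m n q, T f ∈ homog F m n (q + 1)}
      add_mem' := fun hS hT q f hf => add_mem (hS q f hf) (hT q f hf)
      zero_mem' := fun q _ _ => (homog F m n (q + 1)).zero_mem
      smul_mem' := fun c _ hT q f hf => (homog F m n (q + 1)).smul_mem c (hT q f hf) }
  have hev : Submodule.span F (evenGens F n p t) ≤ evenEnd F m n := by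
    rw [Submodule.span_le]
    rintro _ ⟨r, s, f, -, hf, rfl⟩ q h hh
    rw [homog_congr (q' := tau r + tau s + (tau r + tau s) + q) (by omega)]
    exact Drs_apply_homog r s hf hh
  have hle : special F n p t ≤ Submodule.span F (evenGens F n p t) ⊔ odd := by
    refine Submodule.span_le.2 ?_
    rintro _ ⟨r, s, f, hf, rfl⟩
    let L : Alg F m n →ₗ[F] Module.End F (Alg F m n) :=
      { toFun := Drs r s, map_add' := Drs_add r s, map_smul' := Drs_smul r s }
    refine map_mem_of_supported L (fun a ha => ?_) hf
    by_cases hpar : #a.2 % 2 = (tau r + tau s) % 2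
    · exact Submodule.mem_sup_left (Submodule.subset_span ⟨r, s, _, mono_mem ha,
        mono_mem hpar, rfl⟩)
    · refine Submodule.mem_sup_right fun q h hh => ?_
      rw [homog_congr (q' := tau r + tau s + #a.2 + q) (by omega)]
      exact Drs_apply_homog r s (mono_mem (Nat.ModEq.refl _)) hh
  obtain ⟨y, hy, z, hz, rfl⟩ := Submodule.mem_sup.1 (hle hT)
  have hz' : z ∈ evenEnd F m n := by
    have h := sub_mem hE (hev hy)
    rwa [show y + z - y = z from LinearMap.ext fun h => by simp] at h
  have : z = 0 := by
    refine ext_mono fun a => ?_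
    have ha : mono F a ∈ homog F m n #a.2 := mono_mem (Nat.ModEq.refl _)
    exact homog_disjoint (hz' _ _ ha) (hz _ _ ha)
  simpa [this] using hy

/-- Every even element of `S` is an even derivation with truncated coefficients and zero
divergence. -/
lemma exists_coeffs {p : ℕ} {t : Fin m → ℕ} {T : Module.End F (Alg F m n)}
    (hT : T ∈ Submodule.span F (evenGens F n p t)) :
    ∃ e : Var m n → Alg F m n, (∀ k, e k ∈ trunc F n p t) ∧ (∀ k, e k ∈ homog F m n (tau k)) ∧
      ∑ k, (-1 : F) ^ tau k • D k (e k) = 0 ∧ T = ∑ k, mul (e k) ∘ₗ D k := by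
  induction hT using Submodule.span_induction with
  | mem x hx =>
    obtain ⟨r, s, f, hf, hp, rfl⟩ := hx
    refine ⟨Pi.single s ((-1 : F) ^ (tau r * tau s) • D r f) -
      Pi.single r ((-1 : F) ^ ((tau r + tau s) * (tau r + tau s)) • D s f), ?_, ?_, ?_, ?_⟩
    · intro k
      refine sub_mem ?_ ?_
      · by_cases h : k = s
        · subst h; simpa using Submodule.smul_mem _ _ (D_trunc r hf)
        · simp [h]
      · by_cases h : k = r
        · subst h; simpa using Submodule.smul_mem _ _ (D_trunc s hf)
        · simp [h]
    · intro k
      refine sub_mem ?_ ?_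
      · by_cases h : k = s
        · subst h
          rw [Pi.single_eq_same, homog_congr (q' := tau r + (tau r + tau k)) (by omega)]
          exact Submodule.smul_mem _ _ (D_homog r hp)
        · simp [h]
      · by_cases h : k = r
        · subst h
          rw [Pi.single_eq_same, homog_congr (q' := tau s + (tau k + tau s)) (by omega)]
          exact Submodule.smul_mem _ _ (D_homog s hp)
        · simp [h]
    · have h1 : ∀ (j : Var m n) (x : Alg F m n),
          ∑ k, (-1 : F) ^ tau k • D k ((Pi.single j x : Var m n → Alg F m n) k) =
            (-1 : F) ^ tau j • D j x := by
        intro j x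
        rw [sum_eq_single j (fun k _ hk => by simp [hk]) (by simp)]
        simp
      simp only [Pi.sub_apply, map_sub, smul_sub, sum_sub_distrib, h1, map_smul]
      have h2 := LinearMap.congr_fun (D_comm (F := F) r s) f
      simp only [LinearMap.comp_apply, LinearMap.smul_apply] at h2
      rw [h2]
      simp only [smul_smul, ← pow_add]
      rw [← sub_smul]
      convert zero_smul F _
      rw [sub_eq_zero]
      apply neg_one_pow_eq
      rcases r with i | i <;> rcases s with j | j <;> simp [tau]
    · have h1 : ∀ (j : Var m n) (x : Alg F m n),
          ∑ k, mul ((Pi.single j x : Var m n → Alg F m n) k) ∘ₗ D k = mul x ∘ₗ D j := by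
        intro j x
        rw [sum_eq_single j (fun k _ hk => by simp [hk]) (by simp)]
        simp
      refine LinearMap.ext fun h => ?_
      have h2 : ∀ j x, ∑ k, mul ((Pi.single j x : Var m n → Alg F m n) k) (D k h) =
          mul x (D j h) := fun j x => by
        simpa [LinearMap.sum_apply] using LinearMap.congr_fun (h1 j x) h
      simp only [LinearMap.sum_apply, LinearMap.comp_apply, Pi.sub_apply, map_sub,
        LinearMap.sub_apply, sum_sub_distrib, h2, map_smul, LinearMap.smul_apply,
        Drs_homog r s hp]
  | zero => exact ⟨0, by simp, by simp, by simp, by simp⟩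
  | add x y _ _ hx hy =>
    obtain ⟨e, h1, h2, h3, rfl⟩ := hx
    obtain ⟨e', h1', h2', h3', rfl⟩ := hy
    refine ⟨e + e', fun k => add_mem (h1 k) (h1' k), fun k => add_mem (h2 k) (h2' k), ?_, ?_⟩
    · simp [sum_add_distrib, h3, h3']
    · simp [sum_add_distrib, LinearMap.add_comp]
  | smul c x _ hx =>
    obtain ⟨e, h1, h2, h3, rfl⟩ := hx
    refine ⟨c • e, fun k => Submodule.smul_mem _ _ (h1 k), fun k => Submodule.smul_mem _ _ (h2 k),
      ?_, ?_⟩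
    · simp only [Pi.smul_apply, map_smul, smul_comm _ c, ← smul_sum, h3, smul_zero]
    · simp [LinearMap.smul_comp, smul_sum]

lemma der_mul {e : Var m n → Alg F m n} (he : ∀ k, e k ∈ homog F m n (tau k))
    {f : Alg F m n} {q : ℕ} (hf : f ∈ homog F m n q) (g : Alg F m n) :
    (∑ k, mul (e k) ∘ₗ D k) (mul f g) =
      mul ((∑ k, mul (e k) ∘ₗ D k) f) g + mul f ((∑ k, mul (e k) ∘ₗ D k) g) := by
  simp only [LinearMap.sum_apply, LinearMap.comp_apply, map_sum, ← sum_add_distrib]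
  refine sum_congr rfl fun k _ => ?_
  rw [leibniz, twist_homog hf, map_add, map_smul, LinearMap.smul_apply, map_smul,
    ← mul_assoc', ← mul_assoc', ← mul_assoc', mul_comm_homog (he k) hf, map_smul,
    LinearMap.smul_apply, smul_smul, ← pow_add, ← two_mul, pow_mul]
  simp

lemma der_D {e : Var m n → Alg F m n} (he : ∀ k, e k ∈ homog F m n (tau k))
    (r : Var m n) (h : Alg F m n) :
    (∑ k, mul (e k) ∘ₗ D k) (D r h) =
      D r ((∑ k, mul (e k) ∘ₗ D k) h) - ∑ k, mul (D r (e k)) (D k h) := by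
  simp only [LinearMap.sum_apply, LinearMap.comp_apply, map_sum, ← sum_sub_distrib]
  refine sum_congr rfl fun k _ => ?_
  have h2 := LinearMap.congr_fun (D_comm (F := F) r k) h
  simp only [LinearMap.comp_apply, LinearMap.smul_apply] at h2
  rw [leibniz, twist_homog (he k), map_smul, LinearMap.smul_apply, h2, map_smul, smul_smul,
    ← pow_add, ← two_mul, pow_mul]
  simp

lemma bracket_term {e : Var m n → Alg F m n} (he : ∀ k, e k ∈ homog F m n (tau k))
    (u v k : Var m n) {f : Alg F m n} (hf : f ∈ homog F m n (tau u + tau v))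
    (h : Alg F m n) :
    (-1 : F) ^ (tau u * tau v) • (mul (mul (D u (e k)) (D k f)) (D v h) +
        mul (D u f) (mul (D v (e k)) (D k h))) -
      (-1 : F) ^ ((tau u + tau v) * (tau u + tau v)) • (mul (mul (D v (e k)) (D k f)) (D u h) +
        mul (D v f) (mul (D u (e k)) (D k h))) =
    (-1 : F) ^ (tau u * tau v + tau k * tau v + tau k * tau u + tau k) •
      (Drs k v (mul (D u (e k)) f) h -
        (-1 : F) ^ (tau u * tau v + tau u + tau v) • Drs k u (mul (D v (e k)) f) h) -
    (-1 : F) ^ tau k •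
      ((-1 : F) ^ (tau u * tau v) • mul (mul (D u (D k (e k))) f) (D v h) -
        (-1 : F) ^ (tau u + tau v) • mul (mul (D v (D k (e k))) f) (D u h)) := by
  have hu := D_homog u (he k)
  have hv := D_homog v (he k)
  have c1 := LinearMap.congr_fun (D_comm (F := F) k u) (e k)
  have c2 := LinearMap.congr_fun (D_comm (F := F) k v) (e k)
  have c3 := LinearMap.congr_fun (D_comm (F := F) v u) (e k)
  simp only [LinearMap.comp_apply, LinearMap.smul_apply] at c1 c2 c3
  rw [Drs_homog k v (mul_homog hu hf), Drs_homog k u (mul_homog hv hf)]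
  simp only [LinearMap.sub_apply, LinearMap.smul_apply, LinearMap.comp_apply, leibniz,
    twist_homog hu, twist_homog hv, c1, c2, c3]
  rw [← mul_assoc' (D u f), ← mul_assoc' (D v f), mul_comm_homog (D_homog u hf) hv,
    mul_comm_homog (D_homog v hf) hu]
  rcases u with u | u <;> rcases v with v | v <;> rcases k with k | k <;>
    simp [tau] <;> module

lemma bracket_mem {e : Var m n → Alg F m n} (he : ∀ k, e k ∈ homog F m n (tau k))
    {p : ℕ} [Fact p.Prime] [CharP F p] {t : Fin m → ℕ}
    (ht : ∀ k, e k ∈ trunc F n p t) (hdiv : ∑ k, (-1 : F) ^ tau k • D k (e k) = 0)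
    (u v : Var m n) {f : Alg F m n} (hft : f ∈ trunc F n p t)
    (hf : f ∈ homog F m n (tau u + tau v)) :
    (∑ k, mul (e k) ∘ₗ D k) * Drs u v f - Drs u v f * (∑ k, mul (e k) ∘ₗ D k) ∈
      special F n p t := by
  have hDrs : ∀ r s : Var m n, ∀ g ∈ trunc F n p t, Drs r s g ∈ special F n p t :=
    fun r s g hg => Submodule.subset_span ⟨r, s, g, hg, rfl⟩
  set E : Module.End F (Alg F m n) := ∑ k, mul (e k) ∘ₗ D k with hE
  have hEf : E f ∈ trunc F n p t := by
    rw [hE, LinearMap.sum_apply]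
    exact sum_mem fun k _ => mul_trunc (ht k) (D_trunc k hft)
  have hEp : E f ∈ homog F m n (tau u + tau v) := by
    rw [hE, LinearMap.sum_apply]
    refine sum_mem fun k _ => ?_
    rw [homog_congr (q' := tau k + (tau k + (tau u + tau v))) (by omega)]
    exact mul_homog (he k) (D_homog k hf)
  have key : E * Drs u v f - Drs u v f * E = Drs u v (E f) -
      ∑ k, (-1 : F) ^ (tau u * tau v + tau k * tau v + tau k * tau u + tau k) •
        (Drs k v (mul (D u (e k)) f) -
          (-1 : F) ^ (tau u * tau v + tau u + tau v) • Drs k u (mul (D v (e k)) f)) := by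
    refine LinearMap.ext fun h => ?_
    have hz : ∀ w z : Var m n,
        ∑ k, (-1 : F) ^ tau k • mul (mul (D w (D k (e k))) f) (D z h) = 0 := by
      intro w z
      have := congrArg (fun x => mul (mul (D w x) f) (D z h)) hdiv
      simpa [map_sum, LinearMap.sum_apply] using this
    have hsum := sum_congr (rfl : (univ : Finset (Var m n)) = univ)
      fun k _ => bracket_term he u v k hf h
    rw [sum_sub_distrib (s := univ) (f := fun k => (-1 : F) ^ (tau u * tau v + tau k * tau v +
      tau k * tau u + tau k) • (Drs k v (mul (D u (e k)) f) h -
        (-1 : F) ^ (tau u * tau v + tau u + tau v) • Drs k u (mul (D v (e k)) f) h))] at hsum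
    have hres : ∑ k, (-1 : F) ^ tau k •
        ((-1 : F) ^ (tau u * tau v) • mul (mul (D u (D k (e k))) f) (D v h) -
        (-1 : F) ^ (tau u + tau v) • mul (mul (D v (D k (e k))) f) (D u h)) = 0 := by
      simp only [smul_sub, smul_comm ((-1 : F) ^ tau _), sum_sub_distrib, ← smul_sum, hz,
        smul_zero, sub_zero]
    rw [hres, sub_zero] at hsum
    simp only [LinearMap.sub_apply, LinearMap.sum_apply, LinearMap.smul_apply]
    rw [← hsum, Module.End.mul_apply,
      Module.End.mul_apply, Drs_homog u v hf, Drs_homog u v hEp]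
    simp only [LinearMap.sub_apply, LinearMap.smul_apply, LinearMap.comp_apply, map_sub, map_smul,
      hE, der_mul he (D_homog u hf), der_mul he (D_homog v hf), der_D he]
    simp only [map_sum, LinearMap.sum_apply, sum_sub_distrib, sum_add_distrib, ← smul_sum]
    module
  rw [key]
  refine sub_mem (hDrs _ _ _ hEf) (sum_mem fun k _ => Submodule.smul_mem _ _ (sub_mem
    (hDrs _ _ _ ?_) (Submodule.smul_mem _ _ (hDrs _ _ _ ?_))))
  · exact mul_trunc (D_trunc u (ht k)) hft
  · exact mul_trunc (D_trunc v (ht k)) hft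

end Closure

/-- The even part of the special Lie superalgebra `S(m,n;t)`, a Lie algebra under the commutator. -/
def evenSpecial (F : Type*) [CommRing F] {m : ℕ} (n p : ℕ) [Fact p.Prime] [CharP F p]
    (t : Fin m → ℕ) : LieSubalgebra F (Module.End F (Alg F m n)) where
  toSubmodule := special F n p t ⊓ evenEnd F m n
  lie_mem' := by
    rintro x y ⟨hx, hx'⟩ ⟨hy, hy'⟩
    change x * y - y * x ∈ special F n p t ⊓ evenEnd F m n
    refine ⟨?_, fun q f hf => ?_⟩
    · obtain ⟨e, h1, h2, h3, rfl⟩ := exists_coeffs (mem_span_evenGens hx hx')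
      have hy2 := mem_span_evenGens hy hy'
      clear hy hy'
      induction hy2 using Submodule.span_induction with
      | mem y hy =>
        obtain ⟨u, v, f, hf, hp, rfl⟩ := hy
        exact bracket_mem h2 h1 h3 u v hf hp
      | zero => rw [mul_zero, zero_mul, sub_zero]; exact Submodule.zero_mem _
      | add y z _ _ hy hz =>
        rw [mul_add, add_mul, add_sub_add_comm]
        exact Submodule.add_mem _ hy hz
      | smul c y _ hy =>
        rw [mul_smul_comm, smul_mul_assoc, ← smul_sub]
        exact Submodule.smul_mem _ _ hy
    · exact sub_mem (hx' q _ (hy' q f hf)) (hy' q _ (hx' q f hf))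

lemma evenSpecial_bracket {p : ℕ} [Fact p.Prime] [CharP F p] {t : Fin m → ℕ}
    (x y : evenSpecial F n p t) :
    ((⁅x, y⁆ : evenSpecial F n p t) : Module.End F (Alg F m n)) =
      (x : Module.End F (Alg F m n)) * y - (y : Module.End F (Alg F m n)) * x := rfl

end ModularCartan

end

/-! Let W be the space of even fields Σ f_k D_k with truncated coefficients. Every derivation of the
even part of S has the form y ↦ [E, y] + Σ ν_{i,s} [D_i^{p^s}, y], with E in W of constant
divergence and 1 ≤ s < t_i, and E and ν are unique. The dimension is then a count. W has dimension
(m+n) 2^{n-1} p^{Σt}. The divergence maps W onto the span of the even truncated monomials other than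
the top one, which is itself even exactly when n is even. Requiring only constant divergence leaves
the constant monomial free. So the fields E form a space of dimension (m+n-1) 2^{n-1} p^{Σt} + 2 (n
even) or + 1 (n odd), and the p-powers add Σ(t_i - 1).

Uniqueness: the p-powers kill the D_i, the torus x_i D_i + x_l D_l, the odd rotations x_k D_l and
the pairs x_a x_b D_i. These elements already have trivial centraliser in W
(`eq_zero_of_lie_eq_zero`), so E = 0. The fields x_q^(p^s) D_j then detect ν.

Existence: a derivation ψ is viewed with values in W and normalised by subtracting brackets. A
Poincaré lemma makes it vanish on the D_i (`IsFieldDer.exists_lie_D`). Dividing by nonzero weights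
makes it vanish on the torus (`IsFieldDer.exists_isWeightDer`). It then acts by scalars on the
rotations and on the pairs, and a field Σ s_l x_l D_l removes these on all rotations and on one pair
(`IsWeightDer.exists_isReducedDer`). The p-powers of the D_i remove one coefficient at each
x_q^(p^s) D_j (`IsReducedDer.exists_isNormalDer`).

A derivation normalised in this way is zero (`IsNormalDer.eq_zero`), by induction on the degree in
the even variables. If ψ kills every [D_i, y], then ψ(y) commutes with the D_i, so its coefficients
are free of even variables, and it has the torus weight of y. Usually no such field has this weight,
because 2 and 3 are invertible. The other y are obtained from brackets of elements already killed,
except at the p-powers x_q^(p^s) D_j, where the last normalisation is used.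

Finally E has constant divergence, because E normalises the even part of S and that property is
equivalent to constant divergence (`mem_ker_divCoeffs_iff`). -/

noncomputable section

open Finset

attribute [local instance] LieRing.ofAssociativeRing

namespace ModularCartan

/-! ### Monomial coordinates and Euler fields -/

section Coordinates

variable {F : Type*} [CommRing F] {m n : ℕ}

/-- The exponent of a variable. -/
def varExpo : Var m n → Expo m n
  | Sum.inl i => (Pi.single i 1, ∅)
  | Sum.inr l => (0, {l})

variable (F) in
/-- The variables, as elements of the superalgebra. -/
def X (r : Var m n) : Alg F m n := mono F (varExpo r)

variable (F m n) in
/-- The unit of the superalgebra. -/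
def one : Alg F m n := mono F (0, ∅)

/-- The coefficient of a monomial. -/
def co (a : Expo m n) : Alg F m n →ₗ[F] F := (monoBasis F m n).coord a

lemma co_mono (a b : Expo m n) : co a (mono F b) = if b = a then 1 else 0 := by
  simp [co, mono, Finsupp.single_apply]

lemma ext_co {f g : Alg F m n} (h : ∀ a, co a f = co a g) : f = g :=
  (monoBasis F m n).ext_elem h

lemma mono_homog (a : Expo m n) {q : ℕ} (h : #a.2 % 2 = q % 2) : mono F a ∈ homog F m n q :=
  mono_mem h

lemma mono_trunc {p : ℕ} {t : Fin m → ℕ} {a : Expo m n} (h : ∀ i, a.1 i < p ^ t i) :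
    mono F a ∈ trunc F n p t :=
  mono_mem h

lemma co_homog {q : ℕ} {f : Alg F m n} (hf : f ∈ homog F m n q) {a : Expo m n}
    (ha : co a f ≠ 0) : #a.2 % 2 = q % 2 := by
  have h1 := (monoBasis F m n).mem_span_image.1 hf
  exact h1 (Finsupp.mem_support_iff.2 ha)

lemma co_trunc {p : ℕ} {t : Fin m → ℕ} {f : Alg F m n} (hf : f ∈ trunc F n p t) {a : Expo m n}
    (ha : co a f ≠ 0) (i : Fin m) : a.1 i < p ^ t i := by
  have h1 := (monoBasis F m n).mem_span_image.1 hf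
  exact h1 (Finsupp.mem_support_iff.2 ha) i

lemma mem_span_mono {s : Set (Expo m n)} {f : Alg F m n} (h : ∀ a, co a f ≠ 0 → a ∈ s) :
    f ∈ Submodule.span F (mono F '' s) :=
  (monoBasis F m n).mem_span_image.2 fun a ha => h a (Finsupp.mem_support_iff.1 ha)

lemma one_mul' (f : Alg F m n) : mul (one F m n) f = f := by
  have : mul (one F m n) = LinearMap.id := by
    refine ext_mono fun a => ?_
    rw [one, mul_mono]
    simp [coeff, inversions]
  rw [this]; rfl

lemma mul_one' (f : Alg F m n) : mul f (one F m n) = f := by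
  have : mul.flip (one F m n) = LinearMap.id := by
    refine ext_mono fun a => ?_
    rw [LinearMap.flip_apply, one, mul_mono]
    simp [coeff, inversions]
  exact LinearMap.congr_fun this f

lemma D_one (r : Var m n) : D r (one F m n) = 0 := by
  cases r <;> simp [one, D_inl_mono, D_inr_mono]

lemma D_X (r s : Var m n) : D r (X F s) = if r = s then one F m n else 0 := by
  rcases r with i | k <;> rcases s with j | l
  · simp only [X, varExpo, D_inl_mono, one, Pi.single_apply, Sum.inl.injEq]
    by_cases h : i = j
    · subst h; simp
    · simp [h]
  · simp [X, varExpo, D_inl_mono]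
  · simp [X, varExpo, D_inr_mono]
  · simp only [X, varExpo, D_inr_mono, one, Sum.inr.injEq, mem_singleton]
    by_cases h : k = l
    · subst h; simp [filter_singleton]
    · simp [h]

lemma X_homog (r : Var m n) : X F r ∈ homog F m n (tau r) := by
  cases r <;> exact mono_homog _ (by simp [varExpo, tau])

lemma co_D_inl (i : Fin m) (a : Expo m n) (f : Alg F m n) :
    co a (D (Sum.inl i) f) = co (a.1 + Pi.single i 1, a.2) f := by
  have : co a ∘ₗ D (Sum.inl i) = co (F := F) (a.1 + Pi.single i 1, a.2) := by
    refine ext_mono fun b => ?_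
    rw [LinearMap.comp_apply, D_inl_mono, co_mono]
    split_ifs with h1 h2 h2
    · subst h2; simp at h1
    · simp
    · subst h2; simp [co_mono]
    · rw [co_mono, if_neg]
      rintro rfl
      apply h2
      refine Prod.ext (funext fun j => ?_) rfl
      by_cases hj : j = i
      · subst hj; simp; omega
      · simp [hj]
  exact LinearMap.congr_fun this f

/-- The degree of a monomial in a variable. -/
def deg : Var m n → Expo m n → ℕ
  | Sum.inl i, a => a.1 i
  | Sum.inr l, a => if l ∈ a.2 then 1 else 0

/-- The field `f D_k`, linear in `f`. -/
def vf (k : Var m n) : Alg F m n →ₗ[F] Module.End F (Alg F m n) where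
  toFun f := mul f ∘ₗ D k
  map_add' f g := by rw [map_add, LinearMap.add_comp]
  map_smul' c f := by rw [map_smul, LinearMap.smul_comp]; rfl

lemma vf_apply (k : Var m n) (f g : Alg F m n) : vf k f g = mul f (D k g) := rfl

variable (F) in
/-- The Euler field of a variable. -/
def eul (r : Var m n) : Module.End F (Alg F m n) := vf r (X F r)

lemma coeff_of_disjoint {a b : Expo m n} (h : Disjoint a.2 b.2) : coeff F a b =
    (-1) ^ inversions a.2 b.2 * ∏ i, (((a.1 i + b.1 i).choose (a.1 i) : ℕ) : F) :=
  if_pos h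

lemma eul_mono (r : Var m n) (a : Expo m n) : eul F r (mono F a) = (deg r a : F) • mono F a := by
  rw [eul, vf_apply]
  rcases r with i | l
  · rw [D_inl_mono, X]
    simp only [deg]
    split_ifs with h
    · simp [h]
    · rw [mul_mono]
      simp only [varExpo, coeff, disjoint_empty_left, if_true, empty_union]
      congr 1
      · rw [prod_eq_single i]
        · simp only [inversions, sum_empty, pow_zero, Pi.single_eq_same, Pi.sub_apply, one_mul]
          rw [Nat.choose_one_right]
          congr 1; omega
        · intro j _ hj; simp [hj]
        · simp
      · congr 1
        refine Prod.ext (funext fun j => ?_) rfl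
        by_cases hj : j = i
        · subst hj; simp; omega
        · simp [hj]
  · rw [D_inr_mono, X]
    simp only [deg]
    split_ifs with h
    · rw [map_smul, mul_mono, coeff_of_disjoint (by simp [varExpo]), smul_smul, card_lt_eq]
      simp only [varExpo, zero_add]
      have h2 : inversions {l} a.2 = inversions {l} (a.2.erase l) := by
        conv_lhs => rw [← insert_erase h, insert_eq, inv_union_right (by simp)]
        simp [inversions]
      rw [h2, ← mul_assoc, ← pow_add, ← two_mul, pow_mul]
      simp [insert_erase h]
    · simp

lemma eul_X (r s : Var m n) : eul F r (X F s) = (if r = s then (1 : F) else 0) • X F s := by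
  rw [eul, vf_apply, D_X]
  split_ifs with h
  · subst h; rw [mul_one', one_smul]
  · simp

lemma co_eul (r : Var m n) (a : Expo m n) (f : Alg F m n) :
    co a (eul F r f) = (deg r a : F) * co a f := by
  have : co a ∘ₗ eul F r = (deg r a : F) • co (F := F) a := by
    refine ext_mono fun b => ?_
    rw [LinearMap.comp_apply, eul_mono, map_smul, LinearMap.smul_apply, co_mono]
    split_ifs with h
    · rw [h]
    · simp
  exact LinearMap.congr_fun this f

/-- `D u` lowers the degree in its own variable by one; when it kills the monomial both sides are
zero. -/
lemma eul_D (r u : Var m n) (a : Expo m n) : eul F r (D u (mono F a)) =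
    ((deg r a : F) - if r = u then 1 else 0) • D u (mono F a) := by
  rcases u with i | l
  · rw [D_inl_mono]
    split_ifs with h1 h2 h2
    · simp
    · simp
    · subst h2; rw [eul_mono]; simp only [deg]; congr 1
      simp [Nat.cast_sub (Nat.one_le_iff_ne_zero.2 h1)]
    · rw [eul_mono, sub_zero]; congr 2
      rcases r with j | k
      · have : j ≠ i := fun h => h2 (by rw [h])
        simp [deg, this]
      · rfl
  · rw [D_inr_mono]
    split_ifs with h1 h2 h2
    · subst h2; rw [map_smul, eul_mono]; simp [deg, h1]
    · have h3 : deg r ((a.1, a.2.erase l) : Expo m n) = deg r a := by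
        rcases r with j | k
        · rfl
        · have : k ≠ l := fun h => h2 (by rw [h])
          simp [deg, this]
      rw [map_smul, eul_mono, sub_zero, smul_comm, h3]
    · rw [map_zero, smul_zero]
    · rw [map_zero, smul_zero]

end Coordinates

/-! ### Brackets of even fields and of the D_{rs} -/

section Brackets

variable {F : Type*} [CommRing F] {m n : ℕ}

lemma lie_apply (S T : Module.End F (Alg F m n)) (f : Alg F m n) :
    ⁅S, T⁆ f = S (T f) - T (S f) := by
  rw [Ring.lie_def]; rfl

lemma lie_vf {k l : Var m n} {f g : Alg F m n} (hf : f ∈ homog F m n (tau k))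
    (hg : g ∈ homog F m n (tau l)) :
    ⁅vf k f, vf l g⁆ = vf l (vf k f g) - vf k (vf l g f) := by
  refine LinearMap.ext fun h => ?_
  have h2 := LinearMap.congr_fun (D_comm (F := F) k l) h
  simp only [LinearMap.comp_apply, LinearMap.smul_apply] at h2
  simp only [lie_apply, LinearMap.sub_apply, vf_apply, leibniz, twist_homog hf, twist_homog hg,
    map_add, ← mul_assoc', map_smul, h2, mul_comm_homog hg hf, LinearMap.smul_apply]
  rcases k with k | k <;> rcases l with l | l <;> simp [tau]

lemma Drs_eq {r s : Var m n} {f : Alg F m n} (hf : f ∈ homog F m n (tau r + tau s)) :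
    Drs r s f = (-1 : F) ^ (tau r * tau s) • vf s (D r f) -
      (-1 : F) ^ (tau r + tau s) • vf r (D s f) := by
  rw [Drs_homog r s hf]
  congr 2
  exact neg_one_pow_eq (by rcases r with r | r <;> rcases s with s | s <;> simp [tau])

/-- This is the identity behind closure under the bracket, kept explicit because the individual
terms are needed to generate elements. -/
lemma lie_sum_Drs {e : Var m n → Alg F m n} (he : ∀ k, e k ∈ homog F m n (tau k))
    (hdiv : ∑ k, (-1 : F) ^ tau k • D k (e k) = 0)
    (u v : Var m n) {f : Alg F m n} (hf : f ∈ homog F m n (tau u + tau v)) :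
    ⁅∑ k, vf k (e k), Drs u v f⁆ = Drs u v ((∑ k, vf k (e k)) f) -
      ∑ k, (-1 : F) ^ (tau u * tau v + tau k * tau v + tau k * tau u + tau k) •
        (Drs k v (mul (D u (e k)) f) -
          (-1 : F) ^ (tau u * tau v + tau u + tau v) • Drs k u (mul (D v (e k)) f)) := by
  have hE : ∑ k, vf k (e k) = ∑ k, mul (e k) ∘ₗ D k := rfl
  rw [hE]
  set E : Module.End F (Alg F m n) := ∑ k, mul (e k) ∘ₗ D k with hE
  have hEp : E f ∈ homog F m n (tau u + tau v) := by
    rw [hE, LinearMap.sum_apply]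
    refine sum_mem fun k _ => ?_
    rw [homog_congr (q' := tau k + (tau k + (tau u + tau v))) (by omega)]
    exact mul_homog (he k) (D_homog k hf)
  refine LinearMap.ext fun h => ?_
  have hz : ∀ w z : Var m n,
      ∑ k, (-1 : F) ^ tau k • mul (mul (D w (D k (e k))) f) (D z h) = 0 := by
    intro w z
    have := congrArg (fun x => mul (mul (D w x) f) (D z h)) hdiv
    simpa [map_sum, LinearMap.sum_apply] using this
  have hsum := sum_congr (rfl : (univ : Finset (Var m n)) = univ)
    fun k _ => bracket_term he u v k hf h
  rw [sum_sub_distrib (s := univ) (f := fun k => (-1 : F) ^ (tau u * tau v + tau k * tau v +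
    tau k * tau u + tau k) • (Drs k v (mul (D u (e k)) f) h -
      (-1 : F) ^ (tau u * tau v + tau u + tau v) • Drs k u (mul (D v (e k)) f) h))] at hsum
  have hres : ∑ k, (-1 : F) ^ tau k •
      ((-1 : F) ^ (tau u * tau v) • mul (mul (D u (D k (e k))) f) (D v h) -
      (-1 : F) ^ (tau u + tau v) • mul (mul (D v (D k (e k))) f) (D u h)) = 0 := by
    simp only [smul_sub, smul_comm ((-1 : F) ^ tau _), sum_sub_distrib, ← smul_sum, hz,
      smul_zero, sub_zero]
  rw [hres, sub_zero] at hsum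
  simp only [LinearMap.sub_apply, LinearMap.sum_apply, LinearMap.smul_apply]
  rw [← hsum, Ring.lie_def, LinearMap.sub_apply, Module.End.mul_apply,
    Module.End.mul_apply, Drs_homog u v hf, Drs_homog u v hEp]
  simp only [LinearMap.sub_apply, LinearMap.smul_apply, LinearMap.comp_apply, map_sub, map_smul,
    hE, der_mul he (D_homog u hf), der_mul he (D_homog v hf), der_D he]
  simp only [map_sum, LinearMap.sum_apply, sum_sub_distrib, sum_add_distrib, ← smul_sum]
  module

lemma Drs_zero (r s : Var m n) : Drs r s (0 : Alg F m n) = 0 := by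
  simp [Drs]

lemma lie_vf_Drs {j : Var m n} {g : Alg F m n} (hg : g ∈ homog F m n (tau j))
    (hdiv : D j g = 0) (u v : Var m n) {f : Alg F m n}
    (hf : f ∈ homog F m n (tau u + tau v)) :
    ⁅vf j g, Drs u v f⁆ = Drs u v (vf j g f) -
      (-1 : F) ^ (tau u * tau v + tau j * tau v + tau j * tau u + tau j) •
        (Drs j v (mul (D u g) f) -
          (-1 : F) ^ (tau u * tau v + tau u + tau v) • Drs j u (mul (D v g) f)) := by
  have h0 : ∀ k, k ≠ j → (Pi.single j g : Var m n → Alg F m n) k = 0 := fun k hk => by simp [hk]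
  have he : ∀ k, (Pi.single j g : Var m n → Alg F m n) k ∈ homog F m n (tau k) := by
    intro k
    by_cases h : k = j
    · subst h; simpa using hg
    · simp [h]
  have h1 : ∑ k, vf k ((Pi.single j g : Var m n → Alg F m n) k) = vf j g := by
    rw [sum_eq_single j (fun k _ hk => by simp [hk]) (by simp)]; simp
  have h2 := lie_sum_Drs he (by
    rw [sum_eq_single j (fun k _ hk => by simp [hk]) (by simp)]; simp [hdiv]) u v hf
  rw [h1] at h2
  rw [h2, sum_eq_single j (fun k _ hk => by
    simp only [h0 k hk, map_zero, LinearMap.zero_apply, Drs_zero, smul_zero, sub_zero]) (by simp)]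
  simp

lemma lie_eul_vf (r k : Var m n) {f : Alg F m n} (hf : f ∈ homog F m n (tau k)) {c : F}
    (hc : eul F r f = c • f) :
    ⁅eul F r, vf k f⁆ = (c - if r = k then 1 else 0) • vf k f := by
  rw [eul, lie_vf (X_homog r) hf, ← eul, hc, vf_apply, D_X, sub_smul, map_smul]
  congr 1
  split_ifs with h1 h2 h2
  · subst h1; simp [mul_one']
  · exact absurd h1.symm h2
  · exact absurd h2.symm h1
  · simp

/-- The `Drs` of monomials are weight vectors even for single Euler fields, which have nonzero
divergence and so lie outside S. -/
lemma lie_eul_Drs (r u v : Var m n) {a : Expo m n} (ha : #a.2 % 2 = (tau u + tau v) % 2) :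
    ⁅eul F r, Drs u v (mono F a)⁆ = ((deg r a : F) - (if r = u then 1 else 0) -
      (if r = v then 1 else 0)) • Drs u v (mono F a) := by
  have hf := mono_homog (F := F) a ha
  rw [Drs_eq hf, lie_sub, Ring.lie_def, Ring.lie_def, mul_smul_comm, smul_mul_assoc,
    mul_smul_comm, smul_mul_assoc, ← smul_sub, ← smul_sub, ← Ring.lie_def, ← Ring.lie_def]
  have h1 : D u (mono F a) ∈ homog F m n (tau v) := by
    rw [homog_congr (q' := tau u + (tau u + tau v)) (by omega)]
    exact D_homog u hf
  have h2 : D v (mono F a) ∈ homog F m n (tau u) := by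
    rw [homog_congr (q' := tau v + (tau u + tau v)) (by omega)]
    exact D_homog v hf
  rw [lie_eul_vf r v h1 (eul_D r u a), lie_eul_vf r u h2 (eul_D r v a), smul_sub]
  congr 1
  · exact smul_comm _ _ _
  · rw [smul_comm, sub_right_comm]

end Brackets

/-! ### Even truncated fields and their coefficients -/

section Fields

variable {F : Type*} [Field F] {m n p : ℕ} {t : Fin m → ℕ}

variable (n p t) in
/-- The indices of the monomial fields `x^(α) x^u D_k` that are even and truncated. -/
def fieldIdx : Finset (Var m n × Expo m n) :=
  {x ∈ univ ×ˢ (Fintype.piFinset (fun i => range (p ^ t i)) ×ˢ univ) |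
    #x.2.2 % 2 = tau x.1 % 2}

lemma mem_fieldIdx {x : Var m n × Expo m n} :
    x ∈ fieldIdx n p t ↔ (∀ i, x.2.1 i < p ^ t i) ∧ #x.2.2 % 2 = tau x.1 % 2 := by
  simp [fieldIdx]

variable (F n p t) in
/-- The space of the even fields with truncated coefficients. -/
def evenFields : Submodule F (Module.End F (Alg F m n)) :=
  Submodule.span F {T | ∃ k, ∃ f ∈ trunc F n p t, f ∈ homog F m n (tau k) ∧ T = vf k f}

/-- The coefficient of the monomial field `x^(α) x^u D_k`. -/
def cf (k : Var m n) (a : Expo m n) : Module.End F (Alg F m n) →ₗ[F] F :=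
  co a ∘ₗ LinearMap.applyₗ (X F k)

lemma cf_apply (k : Var m n) (a : Expo m n) (T : Module.End F (Alg F m n)) :
    cf k a T = co a (T (X F k)) := rfl

lemma vf_mem {k : Var m n} {f : Alg F m n} (h1 : f ∈ trunc F n p t)
    (h2 : f ∈ homog F m n (tau k)) : vf k f ∈ evenFields F n p t :=
  Submodule.subset_span ⟨k, f, h1, h2, rfl⟩

lemma vf_mono_mem {k : Var m n} {a : Expo m n} (h1 : ∀ i, a.1 i < p ^ t i)
    (h2 : #a.2 % 2 = tau k % 2) : vf k (mono F a) ∈ evenFields F n p t :=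
  vf_mem (mono_trunc h1) (mono_homog a h2)

lemma vf_apply_X (k l : Var m n) (f : Alg F m n) : vf k f (X F l) = if k = l then f else 0 := by
  rw [vf_apply, D_X]; split_ifs <;> simp [mul_one']

lemma cf_vf (k l : Var m n) (a : Expo m n) (f : Alg F m n) :
    cf k a (vf l f) = if l = k then co a f else 0 := by
  rw [cf_apply, vf_apply_X]; split_ifs <;> simp

lemma evenFields_apply_X {T : Module.End F (Alg F m n)} (hT : T ∈ evenFields F n p t)
    (k : Var m n) : T (X F k) ∈ trunc F n p t ⊓ homog F m n (tau k) := by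
  induction hT using Submodule.span_induction with
  | mem T hT =>
    obtain ⟨l, f, h1, h2, rfl⟩ := hT
    rw [vf_apply_X]
    split_ifs with h
    · subst h; exact ⟨h1, h2⟩
    · exact zero_mem _
  | zero => exact zero_mem _
  | add S T _ _ hS hT => exact add_mem hS hT
  | smul c T _ hT => exact Submodule.smul_mem _ c hT

lemma evenFields_eq_sum {T : Module.End F (Alg F m n)} (hT : T ∈ evenFields F n p t) :
    T = ∑ k, vf k (T (X F k)) := by
  induction hT using Submodule.span_induction with
  | mem T hT =>
    obtain ⟨l, f, h1, h2, rfl⟩ := hT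
    rw [sum_eq_single l]
    · rw [vf_apply_X, if_pos rfl]
    · intro k _ hk; rw [vf_apply_X, if_neg (Ne.symm hk), map_zero]
    · simp
  | zero => simp
  | add S T _ _ hS hT =>
    simp only [LinearMap.add_apply, map_add, sum_add_distrib]
    rw [← hS, ← hT]
  | smul c T _ hT =>
    simp only [LinearMap.smul_apply, map_smul, ← smul_sum]
    rw [← hT]

lemma evenFields_one {T : Module.End F (Alg F m n)} (hT : T ∈ evenFields F n p t) :
    T (one F m n) = 0 := by
  rw [evenFields_eq_sum hT, LinearMap.sum_apply]
  simp [vf_apply, D_one]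

lemma evenFields_ext {S T : Module.End F (Alg F m n)} (hS : S ∈ evenFields F n p t)
    (hT : T ∈ evenFields F n p t) (h : ∀ k a, cf k a S = cf k a T) : S = T := by
  rw [evenFields_eq_sum hS, evenFields_eq_sum hT]
  exact sum_congr rfl fun k _ => congrArg _ (ext_co (h k))

lemma cf_mem {T : Module.End F (Alg F m n)} (hT : T ∈ evenFields F n p t) {k : Var m n}
    {a : Expo m n} (h : cf k a T ≠ 0) : (k, a) ∈ fieldIdx n p t := by
  obtain ⟨h1, h2⟩ := evenFields_apply_X hT k
  exact mem_fieldIdx.2 ⟨co_trunc h1 h, co_homog h2 h⟩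

/-- Coefficients are read off at the variables. A field kills constants, so only the derivative of
its coefficient survives in the bracket, and for divided powers a derivative is a pure shift of
exponents. -/
lemma cf_lie_D {T : Module.End F (Alg F m n)} (hT : T ∈ evenFields F n p t) (i : Fin m)
    (k : Var m n) (a : Expo m n) :
    cf k a ⁅D (F := F) (m := m) (n := n) (Sum.inl i), T⁆ = cf k (a.1 + Pi.single i 1, a.2) T := by
  have h1 := evenFields_one hT
  rw [cf_apply, lie_apply, map_sub, D_X, co_D_inl, cf_apply]
  split_ifs <;> simp [h1]

lemma cf_lie_eul (T : Module.End F (Alg F m n)) (r k : Var m n) (a : Expo m n) :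
    cf k a ⁅eul F r, T⁆ = ((deg r a : F) - if r = k then 1 else 0) * cf k a T := by
  rw [cf_apply, lie_apply, map_sub, co_eul, eul_X, map_smul, map_smul, cf_apply, smul_eq_mul,
    sub_mul]

/-- The even field with given coefficients. -/
def ofCf (p : ℕ) (t : Fin m → ℕ) (c : Var m n → Expo m n → F) : Module.End F (Alg F m n) :=
  ∑ x ∈ fieldIdx n p t, c x.1 x.2 • vf x.1 (mono F x.2)

lemma ofCf_mem (c : Var m n → Expo m n → F) : ofCf p t c ∈ evenFields F n p t :=
  sum_mem fun _ hx => Submodule.smul_mem _ _ <|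
    vf_mono_mem (mem_fieldIdx.1 hx).1 (mem_fieldIdx.1 hx).2

lemma cf_ofCf (c : Var m n → Expo m n → F) (k : Var m n) (a : Expo m n) :
    cf k a (ofCf p t c) = if (k, a) ∈ fieldIdx n p t then c k a else 0 := by
  have h : ∀ x : Var m n × Expo m n, cf k a (c x.1 x.2 • vf x.1 (mono F x.2)) =
      if x = (k, a) then c k a else 0 := by
    rintro ⟨l, b⟩
    rw [map_smul, cf_vf, co_mono, smul_eq_mul]
    by_cases h1 : l = k <;> by_cases h2 : b = a <;> simp [h1, h2]
  simp only [ofCf, map_sum, h, sum_ite_eq']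

/-! ### The even part of S inside the even fields -/

section Special

variable [Fact p.Prime] [CharP F p]

lemma evenFields_lie {S T : Module.End F (Alg F m n)} (hS : S ∈ evenFields F n p t)
    (hT : T ∈ evenFields F n p t) : ⁅S, T⁆ ∈ evenFields F n p t := by
  rw [evenFields_eq_sum hS, evenFields_eq_sum hT, sum_lie]
  refine sum_mem fun k _ => ?_
  rw [lie_sum]
  refine sum_mem fun l _ => ?_
  obtain ⟨h1, h2⟩ := evenFields_apply_X hS k
  obtain ⟨h3, h4⟩ := evenFields_apply_X hT l
  rw [lie_vf h2 h4]
  refine sub_mem (vf_mem (mul_trunc h1 (D_trunc k h3)) ?_) (vf_mem (mul_trunc h3 (D_trunc l h1)) ?_)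
  · rw [homog_congr (q' := tau k + (tau k + tau l)) (by omega)]
    exact mul_homog h2 (D_homog k h4)
  · rw [homog_congr (q' := tau l + (tau l + tau k)) (by omega)]
    exact mul_homog h4 (D_homog l h2)

lemma Drs_mem {u v : Var m n} {f : Alg F m n} (h1 : f ∈ trunc F n p t)
    (h2 : f ∈ homog F m n (tau u + tau v)) : Drs u v f ∈ evenSpecial F n p t := by
  refine ⟨Submodule.subset_span ⟨u, v, f, h1, rfl⟩, fun q h hh => ?_⟩
  rw [homog_congr (q' := tau u + tau v + (tau u + tau v) + q) (by omega)]
  exact Drs_apply_homog u v h2 hh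

lemma Drs_mono_mem {u v : Var m n} {a : Expo m n} (h1 : ∀ i, a.1 i < p ^ t i)
    (h2 : #a.2 % 2 = (tau u + tau v) % 2) : Drs u v (mono F a) ∈ evenSpecial F n p t :=
  Drs_mem (mono_trunc h1) (mono_homog a h2)

lemma evenSpecial_le_evenFields {T : Module.End F (Alg F m n)} (hT : T ∈ evenSpecial F n p t) :
    T ∈ evenFields F n p t := by
  obtain ⟨e, h1, h2, -, rfl⟩ := exists_coeffs (mem_span_evenGens hT.1 hT.2)
  exact sum_mem fun k _ => vf_mem (h1 k) (h2 k)

/-- To check that the even part of `S` lies in a subspace, it suffices to check the `D_{rs}` of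
monomials. -/
lemma evenSpecial_induction {N : Submodule F (Module.End F (Alg F m n))}
    (h : ∀ u v (a : Expo m n), (∀ i, a.1 i < p ^ t i) → #a.2 % 2 = (tau u + tau v) % 2 →
      Drs u v (mono F a) ∈ N) {T : Module.End F (Alg F m n)} (hT : T ∈ evenSpecial F n p t) :
    T ∈ N := by
  have h1 := mem_span_evenGens hT.1 hT.2
  refine (Submodule.span_le.2 ?_) h1
  rintro _ ⟨u, v, f, hf, hp, rfl⟩
  have h2 : f ∈ Submodule.span F
      (mono F '' {a | (∀ i, a.1 i < p ^ t i) ∧ #a.2 % 2 = (tau u + tau v) % 2}) :=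
    mem_span_mono fun a ha => ⟨co_trunc hf ha, co_homog hp ha⟩
  let L : Alg F m n →ₗ[F] Module.End F (Alg F m n) :=
    { toFun := Drs u v, map_add' := Drs_add u v, map_smul' := Drs_smul u v }
  exact map_mem_of_supported L (fun a ha => h u v a ha.1 ha.2) h2

end Special

end Fields

/-! ### Explicit elements of the even part of S -/

section Formulas

variable {F : Type*} [Field F] {m n p : ℕ} {t : Fin m → ℕ}

lemma D_inl_eq_vf (i : Fin m) : D (F := F) (m := m) (n := n) (Sum.inl i) = vf (Sum.inl i) (one F m n) := by
  refine LinearMap.ext fun h => ?_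
  rw [vf_apply, one_mul']

lemma one_homog (i : Fin m) : one F m n ∈ homog F m n (tau (Sum.inl i : Var m n)) :=
  mono_homog _ rfl

lemma lie_D_vf (i : Fin m) (k : Var m n) {f : Alg F m n} (hf : f ∈ homog F m n (tau k)) :
    ⁅D (F := F) (m := m) (n := n) (Sum.inl i), vf k f⁆ = vf k (D (Sum.inl i) f) := by
  rw [D_inl_eq_vf, lie_vf (one_homog i) hf, vf_apply k, D_one]
  simp

lemma lie_D_Drs (i : Fin m) (u v : Var m n) {f : Alg F m n}
    (hf : f ∈ homog F m n (tau u + tau v)) :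
    ⁅D (F := F) (m := m) (n := n) (Sum.inl i), Drs u v f⁆ = Drs u v (D (Sum.inl i) f) := by
  rw [D_inl_eq_vf, lie_vf_Drs (one_homog i) (D_one _) u v hf]
  simp [D_one, Drs_zero]

lemma Drs_inl_inl (i j : Fin m) {f : Alg F m n} (hf : f ∈ homog F m n 0) :
    Drs (Sum.inl i) (Sum.inl j) f =
      vf (Sum.inl j) (D (Sum.inl i) f) - vf (Sum.inl i) (D (Sum.inl j) f) := by
  have hf' : f ∈ homog F m n (tau (Sum.inl i : Var m n) + tau (Sum.inl j : Var m n)) := hf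
  rw [Drs_eq hf']; simp [tau]

lemma Drs_inl_inr (i : Fin m) (l : Fin n) {f : Alg F m n} (hf : f ∈ homog F m n 1) :
    Drs (Sum.inl i) (Sum.inr l) f =
      vf (Sum.inr l) (D (Sum.inl i) f) + vf (Sum.inl i) (D (Sum.inr l) f) := by
  have hf' : f ∈ homog F m n (tau (Sum.inl i : Var m n) + tau (Sum.inr l : Var m n)) := hf
  rw [Drs_eq hf']; simp [tau]

lemma Drs_inr_inr (k l : Fin n) {f : Alg F m n} (hf : f ∈ homog F m n 0) :
    Drs (Sum.inr k) (Sum.inr l) f =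
      -vf (Sum.inr l) (D (Sum.inr k) f) - vf (Sum.inr k) (D (Sum.inr l) f) := by
  have hf' : f ∈ homog F m n (tau (Sum.inr k : Var m n) + tau (Sum.inr l : Var m n)) := by
    rwa [homog_congr (q' := 0) (by simp [tau])]
  rw [Drs_eq hf']; simp [tau]

lemma Drs_inl_antisymm (i j : Fin m) {f : Alg F m n} (hf : f ∈ homog F m n 0) :
    Drs (Sum.inl i) (Sum.inl j) f = -Drs (Sum.inl j) (Sum.inl i) f := by
  rw [Drs_inl_inl i j hf, Drs_inl_inl j i hf, neg_sub]

lemma D_inl_add (i : Fin m) (α : Fin m → ℕ) (w : Finset (Fin n)) :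
    D (Sum.inl i) (mono F (α + Pi.single i 1, w)) = mono F (α, w) := by
  rw [D_inl_mono]; simp

lemma D_inl_of_eq_zero {i : Fin m} {a : Expo m n} (h : a.1 i = 0) :
    D (Sum.inl i) (mono F a) = 0 := by
  rw [D_inl_mono, if_pos h]

lemma D_inr_of_notMem {l : Fin n} {a : Expo m n} (h : l ∉ a.2) :
    D (Sum.inr l) (mono F a) = 0 := by
  rw [D_inr_mono, if_neg h]

lemma D_inr_insert {l : Fin n} (α : Fin m → ℕ) {w : Finset (Fin n)} (h : l ∉ w) :
    ∃ c : F, c ≠ 0 ∧ D (Sum.inr l) (mono F (α, insert l w)) = c • mono F (α, w) := by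
  refine ⟨_, pow_ne_zero #{j ∈ insert l w | j < l} (neg_ne_zero.2 one_ne_zero), ?_⟩
  rw [D_inr_mono, if_pos (by simp)]
  simp [erase_insert h]

/-- The coefficient is integrated in another even variable x_j; the second term of D_{ji} vanishes
because the coefficient does not involve x_i. -/
lemma vf_inl_eq_Drs {i j : Fin m} (hij : j ≠ i) {α : Fin m → ℕ} (hα : α i = 0)
    {w : Finset (Fin n)} (hw : #w % 2 = 0) :
    vf (Sum.inl i) (mono F (α, w)) =
      Drs (Sum.inl j) (Sum.inl i) (mono F (α + Pi.single j 1, w)) := by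
  rw [Drs_inl_inl _ _ (mono_homog _ hw), D_inl_add, D_inl_of_eq_zero (by simp [hα, hij]), map_zero,
    sub_zero]

/-- For an odd variable the two terms of D_{ll} add up instead of cancelling. This is how fields g
D_l with g free of x_l enter S. -/
lemma Drs_inr_self (l : Fin n) {f : Alg F m n} (hf : f ∈ homog F m n 0) :
    Drs (Sum.inr l) (Sum.inr l) f = (-2 : F) • vf (Sum.inr l) (D (Sum.inr l) f) := by
  rw [Drs_inr_inr _ _ hf]; module

lemma lt_add_single {α : Fin m → ℕ} (hα : ∀ i, α i < p ^ t i) {j : Fin m}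
    (hj : α j + 1 < p ^ t j) (i : Fin m) : (α + Pi.single j 1 : Fin m → ℕ) i < p ^ t i := by
  by_cases h : i = j
  · subst h; simpa using hj
  · simpa [h] using hα i

variable (F n) in
/-- The elements `x_i D_i + x_l D_l` of the torus. -/
def tor (i : Fin m) (l : Fin n) : Module.End F (Alg F m n) :=
  eul F (Sum.inl i) + eul F (Sum.inr l)

lemma tor_eq_Drs (i : Fin m) (l : Fin n) :
    tor F n i l = Drs (Sum.inl i) (Sum.inr l) (mono F (Pi.single i 1, {l})) := by
  rw [Drs_inl_inr _ _ (mono_homog _ (by simp)), tor, eul, eul, X, X, D_inl_mono, D_inr_mono]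
  simp [varExpo, filter_singleton, add_comm]

lemma eul_eq_vf (r : Var m n) : eul F r = vf r (mono F (varExpo r)) := rfl

section Prime

variable [hp : Fact p.Prime] [CharP F p]

lemma Dinl_mem (hm : 3 ≤ m) (ht : ∀ i, 1 ≤ t i) (i : Fin m) :
    D (F := F) (m := m) (n := n) (Sum.inl i) ∈ evenSpecial F n p t := by
  obtain ⟨j, hj⟩ : ∃ j : Fin m, j ≠ i := Fintype.exists_ne_of_one_lt_card (by simp; omega) i
  rw [D_inl_eq_vf, one, vf_inl_eq_Drs hj rfl rfl]
  refine Drs_mono_mem (lt_add_single (fun i => ?_) ?_) rfl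
  · exact pow_pos hp.out.pos _
  · simpa using one_lt_pow₀ hp.out.one_lt (by have := ht j; omega)

lemma tor_mem (ht : ∀ i, 1 ≤ t i) (i : Fin m) (l : Fin n) :
    tor F n i l ∈ evenSpecial F n p t := by
  rw [tor_eq_Drs]
  refine Drs_mono_mem (fun j => ?_) (by simp [tau])
  have h1 := one_lt_pow₀ hp.out.one_lt (show t j ≠ 0 by have := ht j; omega)
  by_cases h : j = i
  · subst h; simpa using h1
  · simp only [Pi.single_apply, h, if_false]; omega

lemma vf_inl_mem {i j : Fin m} (hij : j ≠ i) {α : Fin m → ℕ} (hα : ∀ i, α i < p ^ t i)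
    (hi : α i = 0) (hj : α j + 1 < p ^ t j) {w : Finset (Fin n)} (hw : #w % 2 = 0) :
    vf (Sum.inl i) (mono F (α, w)) ∈ evenSpecial F n p t := by
  rw [vf_inl_eq_Drs hij hi hw]
  exact Drs_mono_mem (lt_add_single hα hj) hw

lemma vf_inr_eq_Drs (h2 : (2 : F) ≠ 0) {l : Fin n} {α : Fin m → ℕ} {w : Finset (Fin n)}
    (hl : l ∉ w) (hw : #w % 2 = 1) : ∃ c : F, vf (Sum.inr l) (mono F (α, w)) =
      c • Drs (Sum.inr l) (Sum.inr l) (mono F (α, insert l w)) := by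
  obtain ⟨c, hc, h⟩ := D_inr_insert (F := F) α hl
  refine ⟨(-2 * c)⁻¹, ?_⟩
  rw [Drs_inr_self _ (mono_homog _ (by rw [card_insert_of_notMem hl]; omega)), h, map_smul,
    smul_smul, smul_smul, mul_assoc, inv_mul_cancel₀ (by simp [h2, hc]), one_smul]

lemma vf_inr_mem (h2 : (2 : F) ≠ 0) {l : Fin n} {α : Fin m → ℕ} (hα : ∀ i, α i < p ^ t i)
    {w : Finset (Fin n)} (hl : l ∉ w) (hw : #w % 2 = 1) :
    vf (Sum.inr l) (mono F (α, w)) ∈ evenSpecial F n p t := by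
  obtain ⟨c, h⟩ := vf_inr_eq_Drs (F := F) (α := α) h2 hl hw
  rw [h]
  exact Submodule.smul_mem _ c (Drs_mono_mem hα
    (by rw [card_insert_of_notMem hl]; simp [tau]; omega))

end Prime

end Formulas

/-! ### Derivations killing the D_i and the torus: the weight argument -/

section Weights

variable {F : Type*} [Field F] {m n p : ℕ} [hp : Fact p.Prime] [CharP F p] {t : Fin m → ℕ}

variable (n p t) in
/-- A linear map that restricts to a derivation from the even part of `S` to the even truncated
fields. -/
structure IsFieldDer (ψ : Module.End F (Module.End F (Alg F m n))) : Prop where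
  map_mem : ∀ x ∈ evenSpecial F n p t, ψ x ∈ evenFields F n p t
  leib : ∀ x ∈ evenSpecial F n p t, ∀ y ∈ evenSpecial F n p t, ψ ⁅x, y⁆ = ⁅ψ x, y⁆ + ⁅x, ψ y⁆

variable (n p t) in
/-- The elements of the even part of `S` killed by a linear map. -/
def kerOn (ψ : Module.End F (Module.End F (Alg F m n))) :
    Submodule F (Module.End F (Alg F m n)) :=
  (evenSpecial F n p t).toSubmodule ⊓ LinearMap.ker ψ

variable {ψ : Module.End F (Module.End F (Alg F m n))}

lemma mem_kerOn {x : Module.End F (Alg F m n)} :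
    x ∈ kerOn n p t ψ ↔ x ∈ evenSpecial F n p t ∧ ψ x = 0 := Iff.rfl

lemma IsFieldDer.lie_mem_kerOn (hψ : IsFieldDer n p t ψ) {x y : Module.End F (Alg F m n)}
    (hx : x ∈ kerOn n p t ψ) (hy : y ∈ kerOn n p t ψ) : ⁅x, y⁆ ∈ kerOn n p t ψ := by
  rw [mem_kerOn] at *
  refine ⟨(evenSpecial F n p t).lie_mem hx.1 hy.1, ?_⟩
  rw [hψ.leib x hx.1 y hy.1, hx.2, hy.2, zero_lie, lie_zero, add_zero]

/-- A monomial field `x^u D_k` has the same weight `d` under the torus spanned by the `tor i l`. -/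
def SameWeight (d : Var m n → F) (k : Var m n) (w : Finset (Fin n)) : Prop :=
  ∀ i l, d (Sum.inl i) + d (Sum.inr l) = (if l ∈ w then 1 else 0) -
    (if k = Sum.inr l then 1 else 0) - (if k = Sum.inl i then 1 else 0)

variable (n p t) in
/-- A derivation into the even fields that kills the `D_i` and the torus. -/
structure IsWeightDer (ψ : Module.End F (Module.End F (Alg F m n))) : Prop
    extends IsFieldDer n p t ψ where
  D_mem : ∀ i, D (F := F) (m := m) (n := n) (Sum.inl i) ∈ kerOn n p t ψ
  tor_mem : ∀ i l, tor F n i l ∈ kerOn n p t ψ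

/-- The Leibniz rule gives [D_i, ψ y] = 0, and bracketing with D_i shifts coefficients down in x_i.
-/
lemma IsFieldDer.cf_map_eq_zero (hψ : IsFieldDer n p t ψ) {i : Fin m}
    (hi : D (F := F) (m := m) (n := n) (Sum.inl i) ∈ kerOn n p t ψ) {y : Module.End F (Alg F m n)}
    (hy : y ∈ evenSpecial F n p t) (hD : ψ ⁅D (F := F) (m := m) (n := n) (Sum.inl i), y⁆ = 0) {k : Var m n}
    {a : Expo m n} (ha : a.1 i ≠ 0) : cf k a (ψ y) = 0 := by
  have h1 := hψ.leib _ hi.1 y hy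
  rw [hD, (mem_kerOn.1 hi).2, zero_lie, zero_add] at h1
  have h2 := cf_lie_D (hψ.map_mem y hy) i k (a.1 - Pi.single i 1, a.2)
  rw [← h1, map_zero] at h2
  have h3 : (a.1 - Pi.single i 1 + Pi.single i 1 : Fin m → ℕ) = a.1 := by
    funext j
    by_cases hj : j = i
    · subst hj; simp; omega
    · simp [hj]
  dsimp only at h2
  rw [h3] at h2
  exact h2.symm

/-- ψ y commutes with every D_i, so its coefficients are free of even variables; ψ commutes with the
torus, so it preserves weights. -/
lemma IsWeightDer.sameWeight (hψ : IsWeightDer n p t ψ) {y : Module.End F (Alg F m n)}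
    (hy : y ∈ evenSpecial F n p t) {d : Var m n → F} (hd : ∀ r, ⁅eul F r, y⁆ = d r • y)
    (hD : ∀ i, ⁅D (F := F) (m := m) (n := n) (Sum.inl i), y⁆ ∈ kerOn n p t ψ) {k : Var m n} {a : Expo m n}
    (h : cf k a (ψ y) ≠ 0) : a.1 = 0 ∧ SameWeight d k a.2 := by
  have ha : a.1 = 0 := by
    funext i
    by_contra hi
    exact h (hψ.cf_map_eq_zero (hψ.D_mem i) hy (mem_kerOn.1 (hD i)).2 hi)
  refine ⟨ha, fun i l => ?_⟩
  -- Both sides of [x_i D_i + x_l D_l, ψ y] = (d_i + d_l) ψ y are compared at a nonzero coefficient.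
  have h1 := hψ.leib _ (hψ.tor_mem i l).1 y hy
  rw [(mem_kerOn.1 (hψ.tor_mem i l)).2, zero_lie, zero_add, tor, add_lie, hd, hd, ← add_smul,
    map_smul, add_lie] at h1
  have h2 := congrArg (cf k a) h1
  rw [map_smul, map_add, cf_lie_eul, cf_lie_eul, ← add_mul, smul_eq_mul] at h2
  rw [mul_right_cancel₀ h h2]
  simp only [deg, ha, eq_comm (a := k), Pi.zero_apply, Nat.cast_zero]
  split_ifs <;> push_cast <;> ring

lemma IsWeightDer.mem_kerOn_of_weight (hψ : IsWeightDer n p t ψ) {y : Module.End F (Alg F m n)}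
    (hy : y ∈ evenSpecial F n p t) {d : Var m n → F} (hd : ∀ r, ⁅eul F r, y⁆ = d r • y)
    (hD : ∀ i, ⁅D (F := F) (m := m) (n := n) (Sum.inl i), y⁆ ∈ kerOn n p t ψ)
    (hw : ∀ k w, #w % 2 = tau k % 2 → ¬ SameWeight d k w) : y ∈ kerOn n p t ψ := by
  refine mem_kerOn.2 ⟨hy, evenFields_ext (hψ.map_mem y hy) (Submodule.zero_mem _) fun k a => ?_⟩
  rw [map_zero]
  by_contra h
  exact hw k a.2 (mem_fieldIdx.1 (cf_mem (hψ.map_mem y hy) h)).2 (hψ.sameWeight hy hd hD h).2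

end Weights

/-! ### Fields with coefficients free of, or linear in, the even variables -/

section ConstantCoefficients

variable {F : Type*} [Field F] {m n p : ℕ} {t : Fin m → ℕ}

lemma lie_eul_vf_mono (r k : Var m n) {a : Expo m n} (ha : #a.2 % 2 = tau k % 2) :
    ⁅eul F r, vf k (mono F a)⁆ =
      ((deg r a : F) - if r = k then 1 else 0) • vf k (mono F a) :=
  lie_eul_vf r k (mono_homog a ha) (eul_mono r a)

lemma lie_vf_inl_mono (j : Fin m) (k : Var m n) {α β : Fin m → ℕ} {u w : Finset (Fin n)}
    (hu : #u % 2 = 0) (hw : #w % 2 = tau k % 2) (h : D k (mono F (α, u)) = 0) :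
    ⁅vf (Sum.inl j) (mono F (α, u)), vf k (mono F (β + Pi.single j 1, w))⁆ =
      coeff F (α, u) (β, w) • vf k (mono F (α + β, u ∪ w)) := by
  rw [lie_vf (mono_homog _ hu) (mono_homog _ hw), vf_apply, vf_apply, h, D_inl_add, mul_mono]
  simp

lemma coeff_ne_zero {a b : Expo m n} (h : Disjoint a.2 b.2) (h' : ∀ i, a.1 i = 0 ∨ b.1 i = 0) :
    coeff F a b ≠ 0 := by
  rw [coeff_of_disjoint h]
  refine mul_ne_zero (pow_ne_zero _ (neg_ne_zero.2 one_ne_zero)) (prod_ne_zero_iff.2 fun i _ => ?_)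
  rcases h' i with h | h <;> simp [h]

lemma two_ne_zero_of_three_lt [CharP F p] (hp3 : 3 < p) : (2 : F) ≠ 0 := by
  have h := (CharP.cast_eq_zero_iff F p 2).not.2 (Nat.not_dvd_of_pos_of_lt (by norm_num) (by omega))
  exact_mod_cast h

lemma three_ne_zero_of_three_lt [CharP F p] (hp3 : 3 < p) : (3 : F) ≠ 0 := by
  have h := (CharP.cast_eq_zero_iff F p 3).not.2 (Nat.not_dvd_of_pos_of_lt (by norm_num) (by omega))
  exact_mod_cast h

lemma three_lt_pow (hp3 : 3 < p) (ht : ∀ i, 1 ≤ t i) (i : Fin m) : 3 < p ^ t i :=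
  hp3.trans_le (Nat.le_self_pow (by have := ht i; omega) p)

variable [hp : Fact p.Prime] [CharP F p] {ψ : Module.End F (Module.End F (Alg F m n))}

variable (n p t) in
/-- A derivation into the even fields that kills the `D_i`, the torus, the odd rotations and one
field `x_a x_b D_i` with odd `x_a`, `x_b`. -/
structure IsReducedDer (ψ : Module.End F (Module.End F (Alg F m n))) : Prop
    extends IsWeightDer n p t ψ where
  rot_mem : ∀ k l, k ≠ l → vf (Sum.inr l) (mono F (0, {k})) ∈ kerOn n p t ψ
  pair_mem : ∃ i a b, a ≠ b ∧ vf (Sum.inl i) (mono F (0, {a, b})) ∈ kerOn n p t ψ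

/-- The generation mechanism: g D_j differentiates one factor x_j away, so its bracket with a field
along D_k is a multiple of the product field. The opposite term vanishes because D_k g = 0. -/
lemma IsFieldDer.vf_mem_kerOn (hψ : IsFieldDer n p t ψ) (j : Fin m) (k : Var m n)
    {α β : Fin m → ℕ} {u w : Finset (Fin n)}
    (hu : #u % 2 = 0) (hw : #w % 2 = tau k % 2) (h : D k (mono F (α, u)) = 0)
    (hc : coeff F (α, u) (β, w) ≠ 0)
    (h1 : vf (Sum.inl j) (mono F (α, u)) ∈ kerOn n p t ψ)
    (h2 : vf k (mono F (β + Pi.single j 1, w)) ∈ kerOn n p t ψ) :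
    vf k (mono F (α + β, u ∪ w)) ∈ kerOn n p t ψ := by
  have h3 := hψ.lie_mem_kerOn h1 h2
  rw [lie_vf_inl_mono j k hu hw h] at h3
  exact (Submodule.smul_mem_iff _ hc).1 h3

/-- For a field free of even variables, the weights in two even directions differ by -1, 0 or 1;
here they differ by 2, and p > 3 separates these values. -/
lemma not_sameWeight_of_one_neg_one (h2 : (2 : F) ≠ 0) (h3 : (3 : F) ≠ 0) {d : Var m n → F}
    {i j : Fin m} (hi : d (Sum.inl i) = 1) (hj : d (Sum.inl j) = -1) (l : Fin n) (k : Var m n)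
    (w : Finset (Fin n)) : ¬ SameWeight d k w := by
  intro h
  have e1 := h i l
  have e2 := h j l
  rw [hi] at e1
  rw [hj] at e2
  have h1 : (1 : F) ≠ 0 := one_ne_zero
  generalize (if l ∈ w then (1 : F) else 0) - (if k = Sum.inr l then 1 else 0) = x at e1 e2
  split_ifs at e1 e2
  · exact h2 (by linear_combination e1 - e2)
  · exact h3 (by linear_combination e1 - e2)
  · exact h1 (by linear_combination e1 - e2)
  · exact h2 (by linear_combination e1 - e2)

lemma IsWeightDer.mem_kerOn_of_one_neg_one (hψ : IsWeightDer n p t ψ) (hp3 : 3 < p) (hn : 0 < n)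
    {y : Module.End F (Alg F m n)}
    (hy : y ∈ evenSpecial F n p t) {d : Var m n → F} (hd : ∀ r, ⁅eul F r, y⁆ = d r • y)
    (hD : ∀ i, ⁅D (F := F) (m := m) (n := n) (Sum.inl i), y⁆ ∈ kerOn n p t ψ)
    {i j : Fin m} (hi : d (Sum.inl i) = 1) (hj : d (Sum.inl j) = -1) : y ∈ kerOn n p t ψ :=
  hψ.mem_kerOn_of_weight hy hd hD fun k w _ =>
    not_sameWeight_of_one_neg_one (two_ne_zero_of_three_lt hp3) (three_ne_zero_of_three_lt hp3)
      hi hj ⟨0, hn⟩ k w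

lemma exists_third (hm : 3 ≤ m) (i j : Fin m) : ∃ q : Fin m, q ≠ i ∧ q ≠ j := by
  have h : ({i, j} : Finset (Fin m)).card < (univ : Finset (Fin m)).card := by
    have := card_le_two (a := i) (b := j)
    simp; omega
  obtain ⟨q, -, hq⟩ := exists_mem_notMem_of_card_lt_card h
  exact ⟨q, by simp_all, by simp_all⟩

lemma single_lt {q i : Fin m} {r : ℕ} (hr : r < p ^ t q) :
    (Pi.single q r : Fin m → ℕ) i < p ^ t i := by
  by_cases h : i = q
  · subst h; simpa using hr
  · simp only [Pi.single_apply, h, if_false]; exact pow_pos hp.out.pos _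

lemma D_inl_single_self (i : Fin m) (w : Finset (Fin n)) :
    D (Sum.inl i) (mono F (Pi.single i 1, w)) = mono F (0, w) := by
  simpa using D_inl_add (F := F) i 0 w

lemma D_inl_single_ne {i j : Fin m} (h : i ≠ j) (r : ℕ) (w : Finset (Fin n)) :
    D (Sum.inl i) (mono F (Pi.single j r, w)) = 0 :=
  D_inl_of_eq_zero (by simp [h])

/-- Fields `x_i x^w D_j` are killed when `x^w D_j` is. -/
lemma IsWeightDer.linear_mem (hψ : IsWeightDer n p t ψ) (hp3 : 3 < p) (hm : 3 ≤ m) (hn : 0 < n)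
    (ht : ∀ i, 1 ≤ t i) {i j : Fin m} (hij : i ≠ j) {w : Finset (Fin n)} (hw : #w % 2 = 0)
    (h : vf (Sum.inl j) (mono F (0, w)) ∈ kerOn n p t ψ) :
    vf (Sum.inl j) (mono F (Pi.single i 1, w)) ∈ kerOn n p t ψ := by
  obtain ⟨q, hqi, hqj⟩ := exists_third hm i j
  have h3 := three_lt_pow hp3 ht
  refine hψ.mem_kerOn_of_one_neg_one hp3 hn (vf_inl_mem hqj (fun q => single_lt ?_) (by simp [hij.symm])
    (by simp [hqi]; have := h3 q; omega) hw) (fun r => lie_eul_vf_mono r _ hw) (fun q => ?_)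
    (i := i) (j := j) ?_ ?_
  · have := h3 i; omega
  · rw [lie_D_vf q _ (mono_homog _ hw)]
    by_cases hq : q = i
    · subst hq; rwa [D_inl_single_self]
    · rw [D_inl_single_ne hq, map_zero]; exact Submodule.zero_mem _
  · simp [deg, hij]
  · simp [deg, hij.symm]

/-- The bracket [x^u D_i, x_i x^w D_j] is x^(u ∪ w) D_j up to sign. -/
lemma IsWeightDer.const_mem_of_const_mem (hψ : IsWeightDer n p t ψ) (hp3 : 3 < p) (hm : 3 ≤ m)
    (hn : 0 < n) (ht : ∀ i, 1 ≤ t i) {i j : Fin m} {u w : Finset (Fin n)} (hij : i ≠ j)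
    (huw : Disjoint u w) (hu : #u % 2 = 0) (hw : #w % 2 = 0)
    (h1 : vf (Sum.inl i) (mono F (0, u)) ∈ kerOn n p t ψ)
    (h2 : vf (Sum.inl j) (mono F (0, w)) ∈ kerOn n p t ψ) :
    vf (Sum.inl j) (mono F (0, u ∪ w)) ∈ kerOn n p t ψ := by
  have h3 := hψ.linear_mem hp3 hm hn ht hij hw h2
  have := hψ.vf_mem_kerOn i (Sum.inl j) (α := 0) (β := 0) hu hw (D_inl_of_eq_zero rfl)
    (coeff_ne_zero huw (by simp)) h1 (by simpa using h3)
  simpa using this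

lemma IsReducedDer.pair_mem' (hψ : IsReducedDer n p t ψ) (hp3 : 3 < p) (hm : 3 ≤ m)
    (ht : ∀ i, 1 ≤ t i) (i : Fin m) {a b : Fin n} (hab : a ≠ b) :
    vf (Sum.inl i) (mono F (0, {a, b})) ∈ kerOn n p t ψ := by
  have hn : 0 < n := a.pos
  -- The rotation x_c D_a replaces x_a by x_c.
  have hrot : ∀ (i : Fin m) (a b c : Fin n), a ≠ b → c ≠ b →
      vf (Sum.inl i) (mono F (0, {a, b})) ∈ kerOn n p t ψ →
      vf (Sum.inl i) (mono F (0, {c, b})) ∈ kerOn n p t ψ := by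
    intro i a b c hab hcb h
    by_cases hca : c = a
    · rwa [hca]
    have h1 := hψ.lie_mem_kerOn (hψ.rot_mem c a hca) h
    obtain ⟨s, hs, h2⟩ := D_inr_insert (F := F) (l := a) (0 : Fin m → ℕ) (w := {b}) (by simpa)
    rw [lie_vf (mono_homog _ (by simp [tau])) (mono_homog _ (by rw [card_pair hab]; simp [tau])),
      vf_apply, vf_apply, D_inl_of_eq_zero rfl, h2, map_smul, mul_mono, smul_smul, map_zero,
      map_zero, sub_zero, map_smul, Submodule.smul_mem_iff] at h1
    · simpa only [add_zero, ← insert_eq] using h1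
    · exact mul_ne_zero hs (coeff_ne_zero (by simpa) (by simp))
  have hswap : ∀ (i : Fin m) (a b : Fin n), vf (Sum.inl i) (mono F (0, {a, b})) ∈ kerOn n p t ψ →
      vf (Sum.inl i) (mono F (0, {b, a})) ∈ kerOn n p t ψ := by
    intro i a b h; rwa [pair_comm]
  obtain ⟨i₀, a₀, b₀, h0, h1⟩ := hψ.pair_mem
  have key : vf (Sum.inl i₀) (mono F (0, {a, b})) ∈ kerOn n p t ψ := by
    by_cases h : b = b₀
    · rw [h] at hab ⊢
      exact hrot _ _ _ _ h0 hab h1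
    · refine hrot i₀ b₀ b a (Ne.symm h) hab ?_
      exact hswap _ _ _ (hrot i₀ a₀ b₀ b h0 h h1)
  by_cases hi : i = i₀
  · rwa [hi]
  -- The bracket with x_{i₀} D_i changes the direction from i₀ to i.
  · have := hψ.const_mem_of_const_mem hp3 hm hn ht (u := {a, b}) (w := ∅) (Ne.symm hi)
      (by simp) (by rw [card_pair hab]) rfl key (by
        have := hψ.D_mem i; rwa [D_inl_eq_vf] at this)
    simpa using this

/-- Two odd variables are split off at a time: [x_a x_b D_j, x_j x^(w∖{a,b}) D_i]. -/
lemma IsReducedDer.const_inl_mem (hψ : IsReducedDer n p t ψ) (hp3 : 3 < p) (hm : 3 ≤ m)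
    (hn : 0 < n) (ht : ∀ i, 1 ≤ t i) (i : Fin m) {w : Finset (Fin n)} (hw : #w % 2 = 0) :
    vf (Sum.inl i) (mono F (0, w)) ∈ kerOn n p t ψ := by
  induction hc : #w using Nat.strong_induction_on generalizing w with
  | _ N ih =>
    by_cases h0 : w = ∅
    · subst h0
      have := hψ.D_mem i; rwa [D_inl_eq_vf] at this
    obtain ⟨a, ha⟩ := nonempty_iff_ne_empty.2 h0
    have h1 := card_erase_add_one ha
    have h2 : (w.erase a).Nonempty := by
      rw [← card_pos]; omega
    obtain ⟨b, hb⟩ := h2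
    have h3 := card_erase_add_one hb
    obtain ⟨j, hji, -⟩ := exists_third hm i i
    have hab : a ≠ b := fun h => by simp [h] at hb
    have := hψ.const_mem_of_const_mem hp3 hm hn ht (u := {a, b}) (w := (w.erase a).erase b)
      hji (by simp) (by rw [card_pair hab]) (by omega)
      (hψ.pair_mem' hp3 hm ht j hab) (ih (#((w.erase a).erase b)) (by omega) (by omega) rfl)
    have e : ({a, b} : Finset (Fin n)) ∪ (w.erase a).erase b = w := by
      rw [insert_eq, union_assoc, ← insert_eq, ← insert_eq, insert_erase hb, insert_erase ha]
    rwa [e] at this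

lemma IsReducedDer.linear_inl_mem (hψ : IsReducedDer n p t ψ) (hp3 : 3 < p) (hm : 3 ≤ m)
    (hn : 0 < n) (ht : ∀ i, 1 ≤ t i) {i j : Fin m} (hij : i ≠ j) {w : Finset (Fin n)}
    (hw : #w % 2 = 0) : vf (Sum.inl j) (mono F (Pi.single i 1, w)) ∈ kerOn n p t ψ :=
  hψ.linear_mem hp3 hm hn ht hij hw (hψ.const_inl_mem hp3 hm hn ht j hw)

/-- The fields `x_i x_k D_l` with `x_k`, `x_l` odd are killed. -/
lemma IsReducedDer.linear_inr_mem (hψ : IsReducedDer n p t ψ) (hp3 : 3 < p) (hm : 3 ≤ m)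
    (ht : ∀ i, 1 ≤ t i) (i : Fin m) {k l : Fin n} (hkl : k ≠ l) :
    vf (Sum.inr l) (mono F (Pi.single i 1, {k})) ∈ kerOn n p t ψ := by
  have h3 := three_lt_pow hp3 ht
  have h2 := two_ne_zero_of_three_lt (F := F) hp3
  refine hψ.mem_kerOn_of_weight (vf_inr_mem h2 (fun q => single_lt ?_) (by simpa using hkl.symm)
    (by simp)) (fun r => lie_eul_vf_mono r _ (by simp [tau])) (fun q => ?_) (fun x w _ h => ?_)
  · have := h3 i; omega
  · rw [lie_D_vf q _ (mono_homog _ (by simp [tau]))]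
    by_cases hq : q = i
    · subst hq; rw [D_inl_single_self]; exact hψ.rot_mem k l hkl
    · rw [D_inl_single_ne hq, map_zero]; exact Submodule.zero_mem _
  -- Up to a common term the weights in the even directions i, q, q' are 1, 0, 0. Comparing i with q
  -- forces a field along D_q, and this contradicts equality of the weights at q and q'.
  · obtain ⟨q, hq, -⟩ := exists_third hm i i
    obtain ⟨q', hq', hqq⟩ := exists_third hm i q
    have e1 := h i k
    have e2 := h q k
    have e3 := h q' k
    simp only [deg, Pi.single_eq_same, Pi.single_eq_of_ne hq, Pi.single_eq_of_ne hq'] at e1 e2 e3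
    simp only [reduceCtorEq, if_false, mem_singleton, if_true, Sum.inr.injEq, hkl] at e1 e2 e3
    have h1 : (1 : F) ≠ 0 := one_ne_zero
    generalize (if k ∈ w then (1 : F) else 0) - (if x = Sum.inr k then 1 else 0) = y at e1 e2 e3
    by_cases c1 : x = Sum.inl i
    · subst c1
      simp only [if_true, Sum.inl.injEq, hq.symm, if_false] at e1 e2
      exact h2 (by push_cast at e1 e2; linear_combination e1 - e2)
    · by_cases c2 : x = Sum.inl q
      · subst c2
        simp only [if_false, c1, Sum.inl.injEq, hqq.symm] at e1 e3
        exact h1 (by push_cast at e1 e3; linear_combination e1 - e3)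
      · simp only [if_false, c1, c2] at e1 e2
        exact h1 (by push_cast at e1 e2; linear_combination e1 - e2)

/-- For k in v and an even variable x_0, the field x^v D_l is up to sign the bracket of x^(v∖{k})
D_0 with x_0 x_k D_l. -/
lemma IsReducedDer.const_inr_mem (hψ : IsReducedDer n p t ψ) (hp3 : 3 < p) (hm : 3 ≤ m)
    (ht : ∀ i, 1 ≤ t i) {l : Fin n} {v : Finset (Fin n)} (hl : l ∉ v)
    (hv : #v % 2 = 1) : vf (Sum.inr l) (mono F (0, v)) ∈ kerOn n p t ψ := by
  obtain ⟨k, hk⟩ : v.Nonempty := by rw [← card_pos]; omega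
  have hkl : k ≠ l := fun h => hl (h ▸ hk)
  have h1 := card_erase_add_one hk
  have h2 := hψ.vf_mem_kerOn ⟨0, by omega⟩ (Sum.inr l) (α := 0) (β := 0) (u := v.erase k)
    (w := {k}) (by omega) (by simp [tau]) (D_inr_of_notMem (by simp [hl]))
    (coeff_ne_zero (by simp) (by simp)) (hψ.const_inl_mem hp3 hm l.pos ht _ (by omega))
    (by simpa using hψ.linear_inr_mem hp3 hm ht _ hkl)
  rwa [add_zero, union_comm, ← insert_eq, insert_erase hk] at h2

end ConstantCoefficients

/-! ### Filtration by degree in the even variables; powers of a single variable -/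

section Levels

variable {F : Type*} [Field F] {m n p : ℕ} [hp : Fact p.Prime] [CharP F p] {t : Fin m → ℕ}
  {ψ : Module.End F (Module.End F (Alg F m n))}

variable (n p t) in
/-- All `D_{uv}` of monomials of filtration level at most `N` are killed. -/
def KillsUpTo (ψ : Module.End F (Module.End F (Alg F m n))) (N : ℕ) : Prop :=
  ∀ u v (a : Expo m n), (∀ i, a.1 i < p ^ t i) → #a.2 % 2 = (tau u + tau v) % 2 →
    ∑ i, a.1 i + tau u + tau v ≤ N → Drs u v (mono F a) ∈ kerOn n p t ψ

variable (n p t) in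
/-- A reduced derivation with vanishing coefficients at the `p`-power fields. -/
structure IsNormalDer (ψ : Module.End F (Module.End F (Alg F m n))) : Prop
    extends IsReducedDer n p t ψ where
  normal : ∀ q s, 1 ≤ s → s < t q → ∃ j, j ≠ q ∧
    cf (Sum.inl j) (0, ∅) (ψ (vf (Sum.inl j) (mono F (Pi.single q (p ^ s), ∅)))) = 0

omit hp in
lemma sum_add_single (α : Fin m → ℕ) (j : Fin m) (r : ℕ) :
    ∑ i, (α + Pi.single j r : Fin m → ℕ) i = ∑ i, α i + r := by
  simp [sum_add_distrib]

omit hp in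
lemma sum_single_add (α : Fin m → ℕ) (j : Fin m) (r : ℕ) :
    ∑ i, (Pi.single j r + α : Fin m → ℕ) i = r + ∑ i, α i := by
  simp [sum_add_distrib]

omit hp in
lemma exists_split (G : Fin m → ℕ) (q : Fin m) :
    ∃ β : Fin m → ℕ, Pi.single q (G q) + β = G ∧ β q = 0 ∧ (∀ i, i ≠ q → β i = G i) ∧
      ∑ i, G i = G q + ∑ i, β i := by
  refine ⟨Function.update G q 0, ?_, by simp, fun i hi => by simp [hi], ?_⟩
  · funext i
    by_cases h : i = q
    · subst h; simp
    · simp [h]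
  · rw [← add_sum_erase _ _ (mem_univ q), ← add_sum_erase _ (Function.update G q 0) (mem_univ q)]
    simp only [Function.update_self, zero_add, add_right_inj]
    exact sum_congr rfl fun i hi => by simp [ne_of_mem_erase hi]

lemma KillsUpTo.vf_inl_mem {N : ℕ} (h : KillsUpTo n p t ψ N) {i j : Fin m} {α : Fin m → ℕ}
    (hα : ∀ i, α i < p ^ t i) (hi : α i = 0) (hij : j ≠ i) (hj : α j + 1 < p ^ t j)
    {w : Finset (Fin n)} (hw : #w % 2 = 0) (hN : ∑ i, α i + 1 ≤ N) :
    vf (Sum.inl i) (mono F (α, w)) ∈ kerOn n p t ψ := by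
  rw [vf_inl_eq_Drs hij hi hw]
  refine h _ _ _ (lt_add_single hα hj) hw ?_
  rw [sum_add_single]
  simpa [tau] using hN

lemma KillsUpTo.vf_inr_mem {N : ℕ} (h : KillsUpTo n p t ψ N) (h2 : (2 : F) ≠ 0) {l : Fin n}
    {α : Fin m → ℕ} (hα : ∀ i, α i < p ^ t i) {v : Finset (Fin n)} (hl : l ∉ v)
    (hv : #v % 2 = 1) (hN : ∑ i, α i + 2 ≤ N) :
    vf (Sum.inr l) (mono F (α, v)) ∈ kerOn n p t ψ := by
  obtain ⟨c, hc⟩ := vf_inr_eq_Drs (F := F) (α := α) h2 hl hv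
  rw [hc]
  exact Submodule.smul_mem _ _ (h _ _ _ hα
    (by rw [card_insert_of_notMem hl]; simp [tau]; omega) (by simp only [tau]; omega))

omit hp in
lemma sum_sub_single {α : Fin m → ℕ} {i : Fin m} (h : α i ≠ 0) :
    ∑ j, (α - Pi.single i 1 : Fin m → ℕ) j + 1 = ∑ j, α j := by
  rw [← sum_add_single _ i 1]
  refine sum_congr rfl fun j _ => ?_
  by_cases hj : j = i
  · subst hj; simp; omega
  · simp [hj]

omit hp in
lemma sub_single_lt {α : Fin m → ℕ} (hα : ∀ i, α i < p ^ t i) (i j : Fin m) :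
    (α - Pi.single i 1 : Fin m → ℕ) j < p ^ t j :=
  lt_of_le_of_lt (Nat.sub_le _ _) (hα j)

/-- Bracketing with D_i lowers the level by one and so lands where ψ already vanishes; one level
further, the weight alone decides. -/
lemma KillsUpTo.Drs_of_weight {N : ℕ} (h : KillsUpTo n p t ψ N) (hψ : IsWeightDer n p t ψ)
    {u v : Var m n} {a : Expo m n} (h1 : ∀ i, a.1 i < p ^ t i)
    (h2 : #a.2 % 2 = (tau u + tau v) % 2) (hN : ∑ i, a.1 i + tau u + tau v ≤ N + 1)
    (hw : ∀ k w, #w % 2 = tau k % 2 → ¬ SameWeight (fun r => (deg r a : F) -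
      (if r = u then 1 else 0) - (if r = v then 1 else 0)) k w) :
    Drs u v (mono F a) ∈ kerOn n p t ψ := by
  refine hψ.mem_kerOn_of_weight (Drs_mono_mem h1 h2) (fun r => lie_eul_Drs r u v h2)
    (fun i => ?_) hw
  rw [lie_D_Drs i u v (mono_homog a h2), D_inl_mono]
  split_ifs with hi
  · rw [Drs_zero]; exact Submodule.zero_mem _
  · refine h _ _ _ (sub_single_lt h1 i) h2 ?_
    have := sum_sub_single hi
    dsimp only
    omega

lemma KillsUpTo.vf_inl_of_weight {N : ℕ} (h : KillsUpTo n p t ψ N) (hψ : IsWeightDer n p t ψ)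
    {i j : Fin m} {α : Fin m → ℕ} (hα : ∀ i, α i < p ^ t i) (hi : α i = 0) (hij : j ≠ i)
    (hj : α j + 1 < p ^ t j) {w : Finset (Fin n)} (hw : #w % 2 = 0) (hN : ∑ i, α i ≤ N)
    (hs : ∀ k w', #w' % 2 = tau k % 2 → ¬ SameWeight (fun r => (deg r (α, w) : F) -
      (if r = Sum.inl i then 1 else 0)) k w') :
    vf (Sum.inl i) (mono F (α, w)) ∈ kerOn n p t ψ := by
  refine hψ.mem_kerOn_of_weight (ModularCartan.vf_inl_mem hij hα hi hj hw)
    (fun r => lie_eul_vf_mono r _ hw) (fun q => ?_) hs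
  rw [lie_D_vf q _ (mono_homog _ hw), D_inl_mono]
  split_ifs with hq
  · rw [map_zero]; exact Submodule.zero_mem _
  · refine h.vf_inl_mem (sub_single_lt hα q) (by simp [hi]) hij (j := j) ?_ hw ?_
    · exact lt_of_le_of_lt (Nat.add_le_add_right (Nat.sub_le _ _) 1) hj
    · have := sum_sub_single hq
      dsimp only at this ⊢
      omega

lemma KillsUpTo.vf_inr_of_weight {N : ℕ} (h : KillsUpTo n p t ψ N) (hψ : IsWeightDer n p t ψ)
    (h2 : (2 : F) ≠ 0) {l : Fin n} {α : Fin m → ℕ} (hα : ∀ i, α i < p ^ t i)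
    {v : Finset (Fin n)} (hl : l ∉ v) (hv : #v % 2 = 1) (hN : ∑ i, α i + 1 ≤ N)
    (hs : ∀ k w', #w' % 2 = tau k % 2 → ¬ SameWeight (fun r => (deg r (α, v) : F) -
      (if r = Sum.inr l then 1 else 0)) k w') :
    vf (Sum.inr l) (mono F (α, v)) ∈ kerOn n p t ψ := by
  have hv' : #v % 2 = tau (Sum.inr l : Var m n) % 2 := by simpa [tau] using hv
  refine hψ.mem_kerOn_of_weight (ModularCartan.vf_inr_mem h2 hα hl hv)
    (fun r => lie_eul_vf_mono r _ hv') (fun q => ?_) hs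
  rw [lie_D_vf q _ (mono_homog _ hv'), D_inl_mono]
  split_ifs with hq
  · rw [map_zero]; exact Submodule.zero_mem _
  · refine h.vf_inr_mem h2 (sub_single_lt hα q) hl hv ?_
    have := sum_sub_single hq
    dsimp only at this ⊢
    omega

omit hp in
lemma cast_top {a s : ℕ} (hs : 1 ≤ s) (h : a + 1 = p ^ s) : (a : F) = -1 := by
  have h1 : ((a + 1 : ℕ) : F) = 0 := by
    rw [h, CharP.cast_eq_zero_iff F p]; exact dvd_pow_self p (by omega)
  push_cast at h1
  linear_combination h1

/-- By Lucas, binom(p^s r, p^s) ≡ r mod p. -/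
lemma choose_prime_pow_mul_ne_zero {s r : ℕ} (h : ¬ p ∣ r) :
    (((p ^ s * r).choose (p ^ s) : ℕ) : F) ≠ 0 := by
  rw [Ne, CharP.cast_eq_zero_iff F p]
  intro hd
  have h1 : (p ^ s * r).choose (p ^ s * 1) ≡ r.choose 1 [MOD p] :=
    Choose.choose_pow_mul_pow_mul_modEq_choose_nat
  rw [mul_one, Nat.choose_one_right] at h1
  exact h ((h1.dvd_iff dvd_rfl).1 hd)

omit hp [CharP F p] in
lemma SameWeight.sub_eq (hn : 0 < n) {d : Var m n → F} {k : Var m n} {w : Finset (Fin n)}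
    (h : SameWeight d k w) (i j : Fin m) : d (Sum.inl i) - d (Sum.inl j) =
      (if k = Sum.inl j then 1 else 0) - (if k = Sum.inl i then 1 else 0) := by
  linear_combination h i ⟨0, hn⟩ - h j ⟨0, hn⟩

omit hp [CharP F p] in
/-- The weight of `x_q^(r) x^w D_j`. -/
lemma sameWeight_single (h2 : (2 : F) ≠ 0) (hm : 3 ≤ m) (hn : 0 < n) {q j : Fin m} (hqj : q ≠ j)
    {r : ℕ} {w w' : Finset (Fin n)} {k : Var m n}
    (h : SameWeight (fun x => (deg x (Pi.single q r, w) : F) -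
      (if x = Sum.inl j then 1 else 0)) k w') : k = Sum.inl j ∧ w' = w ∧ (r : F) = 0 := by
  have h1 : (1 : F) ≠ 0 := one_ne_zero
  obtain ⟨i, hiq, hij⟩ := exists_third hm q j
  have eij := h.sub_eq hn i j
  have eqi := h.sub_eq hn q i
  simp only [deg, Pi.single_eq_of_ne hiq, Pi.single_eq_of_ne hqj.symm, Pi.single_eq_same,
    Sum.inl.injEq, hij, hqj, if_true, if_false, Nat.cast_zero] at eij eqi
  have hk : k = Sum.inl j := by
    by_contra hk
    rw [if_neg hk] at eij
    split_ifs at eij with hki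
    · exact h2 (by linear_combination eij)
    · exact h1 (by linear_combination eij)
  subst hk
  simp only [Sum.inl.injEq, hij.symm, hqj.symm, if_false] at eqi
  refine ⟨rfl, ?_, by linear_combination eqi⟩
  ext l
  have e := h i l
  simp only [deg, Pi.single_eq_of_ne hiq, Sum.inl.injEq, hij, hij.symm,
    if_false, reduceCtorEq] at e
  by_cases c1 : l ∈ w <;> by_cases c2 : l ∈ w' <;> simp [c1, c2] at e ⊢

/-- Fields with a divided power of a single even variable are killed. -/
lemma IsNormalDer.single_mem (hψ : IsNormalDer n p t ψ) (hp3 : 3 < p) (hm : 3 ≤ m) (hn : 0 < n)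
    (ht : ∀ i, 1 ≤ t i) {N : ℕ} (h : KillsUpTo n p t ψ N) {q j : Fin m} (hqj : q ≠ j) {r : ℕ}
    (hr : r < p ^ t q) (hrN : r ≤ N) {w : Finset (Fin n)} (hw : #w % 2 = 0) :
    vf (Sum.inl j) (mono F (Pi.single q r, w)) ∈ kerOn n p t ψ := by
  have h2 := two_ne_zero_of_three_lt (F := F) hp3
  have h3 := three_lt_pow hp3 ht
  obtain ⟨i, hiq, hij⟩ := exists_third hm q j
  rcases eq_or_ne r 0 with rfl | hr0
  · simpa using hψ.const_inl_mem hp3 hm hn ht j hw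
  have hi1 : ∀ x, x ≠ q → (Pi.single q r : Fin m → ℕ) x + 1 < p ^ t x := fun x hx => by
    simp only [Pi.single_eq_of_ne hx]; have := h3 x; omega
  have hsum : ∀ s, ∑ x, (Pi.single q s : Fin m → ℕ) x = s := fun s => by simp
  -- An exponent prime to p already gives a weight that no field free of even variables has.
  by_cases hpr : (r : F) ≠ 0
  · exact h.vf_inl_of_weight hψ.toIsWeightDer (fun x => single_lt hr) (by simp [hqj.symm]) hij
      (hi1 i hiq) hw (by rw [hsum]; exact hrN) fun k w' _ hs =>
        hpr (sameWeight_single h2 hm hn hqj hs).2.2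
  rw [not_not, CharP.cast_eq_zero_iff F p] at hpr
  obtain ⟨s, r', hr', rfl⟩ := Nat.exists_eq_pow_mul_and_not_dvd hr0 p hp.out.ne_one
  have hs : s ≠ 0 := by rintro rfl; exact hr' (by simpa using hpr)
  have hps : p ≤ p ^ s := Nat.le_self_pow hs p
  have hr'0 : r' ≠ 0 := by rintro rfl; simp at hr'
  rcases eq_or_ne r' 1 with rfl | hr1
  · rw [mul_one] at hr hrN hi1 ⊢
    -- move from one field to another along a linear field
    have key : ∀ x y : Fin m, x ≠ q → y ≠ q → x ≠ y → ∀ w : Finset (Fin n), #w % 2 = 0 →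
        vf (Sum.inl x) (mono F (Pi.single q (p ^ s), ∅)) ∈ kerOn n p t ψ →
        vf (Sum.inl y) (mono F (Pi.single q (p ^ s), w)) ∈ kerOn n p t ψ := by
      intro x y hx hy hxy w hw h1
      have := hψ.vf_mem_kerOn x (Sum.inl y) (α := Pi.single q (p ^ s)) (β := 0) (u := ∅) (w := w)
        rfl hw (D_inl_single_ne hy _ _) (coeff_ne_zero (by simp) (by simp)) h1
        (by simpa using hψ.linear_inl_mem hp3 hm hn ht hxy hw)
      simpa using this
    -- For exponent p^s the weight allows ψ only a multiple of D_{j₀}; the normalisation says that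
    -- this multiple is zero.
    obtain ⟨j₀, hj₀, h0⟩ := hψ.normal q s (by omega)
      ((Nat.pow_lt_pow_iff_right hp.out.one_lt).1 hr)
    have hmem : vf (Sum.inl j₀) (mono F (Pi.single q (p ^ s), ∅)) ∈ kerOn n p t ψ := by
      obtain ⟨i, hiq, hij⟩ := exists_third hm q j₀
      have hy := ModularCartan.vf_inl_mem (F := F) (n := n) (w := ∅) hij
        (fun x => single_lt (i := x) hr) (by simp [hj₀]) (hi1 i hiq) rfl
      have hD : ∀ x, ⁅D (F := F) (m := m) (n := n) (Sum.inl x),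
          vf (Sum.inl j₀) (mono F (Pi.single q (p ^ s), ∅))⁆ ∈ kerOn n p t ψ := by
        intro x
        rw [lie_D_vf x _ (mono_homog _ rfl)]
        by_cases hx : x = q
        · subst hx
          rw [D_inl_mono, if_neg (by simp; omega)]
          refine h.vf_inl_mem (sub_single_lt (fun x => single_lt hr) _) (by simp [hj₀]) hij
            ?_ rfl ?_
          · simp only [Pi.sub_apply, Pi.single_eq_of_ne hiq]
            have := h3 i; omega
          · rw [sum_sub_single (by simp; omega), hsum]; exact hrN
        · rw [D_inl_single_ne hx, map_zero]; exact Submodule.zero_mem _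
      refine mem_kerOn.2 ⟨hy, evenFields_ext (hψ.map_mem _ hy) (Submodule.zero_mem _)
        fun k a => ?_⟩
      rw [map_zero]
      by_contra hne
      obtain ⟨ha, hs⟩ := hψ.sameWeight hy (fun r => lie_eul_vf_mono r _ rfl) hD hne
      obtain ⟨rfl, ha', -⟩ := sameWeight_single h2 hm hn hj₀.symm hs
      apply hne
      have : a = (0, ∅) := Prod.ext ha ha'
      rwa [this]
    -- One move changes the direction, so returning to j₀ with a new factor x^w takes two moves
    -- through a third direction.
    by_cases hjj : j₀ = j
    · subst hjj
      refine key i j₀ hiq hj₀ hij w hw ?_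
      exact key j₀ i hj₀ hiq hij.symm ∅ rfl hmem
    · exact key j₀ j hj₀ hqj.symm hjj w hw hmem
  -- For r = p^s (b + 1) with b > 0, the exponent splits as p^s + p^s b: the bracket of x_q^(p^s)
  -- x^w D_i with x_q^(p^s b) x_i D_j has coefficient binom(p^s (b + 1), p^s), nonzero in F.
  · obtain ⟨b, rfl⟩ : ∃ b, r' = b + 1 := ⟨r' - 1, by omega⟩
    have hb : b ≠ 0 := by omega
    rw [mul_add, mul_one] at hr hrN hr0 ⊢
    have hb' : 0 < p ^ s * b := Nat.mul_pos (by omega) (by omega)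
    have h1 : vf (Sum.inl i) (mono F (Pi.single q (p ^ s), w)) ∈ kerOn n p t ψ :=
      h.vf_inl_mem (fun x => single_lt (by omega)) (by simp [hiq]) hij.symm
        (by simp only [Pi.single_eq_of_ne hqj.symm]; have := h3 j; omega) hw
        (by rw [hsum]; omega)
    have hlt : ∀ x, (Pi.single q (p ^ s * b) + Pi.single i 1 : Fin m → ℕ) x < p ^ t x :=
      lt_add_single (fun x => single_lt (by omega))
        (by simp only [Pi.single_eq_of_ne hiq]; have := h3 i; omega)
    have h4 : vf (Sum.inl j) (mono F (Pi.single q (p ^ s * b) + Pi.single i 1, ∅)) ∈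
        kerOn n p t ψ := by
      refine h.vf_inl_mem hlt (by simp [hij.symm, hqj.symm]) hij ?_ rfl ?_
      · simp [hiq]; have := h3 i; omega
      · rw [sum_add_single, hsum]; omega
    have := hψ.vf_mem_kerOn i (Sum.inl j) hw rfl (D_inl_single_ne hqj.symm _ _) ?_ h1 h4
    · rwa [union_empty, ← Pi.single_add, add_comm] at this
    · rw [coeff_of_disjoint (by simp)]
      refine mul_ne_zero (pow_ne_zero _ (neg_ne_zero.2 one_ne_zero))
        (prod_ne_zero_iff.2 fun x _ => ?_)
      by_cases hx : x = q
      · subst hx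
        simp only [Pi.single_eq_same]
        have := choose_prime_pow_mul_ne_zero (F := F) (s := s) hr'
        rwa [mul_add, mul_one, add_comm] at this
      · simp [hx]

end Levels

/-! ### Raising the level: fields g D_i, g D_l and the D_{ij}, D_{kl} of equal parity -/

section InductionStep

variable {F : Type*} [Field F] {m n p : ℕ} [hp : Fact p.Prime] [CharP F p] {t : Fin m → ℕ}
  {ψ : Module.End F (Module.End F (Alg F m n))} {N : ℕ}

omit hp in
lemma split_trunc {G β : Fin m → ℕ} {q : Fin m} (hG : ∀ i, G i < p ^ t i)
    (h0 : β q = 0) (h1 : ∀ i, i ≠ q → β i = G i) (i : Fin m) : β i < p ^ t i := by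
  by_cases h : i = q
  · subst h; rw [h0]; exact (Nat.zero_le _).trans_lt (hG i)
  · rw [h1 i h]; exact hG i

/-- Fields `g x^w D_i` with `g` independent of `x_i` are killed one level further. -/
lemma IsNormalDer.inl_mem (hψ : IsNormalDer n p t ψ) (hp3 : 3 < p) (hm : 3 ≤ m) (hn : 0 < n)
    (ht : ∀ i, 1 ≤ t i) (h : KillsUpTo n p t ψ N) {i j : Fin m} {G : Fin m → ℕ}
    (hG : ∀ i, G i < p ^ t i) (hi : G i = 0) (hji : j ≠ i) (hj : G j + 1 < p ^ t j)
    {w : Finset (Fin n)} (hw : #w % 2 = 0) (hN : ∑ i, G i ≤ N) :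
    vf (Sum.inl i) (mono F (G, w)) ∈ kerOn n p t ψ := by
  have h2 := two_ne_zero_of_three_lt (F := F) hp3
  have h3 := three_lt_pow hp3 ht
  -- An exponent equal to 1 gives weight 1 at q against -1 at i.
  by_cases hone : ∃ q, G q = 1
  · obtain ⟨q, hq⟩ := hone
    have hqi : q ≠ i := by rintro rfl; omega
    refine h.vf_inl_of_weight hψ.toIsWeightDer hG hi hji hj hw hN fun k w' _ =>
      not_sameWeight_of_one_neg_one h2 (three_ne_zero_of_three_lt hp3) (i := q) (j := i) ?_ ?_
        ⟨0, hn⟩ k w'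
    · simp [deg, hq, hqi]
    · simp [deg, hi]
  push Not at hone
  by_cases hq : ∃ q, q ≠ j ∧ G q ≠ 0
  swap
  · push Not at hq
    have hG' : G = Pi.single j (G j) := by
      funext x
      by_cases hx : x = j
      · subst hx; simp
      · simp [hx, hq x hx]
    have hle : G j ≤ ∑ i, G i := single_le_sum (fun i _ => Nat.zero_le (G i)) (mem_univ j)
    rw [hG']
    exact hψ.single_mem hp3 hm hn ht h hji (hG j) (by omega) hw
  obtain ⟨q, hqj, hq0⟩ := hq
  have hqi : q ≠ i := by rintro rfl; exact hq0 hi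
  obtain ⟨β, hβ, hβq, hβe, hs⟩ := exists_split G q
  have hβt := split_trunc hG hβq hβe
  have hq1 := hone q
  by_cases hβ0 : β = 0
  · subst hβ0
    rw [add_zero] at hβ
    rw [← hβ]
    refine hψ.single_mem hp3 hm hn ht h hqi (hG q) ?_ hw
    simp at hs; omega
  have hpos : 0 < ∑ i, β i := by
    by_contra hz
    apply hβ0
    funext x
    have : ∑ i, β i = 0 := by omega
    exact (sum_eq_zero_iff.1 this) x (mem_univ x)
  have hne : ∀ x, x ≠ q → (Pi.single q (G q) : Fin m → ℕ) x = 0 := fun x hx => by simp [hx]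
  -- The power of x_q is split off: the field is a bracket of x_q^(G q) x^w D_j with x^(β + ε_j)
  -- D_i. Both factors have level at most N because β ≠ 0 and G q ≥ 2.
  have e1 : vf (Sum.inl j) (mono F (Pi.single q (G q), w)) ∈ kerOn n p t ψ :=
    h.vf_inl_mem (j := i) (fun x => single_lt (hG q)) (hne j hqj.symm) hji.symm
      (by rw [hne i hqi.symm]; have := h3 i; omega) hw (by simp; omega)
  have e2 : vf (Sum.inl i) (mono F (β + Pi.single j 1, ∅)) ∈ kerOn n p t ψ := by
    refine h.vf_inl_mem (j := q) (lt_add_single hβt (by rwa [hβe j hqj.symm]))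
      (by simp [hβe i hqi.symm, hi, hji.symm]) hqi ?_ rfl ?_
    · simp [hβq, hqj]; have := h3 q; omega
    · rw [sum_add_single]; omega
  have := hψ.vf_mem_kerOn j (Sum.inl i) hw rfl (D_inl_single_ne hqi.symm _ _)
    (coeff_ne_zero (by simp) fun x => ?_) e1 e2
  · rwa [union_empty, hβ] at this
  · by_cases hx : x = q
    · right; rw [hx]; exact hβq
    · left; exact hne x hx

omit hp in
lemma lie_single_Drs {q j : Fin m} (hqj : q ≠ j) {u v : Var m n} (hu : u ≠ Sum.inl q)
    (hv : v ≠ Sum.inl q) {r : ℕ} {β : Fin m → ℕ} {w : Finset (Fin n)}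
    (hw : #w % 2 = (tau u + tau v) % 2) :
    ⁅vf (m := m) (n := n) (Sum.inl j) (mono F (Pi.single q r, ∅)), Drs u v (mono F (β + Pi.single j 1, w))⁆ =
      coeff F (Pi.single q r, ∅) (β, w) • Drs u v (mono F (Pi.single q r + β, w)) := by
  have hD : ∀ x : Var m n, x ≠ Sum.inl q → D x (mono F (Pi.single q r, ∅)) = 0 := by
    rintro (x | x) hx
    · exact D_inl_single_ne (fun h => hx (by rw [h])) _ _
    · exact D_inr_of_notMem (by simp)
  rw [lie_vf_Drs (mono_homog _ rfl) (hD _ (by simpa using hqj.symm)) u v (mono_homog _ hw), hD u hu,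
    hD v hv, vf_apply, D_inl_add, mul_mono, Drs_smul]
  simp [Drs_zero]

/-- If x_i or x_j is absent from x^(α), at most one field remains. Otherwise let β be α with its
i-th entry removed: the bracket of x_i^(α i) D_j with D_{ij}(x^(β + ε_j) x^w) = -x^(β) x^w D_i gives
the element, and the correction term is a D_{jj}, hence zero. -/
lemma IsNormalDer.Drs_inl_inl_mem_of_lt (hψ : IsNormalDer n p t ψ) (hp3 : 3 < p) (hm : 3 ≤ m)
    (hn : 0 < n) (ht : ∀ i, 1 ≤ t i) (h : KillsUpTo n p t ψ N) {i j : Fin m} (hij : i ≠ j)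
    {α : Fin m → ℕ} (hα : ∀ i, α i < p ^ t i) (hj : α j + 1 < p ^ t j) {w : Finset (Fin n)}
    (hw : #w % 2 = 0) (hN : ∑ i, α i ≤ N + 1) :
    Drs (Sum.inl i) (Sum.inl j) (mono F (α, w)) ∈ kerOn n p t ψ := by
  have h3 := three_lt_pow hp3 ht
  have hw' : #w % 2 = (tau (Sum.inl i : Var m n) + tau (Sum.inl j : Var m n)) % 2 := hw
  by_cases hi0 : α i = 0
  · rw [Drs_inl_inl _ _ (mono_homog _ hw), D_inl_of_eq_zero hi0, map_zero, zero_sub, D_inl_mono]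
    split_ifs with hj0
    · simp
    · refine Submodule.neg_mem _ (hψ.inl_mem hp3 hm hn ht h (sub_single_lt hα j)
        (by simp [hi0]) hij.symm ?_ hw ?_)
      · simp; omega
      · have := sum_sub_single hj0; dsimp only at this; omega
  obtain ⟨β, hβ, hβi, hβe, hs⟩ := exists_split α i
  have hβt := split_trunc hα hβi hβe
  by_cases hj0 : α j = 0
  · rw [Drs_inl_inl _ _ (mono_homog _ hw), D_inl_of_eq_zero (i := j) hj0, map_zero, sub_zero,
      D_inl_mono, if_neg hi0]
    obtain ⟨x, hxi, hxj⟩ := exists_third hm i j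
    refine hψ.inl_mem hp3 hm hn ht h (sub_single_lt hα i) (by simp [hj0]) hij ?_ hw ?_
    · have := hα i; simp; omega
    · have := sum_sub_single hi0; omega
  have hle : β j ≤ ∑ x, β x := single_le_sum (fun i _ => Nat.zero_le (β i)) (mem_univ j)
  have hβj := hβe j hij.symm
  have e1 : vf (Sum.inl j) (mono F (Pi.single i (α i), ∅)) ∈ kerOn n p t ψ :=
    hψ.single_mem hp3 hm hn ht h hij (hα i) (by omega) rfl
  have e2 : vf (Sum.inl i) (mono F (β, w)) ∈ kerOn n p t ψ :=
    hψ.inl_mem hp3 hm hn ht h hβt hβi hij.symm (by rwa [hβj]) hw (by omega)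
  have e3 : Drs (Sum.inl i) (Sum.inl j) (mono F (β + Pi.single j 1, w)) ∈ kerOn n p t ψ := by
    rw [Drs_inl_antisymm _ _ (mono_homog _ hw), ← vf_inl_eq_Drs hij.symm hβi hw]
    exact Submodule.neg_mem _ e2
  have e4 := hψ.lie_mem_kerOn e1 e3
  have hD : D (Sum.inl j) (mono F (Pi.single i (α i), (∅ : Finset (Fin n)))) = 0 :=
    D_inl_single_ne hij.symm _ _
  have hz : ∀ g : Alg F m n, g ∈ homog F m n 0 →
      Drs (Sum.inl j) (Sum.inl j) g = 0 := fun g hg => by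
    rw [Drs_inl_inl _ _ hg, sub_self]
  rw [lie_vf_Drs (mono_homog _ rfl) hD _ _ (mono_homog _ hw'), hD, vf_apply,
    D_inl_add, mul_mono, Drs_smul, hz] at e4
  · simp only [map_zero, LinearMap.zero_apply, Drs_zero, smul_zero, sub_zero, empty_union,
      hβ] at e4
    refine (Submodule.smul_mem_iff _ (coeff_ne_zero (by simp) fun x => ?_)).1 e4
    by_cases hx : x = i
    · right; rw [hx]; exact hβi
    · left; simp [hx]
  · exact mul_homog (q := 0) (q' := 0) (D_homog (q := 0) (Sum.inl i) (mono_homog _ rfl))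
      (mono_homog _ hw)

omit hp in
-- Equal weights at i and j exclude a field along D_i. At an odd direction l other than that of the
-- field, the required equality is between -2 or -1 and 0 or 1.
lemma not_sameWeight_of_neg_two (h2 : (2 : F) ≠ 0) (h3 : (3 : F) ≠ 0) (hn : 2 ≤ n)
    {d : Var m n → F} {i j : Fin m} (hij : i ≠ j) (hi : d (Sum.inl i) = -2)
    (hj : d (Sum.inl j) = -2) {v : Finset (Fin n)}
    (hv : ∀ l, d (Sum.inr l) = if l ∈ v then 1 else 0) (k : Var m n) (w : Finset (Fin n)) :
    ¬ SameWeight d k w := by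
  intro h
  have h1 : (1 : F) ≠ 0 := one_ne_zero
  have hki : k ≠ Sum.inl i := by
    rintro rfl
    have := h.sub_eq (by omega) i j
    rw [hi, hj] at this
    simp only [Sum.inl.injEq, hij, if_false, if_true] at this
    exact h1 (by linear_combination this)
  obtain ⟨l, hl⟩ : ∃ l : Fin n, k ≠ Sum.inr l := by
    by_cases hk : k = Sum.inr ⟨0, by omega⟩
    · exact ⟨⟨1, by omega⟩, by rw [hk]; simp⟩
    · exact ⟨_, hk⟩
  have e := h i l
  rw [hi, hv, if_neg hki, if_neg hl] at e
  split_ifs at e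
  · exact h2 (by linear_combination -e)
  · exact h1 (by linear_combination -e)
  · exact h3 (by linear_combination -e)
  · exact h2 (by linear_combination -e)

lemma IsNormalDer.Drs_inl_inl_mem (hψ : IsNormalDer n p t ψ) (hp3 : 3 < p) (hm : 3 ≤ m)
    (hn : 2 ≤ n) (ht : ∀ i, 1 ≤ t i) (h : KillsUpTo n p t ψ N) (i j : Fin m)
    {α : Fin m → ℕ} (hα : ∀ i, α i < p ^ t i) {w : Finset (Fin n)}
    (hw : #w % 2 = 0) (hN : ∑ i, α i ≤ N + 1) :
    Drs (Sum.inl i) (Sum.inl j) (mono F (α, w)) ∈ kerOn n p t ψ := by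
  by_cases hij : i = j
  · rw [hij, Drs_inl_inl _ _ (mono_homog _ hw), sub_self]; exact Submodule.zero_mem _
  by_cases hj : α j + 1 < p ^ t j
  · exact hψ.Drs_inl_inl_mem_of_lt hp3 hm (by omega) ht h hij hα hj hw hN
  by_cases hi : α i + 1 < p ^ t i
  · rw [Drs_inl_antisymm _ _ (mono_homog _ hw)]
    exact Submodule.neg_mem _
      (hψ.Drs_inl_inl_mem_of_lt hp3 hm (by omega) ht h (Ne.symm hij) hα hi hw hN)
  -- Both exponents are maximal, hence -1 in F, and D_{ij} lowers each weight to -2.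
  have hti : (α i : F) = -1 := cast_top (ht i) (by have := hα i; omega)
  have htj : (α j : F) = -1 := cast_top (ht j) (by have := hα j; omega)
  refine h.Drs_of_weight hψ.toIsWeightDer hα hw (by simpa [tau] using hN) fun k w' _ =>
    not_sameWeight_of_neg_two (two_ne_zero_of_three_lt hp3) (three_ne_zero_of_three_lt hp3) hn
      (v := w) hij ?_ ?_ (fun l => ?_) k w'
  · simp only [deg, hti, Sum.inl.injEq, hij, if_true, if_false]; norm_num
  · simp only [deg, htj, Sum.inl.injEq, Ne.symm hij, if_true, if_false]; norm_num
  · simp [deg]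

omit hp in
-- The odd directions l and x ∈ v have weights differing by 2. A field free of even variables
-- reaches this difference only along D_l, with coefficient containing x_x and not x_l, and the even
-- part of the weight is then zero.
lemma SameWeight.eq_zero_of_odd (h2 : (2 : F) ≠ 0) (h3 : (3 : F) ≠ 0) {α : Fin m → ℕ} {l : Fin n}
    {v : Finset (Fin n)} (hl : l ∉ v) (hv : v.Nonempty) {k : Var m n} {w : Finset (Fin n)}
    (h : SameWeight (fun r => (deg r (α, v) : F) - (if r = Sum.inr l then 1 else 0)) k w)
    (i : Fin m) : (α i : F) = 0 := by
  have h1 : (1 : F) ≠ 0 := one_ne_zero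
  obtain ⟨x, hx⟩ := hv
  have hxl : x ≠ l := fun e => hl (e ▸ hx)
  have e1 := h i l
  have e2 := h i x
  simp only [deg, hl, hx, hxl, Sum.inr.injEq, reduceCtorEq, if_true, if_false, Nat.cast_zero,
    Nat.cast_one] at e1 e2
  by_cases hk : k = Sum.inr l
  · subst hk
    simp only [Sum.inr.injEq, hxl.symm, reduceCtorEq, if_true, if_false] at e1 e2
    split_ifs at e1 e2
    · exact absurd (by linear_combination e2 - e1) h1
    · exact absurd (by linear_combination e2 - e1) h2
    · linear_combination e1
    · exact absurd (by linear_combination e2 - e1) h1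
  · exfalso
    rw [if_neg hk] at e1
    generalize (if k = Sum.inl i then (1 : F) else 0) = y at e1 e2
    split_ifs at e1 e2
    · exact h3 (by linear_combination e2 - e1)
    · exact h2 (by linear_combination e2 - e1)
    · exact mul_ne_zero h2 h2 (by linear_combination e2 - e1)
    · exact h3 (by linear_combination e2 - e1)
    · exact h2 (by linear_combination e2 - e1)
    · exact h1 (by linear_combination e2 - e1)
    · exact h3 (by linear_combination e2 - e1)
    · exact h2 (by linear_combination e2 - e1)

omit hp in
lemma add_two_lt_of_dvd (hp3 : 3 < p) {a s : ℕ} (hs : 1 ≤ s) (ha : a < p ^ s) (hd : p ∣ a) :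
    a + 3 < p ^ s := by
  obtain ⟨b, rfl⟩ := hd
  obtain ⟨s, rfl⟩ : ∃ s', s = s' + 1 := ⟨s - 1, by omega⟩
  rw [pow_succ'] at ha ⊢
  have hb : b < p ^ s := lt_of_mul_lt_mul_left ha (Nat.zero_le _)
  have : p * (b + 1) ≤ p * p ^ s := Nat.mul_le_mul_left _ hb
  rw [mul_add, mul_one] at this
  omega

/-- Fields `g x^v D_l` with `x_l` odd and not in `v` are killed one level further. -/
lemma IsNormalDer.inr_mem (hψ : IsNormalDer n p t ψ) (hp3 : 3 < p) (hm : 3 ≤ m)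
    (ht : ∀ i, 1 ≤ t i) (h : KillsUpTo n p t ψ N) {l : Fin n} {G : Fin m → ℕ}
    (hG : ∀ i, G i < p ^ t i) {v : Finset (Fin n)} (hl : l ∉ v) (hv : #v % 2 = 1)
    (hN : ∑ i, G i + 1 ≤ N) :
    vf (Sum.inr l) (mono F (G, v)) ∈ kerOn n p t ψ := by
  have h2 := two_ne_zero_of_three_lt (F := F) hp3
  have h3 := three_lt_pow hp3 ht
  have hvn : v.Nonempty := by rw [← card_pos]; omega
  by_cases h0 : ∀ i, (G i : F) = 0
  swap
  · exact h.vf_inr_of_weight hψ.toIsWeightDer h2 hG hl hv hN fun k w' _ hs =>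
      h0 (hs.eq_zero_of_odd h2 (three_ne_zero_of_three_lt hp3) hl hvn)
  simp only [CharP.cast_eq_zero_iff F p] at h0
  by_cases hG0 : G = 0
  · rw [hG0]; exact hψ.const_inr_mem hp3 hm ht hl hv
  obtain ⟨q, hq⟩ : ∃ q, G q ≠ 0 := by
    by_contra hq; push Not at hq; exact hG0 (funext hq)
  have hqp : p ≤ G q := Nat.le_of_dvd (by omega) (h0 q)
  obtain ⟨j, hjq, -⟩ := exists_third hm q q
  obtain ⟨i, hiq, hij⟩ := exists_third hm q j
  obtain ⟨β, hβ, hβq, hβe, hs⟩ := exists_split G q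
  have hβt := split_trunc hG hβq hβe
  have hne : ∀ x, x ≠ q → (Pi.single q (G q) : Fin m → ℕ) x = 0 := fun x hx => by simp [hx]
  -- All exponents are now divisible by p, so G q ≥ p, and the power of x_q can be split off:
  -- [x_q^(G q) D_j, x^(β + ε_j) x^v D_l].
  have e1 : vf (Sum.inl j) (mono F (Pi.single q (G q), ∅)) ∈ kerOn n p t ψ :=
    h.vf_inl_mem (j := i) (fun x => single_lt (hG q)) (hne j hjq) hij
      (by rw [hne i hiq]; have := h3 i; omega) rfl (by simp; omega)
  have e2 : vf (Sum.inr l) (mono F (β + Pi.single j 1, v)) ∈ kerOn n p t ψ := by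
    refine h.vf_inr_mem h2 (lt_add_single hβt ?_) hl hv ?_
    · rw [hβe j hjq]
      have := add_two_lt_of_dvd hp3 (ht j) (hG j) (h0 j); omega
    · rw [sum_add_single]; omega
  have := hψ.vf_mem_kerOn j (Sum.inr l) rfl (by simpa [tau] using hv)
    (D_inr_of_notMem (by simp)) (coeff_ne_zero (by simp) fun x => ?_) e1 e2
  · rwa [empty_union, hβ] at this
  · by_cases hx : x = q
    · right; rw [hx]; exact hβq
    · left; exact hne x hx

lemma IsNormalDer.Drs_inr_self_mem (hψ : IsNormalDer n p t ψ) (hp3 : 3 < p) (hm : 3 ≤ m)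
    (ht : ∀ i, 1 ≤ t i) (h : KillsUpTo n p t ψ N) (l : Fin n)
    {a : Expo m n} (ha : ∀ i, a.1 i < p ^ t i) (hw : #a.2 % 2 = 0)
    (hN : ∑ i, a.1 i + 1 ≤ N) :
    Drs (Sum.inr l) (Sum.inr l) (mono F a) ∈ kerOn n p t ψ := by
  rw [Drs_inr_self _ (mono_homog _ hw), D_inr_mono]
  split_ifs with hl
  · rw [map_smul]
    have := card_erase_add_one hl
    exact Submodule.smul_mem _ _ (Submodule.smul_mem _ _
      (hψ.inr_mem hp3 hm ht h ha (by simp) (by omega) hN))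
  · rw [map_zero, smul_zero]; exact Submodule.zero_mem _

/-- Polarisation: the rotation x_l D_k applied to D_{ll}(f) yields D_{ll}(x_l D_k f) + 2 D_{kl}(f).
-/
lemma IsNormalDer.Drs_inr_inr_mem (hψ : IsNormalDer n p t ψ) (hp3 : 3 < p) (hm : 3 ≤ m)
    (ht : ∀ i, 1 ≤ t i) (h : KillsUpTo n p t ψ N) (k l : Fin n)
    {a : Expo m n} (ha : ∀ i, a.1 i < p ^ t i) (hw : #a.2 % 2 = 0)
    (hN : ∑ i, a.1 i + 1 ≤ N) :
    Drs (Sum.inr k) (Sum.inr l) (mono F a) ∈ kerOn n p t ψ := by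
  have h2 := two_ne_zero_of_three_lt (F := F) hp3
  by_cases hkl : k = l
  · rw [hkl]; exact hψ.Drs_inr_self_mem hp3 hm ht h l ha hw hN
  have e1 := hψ.rot_mem l k (Ne.symm hkl)
  have e2 := hψ.Drs_inr_self_mem hp3 hm ht h l ha hw hN
  have e3 := hψ.lie_mem_kerOn e1 e2
  have hw' : #a.2 % 2 = (tau (Sum.inr l : Var m n) + tau (Sum.inr l : Var m n)) % 2 := by
    simpa [tau] using hw
  have hX : mono F ((0 : Fin m → ℕ), ({l} : Finset (Fin n))) = X F (Sum.inr l) := rfl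
  rw [lie_vf_Drs (mono_homog _ (by simp [tau])) (D_inr_of_notMem (by simpa using hkl)) _ _
    (mono_homog _ hw'), hX, D_X, if_pos rfl, one_mul', vf_apply, ← hX] at e3
  have e4 : Drs (Sum.inr l) (Sum.inr l) (mul (mono F (0, {l})) (D (Sum.inr k) (mono F a))) ∈
      kerOn n p t ψ := by
    rw [D_inr_mono]
    split_ifs with hk
    · rw [map_smul, mul_mono, Drs_smul, Drs_smul]
      refine Submodule.smul_mem _ _ ?_
      by_cases hl : l ∈ a.2.erase k
      · rw [coeff_zero_of_not_disjoint (by simpa using hl), zero_smul]; exact Submodule.zero_mem _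
      · refine Submodule.smul_mem _ _ (hψ.Drs_inr_self_mem hp3 hm ht h l (by simpa using ha) ?_
          (by simpa using hN))
        have := card_erase_add_one hk
        rw [← insert_eq, card_insert_of_notMem hl, this, hw]
    · rw [map_zero, Drs_zero]; exact Submodule.zero_mem _
  have e5 := Submodule.sub_mem _ e4 e3
  rw [sub_sub_cancel] at e5
  have e6 : (2 : F) • Drs (Sum.inr k) (Sum.inr l) (mono F a) ∈ kerOn n p t ψ := by
    convert e5 using 1
    simp only [tau]
    norm_num
    module
  exact (Submodule.smul_mem_iff _ h2).1 e6

end InductionStep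

/-! ### Raising the level: the mixed D_{il}, and vanishing of normalised derivations -/

section MixedFields

variable {F : Type*} [Field F] {m n p : ℕ} [hp : Fact p.Prime] [CharP F p] {t : Fin m → ℕ}
  {ψ : Module.End F (Module.End F (Alg F m n))} {N : ℕ}

lemma Drs_inr_inl (l : Fin n) (i : Fin m) {f : Alg F m n} (hf : f ∈ homog F m n 1) :
    Drs (Sum.inr l) (Sum.inl i) f = Drs (Sum.inl i) (Sum.inr l) f := by
  have hf' : f ∈ homog F m n (tau (Sum.inr l : Var m n) + tau (Sum.inl i : Var m n)) := hf
  rw [Drs_inl_inr _ _ hf, Drs_eq hf']; simp [tau, add_comm]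

lemma coeff_eq_zero_of_top {a b : Expo m n} (ha : ∀ i, a.1 i < p ^ t i)
    (hb : ∀ i, b.1 i < p ^ t i) {i : Fin m} (h : p ^ t i ≤ a.1 i + b.1 i) : coeff F a b = 0 := by
  unfold coeff
  split_ifs
  · rw [prod_eq_zero (mem_univ i), mul_zero]
    rw [CharP.cast_eq_zero_iff F p]
    exact dvd_choose_of_carry hp.out (ha i) (hb i) h
  · rfl

/-- `D_{il}(x^(α) x^u)` is killed when `u` contains an index other than `l`. -/
lemma IsNormalDer.Drs_inl_inr_mem_of_mem (hψ : IsNormalDer n p t ψ) (hp3 : 3 < p) (hm : 3 ≤ m)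
    (hn : 2 ≤ n) (ht : ∀ i, 1 ≤ t i) (h : KillsUpTo n p t ψ N) (i : Fin m) {k l : Fin n}
    (hkl : k ≠ l) {α : Fin m → ℕ} (hα : ∀ i, α i < p ^ t i) {u : Finset (Fin n)} (hk : k ∈ u)
    (hu : #u % 2 = 1) (hN : ∑ i, α i ≤ N) :
    Drs (Sum.inl i) (Sum.inr l) (mono F (α, u)) ∈ kerOn n p t ψ := by
  have h3 := three_lt_pow hp3 ht
  obtain ⟨j, hji, -⟩ := exists_third hm i i
  have hcard := card_erase_add_one hk
  have hw : #(u.erase k) % 2 = 0 := by omega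
  -- Bracketing x_j x_k D_l with D_{ij}(x^(α) x^(u∖{k})) gives a nonzero multiple of D_{il}(x^(α)
  -- x^u) plus a D_{ij} term that is already killed.
  have e1 := hψ.linear_inr_mem hp3 hm ht j hkl
  have e2 : Drs (Sum.inl i) (Sum.inl j) (mono F (α, u.erase k)) ∈ kerOn n p t ψ :=
    hψ.Drs_inl_inl_mem hp3 hm hn ht h i j hα hw (by omega)
  have e3 := hψ.lie_mem_kerOn e1 e2
  have hw' : #(u.erase k) % 2 = (tau (Sum.inl i : Var m n) + tau (Sum.inl j : Var m n)) % 2 := hw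
  rw [lie_vf_Drs (mono_homog _ (by simp [tau])) (D_inr_of_notMem (by simpa using hkl.symm)) _ _
    (mono_homog _ hw'), D_inl_single_ne hji.symm, D_inl_single_self, vf_apply, mul_mono] at e3
  have e4 : Drs (Sum.inl i) (Sum.inl j) (mul (mono F (Pi.single j 1, {k}))
      (D (Sum.inr l) (mono F (α, u.erase k)))) ∈ kerOn n p t ψ := by
    rw [D_inr_mono]
    split_ifs with hl
    · rw [map_smul, mul_mono, Drs_smul, Drs_smul]
      refine Submodule.smul_mem _ _ ?_
      have hlt : ∀ x, (Pi.single j 1 : Fin m → ℕ) x < p ^ t x := fun x =>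
        single_lt (by have := h3 j; omega)
      by_cases hj : α j + 1 < p ^ t j
      · refine Submodule.smul_mem _ _ (hψ.Drs_inl_inl_mem hp3 hm hn ht h i j ?_ ?_ ?_)
        · rw [add_comm]; exact lt_add_single hα hj
        · have := card_erase_add_one hl
          rw [card_union_of_disjoint (by simp), card_singleton, add_comm, this]
          exact hw
        · rw [sum_single_add]; dsimp only; omega
      -- When α j is maximal, the product with x_j vanishes by a carry in the binomial coefficient.
      · rw [coeff_eq_zero_of_top (i := j) hlt hα (by
          simp only [Pi.single_eq_same]; omega), zero_smul]
        exact Submodule.zero_mem _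
    · rw [map_zero, Drs_zero]; exact Submodule.zero_mem _
  have e5 := Submodule.sub_mem _ e4 e3
  rw [sub_sub_cancel] at e5
  simp only [map_zero, LinearMap.zero_apply, Drs_zero, zero_sub, zero_add, ← insert_eq,
    insert_erase hk, Drs_smul, Drs_inr_inl l i (mono_homog (F := F) (α, u) hu),
    ← neg_smul, smul_smul] at e5
  refine (Submodule.smul_mem_iff _ ?_).1 e5
  exact mul_ne_zero (pow_ne_zero _ (neg_ne_zero.2 one_ne_zero)) (neg_ne_zero.2
    (mul_ne_zero (pow_ne_zero _ (neg_ne_zero.2 one_ne_zero)) (coeff_ne_zero (by simp) (by simp))))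

omit hp in
/-- The weight of `D_{il}(x^(γ+ε_i) x_l)`. -/
lemma SameWeight.exists_const (hn : 2 ≤ n) {d : Var m n → F} (hd : ∀ l, d (Sum.inr l) = 0)
    {k : Var m n} {w : Finset (Fin n)} (h : SameWeight d k w) : ∃ c : F, (c = 0 ∨ c = 1) ∧
      ∀ i, d (Sum.inl i) = c - if k = Sum.inl i then 1 else 0 := by
  obtain ⟨l, hl⟩ : ∃ l : Fin n, k ≠ Sum.inr l := by
    by_cases hk : k = Sum.inr ⟨0, by omega⟩
    · exact ⟨⟨1, by omega⟩, by rw [hk]; simp⟩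
    · exact ⟨_, hk⟩
  refine ⟨if l ∈ w then 1 else 0, by split_ifs <;> simp, fun i => ?_⟩
  have := h i l
  rw [hd, add_zero, if_neg hl, sub_zero] at this
  exact this

omit hp in
-- Modulo the D_{ij}, the element D_{il}(x^(γ + ε_i) x_l) does not depend on i, so i may be replaced
-- by a more convenient direction.
lemma Drs_swap (i j : Fin m) (l : Fin n) (γ : Fin m → ℕ) :
    Drs (Sum.inl j) (Sum.inr l) (mono F (γ + Pi.single j 1, {l})) -
      Drs (Sum.inl i) (Sum.inr l) (mono F (γ + Pi.single i 1, {l})) =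
    Drs (Sum.inl i) (Sum.inl j) (mono F (γ + Pi.single i 1 + Pi.single j 1, ∅)) := by
  have hl : ∀ α : Fin m → ℕ, D (Sum.inr l) (mono F (α, {l})) = mono F (α, ∅) := fun α => by
    rw [D_inr_mono]; simp [filter_singleton]
  have e : γ + Pi.single i 1 + Pi.single j 1 = γ + Pi.single j 1 + Pi.single i 1 := by
    rw [add_right_comm]
  rw [Drs_inl_inr _ _ (mono_homog _ (by simp)), Drs_inl_inr _ _ (mono_homog _ (by simp)),
    Drs_inl_inl _ _ (mono_homog _ (by simp)), D_inl_add, D_inl_add, D_inl_add, hl, hl]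
  rw [e, D_inl_add]
  abel

omit hp in
lemma add_two_lt_of_cast_eq_one (h2 : (2 : F) ≠ 0) (h3 : (3 : F) ≠ 0) {a s : ℕ} (hs : 1 ≤ s)
    (ha : a < p ^ s) (h : (a : F) = 1) : a + 2 < p ^ s := by
  have h0 : ((p ^ s : ℕ) : F) = 0 := by
    rw [CharP.cast_eq_zero_iff F p]; exact dvd_pow_self p (by omega)
  have c1 : a + 1 ≠ p ^ s := fun e => by
    rw [← e] at h0; push_cast at h0; rw [h] at h0; exact h2 (by linear_combination h0)
  have c2 : a + 2 ≠ p ^ s := fun e => by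
    rw [← e] at h0; push_cast at h0; rw [h] at h0; exact h3 (by linear_combination h0)
  omega

omit hp in
-- Supplies the directions for removing the power of x_q while raising x_j twice. Apart from at most
-- one direction, all exponents are 0 or all are 1 in F, and are therefore far enough below the
-- maximum; γ q = 1 happens only when γ j is 1 in F, where a weight argument is available.
lemma exists_raise (hp3 : 3 < p) (hm : 3 ≤ m) (ht : ∀ i, 1 ≤ t i) {γ : Fin m → ℕ}
    (hγt : ∀ i, γ i < p ^ t i) (hγ0 : γ ≠ 0) {c : F} (hc : c = 0 ∨ c = 1) (k : Var m n)
    (hγ : ∀ i, (γ i : F) = c - if k = Sum.inl i then 1 else 0) :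
    ∃ q j, j ≠ q ∧ γ q ≠ 0 ∧ γ j + 2 < p ^ t j ∧ (γ q ≠ 1 ∨ (γ j : F) = 1) := by
  have h1 : (1 : F) ≠ 0 := one_ne_zero
  have h2 := two_ne_zero_of_three_lt (F := F) hp3
  have h3 := three_ne_zero_of_three_lt (F := F) hp3
  obtain ⟨x₀, hx₀⟩ : ∃ x₀ : Fin m, ∀ x, x ≠ x₀ → k ≠ Sum.inl x := by
    rcases k with x₀ | l
    · exact ⟨x₀, fun x hx h => hx (Sum.inl_injective h).symm⟩
    · exact ⟨⟨0, by omega⟩, by simp⟩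
  rcases hc with rfl | rfl
  · have hdvd : ∀ x, x ≠ x₀ → γ x + 2 < p ^ t x := fun x hx => by
      have := hγ x
      rw [if_neg (hx₀ x hx), sub_zero, CharP.cast_eq_zero_iff F p] at this
      have := add_two_lt_of_dvd hp3 (ht x) (hγt x) this
      omega
    by_cases hq : γ x₀ = 0
    · obtain ⟨q, hq0⟩ : ∃ q, γ q ≠ 0 := by
        by_contra hq; push Not at hq; exact hγ0 (funext hq)
      have hqx : q ≠ x₀ := by rintro rfl; exact hq0 hq
      obtain ⟨j, hjq, hjx⟩ := exists_third hm q x₀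
      refine ⟨q, j, hjq, hq0, hdvd j hjx, Or.inl fun e => ?_⟩
      have := hγ q
      rw [if_neg (hx₀ q hqx), e] at this
      exact h1 (by push_cast at this; linear_combination this)
    · obtain ⟨j, hjx, -⟩ := exists_third hm x₀ x₀
      refine ⟨x₀, j, hjx, hq, hdvd j hjx, Or.inl fun e => ?_⟩
      have := hγ x₀
      rw [e] at this
      push_cast at this
      split_ifs at this
      · exact h2 (by linear_combination this)
      · exact h1 (by linear_combination this)
  · obtain ⟨q, hq, -⟩ := exists_third hm x₀ x₀
    obtain ⟨j, hjx, hjq⟩ := exists_third hm x₀ q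
    have e1 := hγ q
    have e2 := hγ j
    rw [if_neg (hx₀ _ ‹_›), sub_zero] at e1 e2
    refine ⟨q, j, hjq, fun e => ?_, add_two_lt_of_cast_eq_one h2 h3 (ht j) (hγt j) e2,
      Or.inr e2⟩
    rw [e] at e1
    exact h1 (by push_cast at e1; exact e1.symm)

/-- Without x_i this is a single field along D_i, unless all other exponents are maximal, and then
the weight decides. With α = γ + ε_i and γ = 0 it is a torus element. For γ ≠ 0 the direction is
switched to a suitable j, and D_{jl}(x^(γ + ε_j) x_l) is a bracket of x_q^(γ q) D_j with a killed
element. -/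
lemma IsNormalDer.Drs_inl_inr_singleton_mem (hψ : IsNormalDer n p t ψ) (hp3 : 3 < p) (hm : 3 ≤ m)
    (hn : 2 ≤ n) (ht : ∀ i, 1 ≤ t i) (h : KillsUpTo n p t ψ N) (i : Fin m) (l : Fin n)
    {α : Fin m → ℕ} (hα : ∀ i, α i < p ^ t i) (hN : ∑ i, α i ≤ N) :
    Drs (Sum.inl i) (Sum.inr l) (mono F (α, {l})) ∈ kerOn n p t ψ := by
  have h1 : (1 : F) ≠ 0 := one_ne_zero
  have h2 := two_ne_zero_of_three_lt (F := F) hp3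
  have h3 := three_ne_zero_of_three_lt (F := F) hp3
  have hpar : ∀ i : Fin m, #({l} : Finset (Fin n)) % 2 =
      (tau (Sum.inl i : Var m n) + tau (Sum.inr l : Var m n)) % 2 := fun i => by simp [tau]
  have hodd : ∀ (i : Fin m) (β : Fin m → ℕ) (x : Fin n), ((deg (Sum.inr x) (β, {l}) : ℕ) : F) -
      (if (Sum.inr x : Var m n) = Sum.inl i then 1 else 0) -
      (if (Sum.inr x : Var m n) = Sum.inr l then 1 else 0) = 0 := fun i β x => by
    simp [deg]
  by_cases hi0 : α i = 0
  · by_cases hj : ∃ j, j ≠ i ∧ α j + 1 < p ^ t j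
    · obtain ⟨j, hji, hj⟩ := hj
      rw [Drs_inl_inr _ _ (mono_homog _ (by simp)), D_inl_of_eq_zero hi0, map_zero, zero_add,
        D_inr_mono, if_pos (by simp), map_smul]
      exact Submodule.smul_mem _ _ (hψ.inl_mem hp3 hm (by omega) ht h hα hi0 hji hj (by simp) hN)
    · push Not at hj
      refine h.Drs_of_weight hψ.toIsWeightDer hα (hpar i) (by simpa [tau] using hN)
        fun k w' _ hs => ?_
      obtain ⟨c, hc, hγ⟩ := hs.exists_const hn (hodd i α)
      obtain ⟨x, hxi, hkx⟩ : ∃ x : Fin m, x ≠ i ∧ k ≠ Sum.inl x := by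
        obtain ⟨x, hx, -⟩ := exists_third hm i i
        obtain ⟨y, hy, hyx⟩ := exists_third hm i x
        by_cases hk : k = Sum.inl x
        · exact ⟨y, hy, by rw [hk]; simpa using hyx.symm⟩
        · exact ⟨x, hx, hk⟩
      have e := hγ x
      have htop : (α x : F) = -1 := cast_top (ht x) (by have := hα x; have := hj x hxi; omega)
      simp only [deg, htop, Sum.inl.injEq, hxi, hkx, reduceCtorEq, if_false] at e
      rcases hc with rfl | rfl
      · exact h1 (by linear_combination -e)
      · exact h2 (by linear_combination -e)
  obtain ⟨γ, rfl⟩ : ∃ γ : Fin m → ℕ, α = γ + Pi.single i 1 := by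
    refine ⟨α - Pi.single i 1, funext fun j => ?_⟩
    by_cases hj : j = i
    · subst hj; simp; omega
    · simp [hj]
  have hγt : ∀ x, γ x < p ^ t x := fun x => lt_of_le_of_lt (by simp) (hα x)
  rw [sum_add_single] at hN
  -- The weight argument settles every case except those in which some field free of even variables
  -- has the weight of this element; that condition restricts γ modulo p.
  by_contra hnot
  have hex : ∃ k w, SameWeight (fun r => ((deg r (γ + Pi.single i 1, {l}) : ℕ) : F) -
      (if r = Sum.inl i then 1 else 0) - (if r = Sum.inr l then 1 else 0)) k w := by
    by_contra hno
    push Not at hno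
    refine hnot (h.Drs_of_weight hψ.toIsWeightDer hα (hpar i) ?_ fun k w' _ => hno k w')
    dsimp only
    rw [sum_add_single]
    simp only [tau]; omega
  obtain ⟨k, w, hs⟩ := hex
  obtain ⟨c, hc, hγ⟩ := hs.exists_const hn (hodd i _)
  have hγ' : ∀ x, (γ x : F) = c - if k = Sum.inl x then 1 else 0 := fun x => by
    rw [← hγ x]
    by_cases hx : x = i
    · subst hx; simp [deg]
    · simp [deg, hx]
  have hγ0 : γ ≠ 0 := by
    rintro rfl
    apply hnot
    rw [zero_add, ← tor_eq_Drs]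
    exact hψ.tor_mem i l
  obtain ⟨q, j, hjq, hq0, hj, hor⟩ := exists_raise hp3 hm ht hγt hγ0 hc k hγ'
  apply hnot
  obtain ⟨β, hβ, hβq, hβe, hsum⟩ := exists_split γ q
  have hβt := split_trunc hγt hβq hβe
  have hβj := hβe j hjq
  have hlt : ∀ x, (β + Pi.single j 1 + Pi.single j 1 : Fin m → ℕ) x < p ^ t x :=
    lt_add_single (lt_add_single hβt (by omega)) (by simp; omega)
  have e1 : vf (Sum.inl j) (mono F (Pi.single q (γ q), ∅)) ∈ kerOn n p t ψ :=
    hψ.single_mem hp3 hm (by omega) ht h hjq.symm (hγt q) (by omega) rfl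
  have e2 : Drs (Sum.inl j) (Sum.inr l) (mono F (β + Pi.single j 1 + Pi.single j 1, {l})) ∈
      kerOn n p t ψ := by
    -- For γ q = 1 the level may be N + 1, but the weight at j is γ j + 1 = 2 in F, which is
    -- impossible. For γ q ≥ 2 the level is at most N.
    by_cases hq1 : γ q = 1
    · refine h.Drs_of_weight hψ.toIsWeightDer hlt (hpar j) ?_ fun k w' _ hs => ?_
      · dsimp only
        rw [sum_add_single, sum_add_single]
        simp only [tau]; omega
      · obtain ⟨c, hc, hγ⟩ := hs.exists_const hn (hodd j _)
        have e := hγ j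
        have hj1 := hor.resolve_left (by simpa using hq1)
        simp only [deg, Pi.add_apply, Pi.single_eq_same, hβj, if_true, reduceCtorEq,
          if_false] at e
        push_cast at e
        rw [hj1] at e
        split_ifs at e <;> rcases hc with rfl | rfl
        · exact h3 (by linear_combination e)
        · exact h2 (by linear_combination e)
        · exact h2 (by linear_combination e)
        · exact h1 (by linear_combination e)
    · refine h _ _ _ hlt (hpar j) ?_
      dsimp only
      rw [sum_add_single, sum_add_single]
      simp only [tau]; omega
  have e3 := hψ.lie_mem_kerOn e1 e2
  rw [lie_single_Drs hjq.symm (by simpa using hjq) (by simp) (hpar j),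
    Submodule.smul_mem_iff, ← add_assoc, hβ] at e3
  · by_cases hij : i = j
    · rwa [hij]
    · have e4 := Drs_swap (F := F) i j l γ
      have e5 : Drs (Sum.inl i) (Sum.inl j) (mono F (γ + Pi.single i 1 + Pi.single j 1, ∅)) ∈
          kerOn n p t ψ := by
        refine hψ.Drs_inl_inl_mem hp3 hm hn ht h i j (lt_add_single hα ?_) rfl ?_
        · simp [Ne.symm hij]; omega
        · rw [sum_add_single, sum_add_single]; omega
      rw [← e4] at e5
      have := Submodule.sub_mem _ e3 e5
      rwa [sub_sub_cancel] at this
  · refine coeff_ne_zero (by simp) fun x => ?_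
    by_cases hx : x = q
    · right; subst hx; simp [hβq, hjq.symm]
    · left; simp [hx]

lemma IsNormalDer.killsUpTo_succ (hψ : IsNormalDer n p t ψ) (hp3 : 3 < p) (hm : 3 ≤ m)
    (hn : 2 ≤ n) (ht : ∀ i, 1 ≤ t i) (h : KillsUpTo n p t ψ N) : KillsUpTo n p t ψ (N + 1) := by
  rintro (i | k) (j | l) ⟨α, w⟩ hα hw hN
  · exact hψ.Drs_inl_inl_mem hp3 hm hn ht h i j hα hw (by simpa [tau] using hN)
  · simp only [tau] at hN hw
    by_cases hk : ∃ k ∈ w, k ≠ l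
    · obtain ⟨k, hk, hkl⟩ := hk
      exact hψ.Drs_inl_inr_mem_of_mem hp3 hm hn ht h i hkl hα hk hw (Nat.le_of_succ_le_succ hN)
    · push Not at hk
      have hw1 : w = {l} := by
        obtain ⟨x, hx⟩ : w.Nonempty := by rw [← card_pos]; omega
        refine eq_singleton_iff_unique_mem.2 ⟨hk x hx ▸ hx, hk⟩
      subst hw1
      exact hψ.Drs_inl_inr_singleton_mem hp3 hm hn ht h i l hα (Nat.le_of_succ_le_succ hN)
  · simp only [tau] at hN hw
    rw [Drs_inr_inl _ _ (mono_homog _ hw)]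
    by_cases hl : ∃ l ∈ w, l ≠ k
    · obtain ⟨l, hl, hkl⟩ := hl
      exact hψ.Drs_inl_inr_mem_of_mem hp3 hm hn ht h j hkl hα hl hw (Nat.le_of_succ_le_succ hN)
    · push Not at hl
      have hw1 : w = {k} := by
        obtain ⟨x, hx⟩ : w.Nonempty := by rw [← card_pos]; omega
        refine eq_singleton_iff_unique_mem.2 ⟨hl x hx ▸ hx, hl⟩
      subst hw1
      exact hψ.Drs_inl_inr_singleton_mem hp3 hm hn ht h j k hα (Nat.le_of_succ_le_succ hN)
  · simp only [tau] at hN hw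
    exact hψ.Drs_inr_inr_mem hp3 hm ht h k l hα hw (by dsimp only at hN ⊢; omega)

/-- Level zero leaves only D_{ij} of monomials in the odd variables, which vanish. -/
lemma IsNormalDer.killsUpTo_zero : KillsUpTo n p t ψ 0 := by
  rintro (i | k) (j | l) ⟨α, w⟩ hα hw hN
  · have : α = 0 := by
      funext x
      simp only [tau] at hN
      have : ∑ i, α i = 0 := Nat.le_zero.1 hN
      exact (sum_eq_zero_iff.1 this) x (mem_univ x)
    rw [Drs_inl_inl _ _ (mono_homog _ hw), this, D_inl_of_eq_zero rfl, D_inl_of_eq_zero rfl]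
    simp
  all_goals simp [tau] at hN

/-- A normalised derivation vanishes. -/
theorem IsNormalDer.eq_zero (hψ : IsNormalDer n p t ψ) (hp3 : 3 < p) (hm : 3 ≤ m)
    (hn : 2 ≤ n) (ht : ∀ i, 1 ≤ t i) {y : Module.End F (Alg F m n)}
    (hy : y ∈ evenSpecial F n p t) : ψ y = 0 := by
  have h : ∀ N, KillsUpTo n p t ψ N := fun N => by
    induction N with
    | zero => exact IsNormalDer.killsUpTo_zero
    | succ N ih => exact hψ.killsUpTo_succ hp3 hm hn ht ih
  exact (mem_kerOn.1 (evenSpecial_induction (fun u v a ha hw => h _ u v a ha hw le_rfl) hy)).2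

end MixedFields

/-- Left and right multiplication by x commute, so their difference obeys (a - b)^(p^s) = a^(p^s) -
b^(p^s). -/
lemma ad_pow_prime_pow {F B : Type*} [Field F] [Ring B] [Algebra F B] {p : ℕ} [Fact p.Prime]
    [CharP F p] (x y : B) (s : ℕ) : (LieAlgebra.ad F B x ^ p ^ s) y = ⁅x ^ p ^ s, y⁆ := by
  rcases subsingleton_or_nontrivial B with h | h
  · exact Subsingleton.elim _ _
  have : CharP (Module.End F B) p :=
    charP_of_injective_algebraMap (algebraMap F (Module.End F B)).injective p
  rw [LieAlgebra.ad_eq_lmul_left_sub_lmul_right, Pi.sub_apply,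
    sub_pow_char_pow_of_commute _ _ (LinearMap.commute_mulLeft_right x x),
    LinearMap.pow_mulLeft, LinearMap.pow_mulRight]
  rfl

/-! ### Powers of ad D_i and the centraliser of the even part of S -/

section Centralizer

variable {F : Type*} [Field F] {m n p : ℕ} {t : Fin m → ℕ}

variable (F n) in
/-- Bracketing with a partial derivation in an even variable. -/
def adD (i : Fin m) : Module.End F (Module.End F (Alg F m n)) :=
  LieAlgebra.ad F _ (D (Sum.inl i))

lemma adD_apply (i : Fin m) (T : Module.End F (Alg F m n)) :
    adD F n i T = ⁅D (F := F) (m := m) (n := n) (Sum.inl i), T⁆ := rfl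

lemma sameWeight_zero (hm : 3 ≤ m) (hn : 0 < n) {k : Var m n} {w : Finset (Fin n)}
    (h : SameWeight (0 : Var m n → F) k w) : ∃ l, k = Sum.inr l ∧ w = {l} := by
  rcases k with i | l
  · obtain ⟨j, hj, -⟩ := exists_third hm i i
    have h1 := h i ⟨0, hn⟩
    have h2 := h j ⟨0, hn⟩
    simp only [Pi.zero_apply, reduceCtorEq, if_false, if_true, Sum.inl.injEq, hj.symm] at h1 h2
    exact absurd (show (1 : F) = 0 by linear_combination h1 - h2) one_ne_zero
  · refine ⟨l, rfl, ?_⟩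
    ext l'
    have h1 := h ⟨0, by omega⟩ l'
    simp only [Pi.zero_apply, reduceCtorEq, if_false, Sum.inr.injEq] at h1
    rw [mem_singleton]
    by_cases hl : l = l'
    · subst hl
      by_cases hw : l ∈ w
      · simp [hw]
      · simp [hw] at h1
    · by_cases hw : l' ∈ w
      · simp [hw, hl] at h1
      · simp [hw, Ne.symm hl]

variable [hp : Fact p.Prime] [CharP F p]

lemma adD_mem {T : Module.End F (Alg F m n)} (hT : T ∈ evenFields F n p t) (i : Fin m) :
    adD F n i T ∈ evenFields F n p t := by
  rw [adD_apply, D_inl_eq_vf]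
  exact evenFields_lie (vf_mono_mem (fun i => pow_pos hp.out.pos _) rfl) hT

lemma adD_pow_mem {T : Module.End F (Alg F m n)} (hT : T ∈ evenFields F n p t) (i : Fin m)
    (r : ℕ) : (adD F n i ^ r) T ∈ evenFields F n p t := by
  induction r with
  | zero => exact hT
  | succ r ih => rw [pow_succ']; exact adD_mem ih i

lemma cf_adD_pow {T : Module.End F (Alg F m n)} (hT : T ∈ evenFields F n p t) (i : Fin m)
    (r : ℕ) (k : Var m n) (a : Expo m n) :
    cf k a ((adD F n i ^ r) T) = cf k (a.1 + Pi.single i r, a.2) T := by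
  induction r generalizing a with
  | zero => simp
  | succ r ih =>
    rw [pow_succ', Module.End.mul_apply, adD_apply, cf_lie_D (adD_pow_mem hT i r), ih]
    dsimp only
    rw [add_assoc, ← Pi.single_add, add_comm 1 r]

variable (F n) in
/-- Bracketing with the derivation `D_i ^ (p ^ s)`. -/
def adFrob (p : ℕ) (i : Fin m) (s : ℕ) : Module.End F (Module.End F (Alg F m n)) :=
  LieAlgebra.ad F _ (D (Sum.inl i) ^ p ^ s)

omit hp [CharP F p] in
lemma adFrob_apply (i : Fin m) (s : ℕ) (T : Module.End F (Alg F m n)) :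
    adFrob F n p i s T = ⁅D (F := F) (m := m) (n := n) (Sum.inl i) ^ p ^ s, T⁆ := rfl

lemma adFrob_eq (i : Fin m) (s : ℕ) : adFrob F n p i s = adD F n i ^ p ^ s :=
  LinearMap.ext fun T => (ad_pow_prime_pow _ T s).symm

lemma adFrob_mem {T : Module.End F (Alg F m n)} (hT : T ∈ evenFields F n p t) (i : Fin m)
    (s : ℕ) : adFrob F n p i s T ∈ evenFields F n p t := by
  rw [adFrob_eq]; exact adD_pow_mem hT i _

lemma cf_adFrob {T : Module.End F (Alg F m n)} (hT : T ∈ evenFields F n p t) (i : Fin m)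
    (s : ℕ) (k : Var m n) (a : Expo m n) :
    cf k a (adFrob F n p i s T) = cf k (a.1 + Pi.single i (p ^ s), a.2) T := by
  rw [adFrob_eq]; exact cf_adD_pow hT i _ k a

/-- The shift by p^(t i) leaves the range of truncated exponents, which is why only the powers with
s < t_i give new derivations. -/
lemma adFrob_top {T : Module.End F (Alg F m n)} (hT : T ∈ evenFields F n p t) (i : Fin m) :
    adFrob F n p i (t i) T = 0 := by
  refine evenFields_ext (adFrob_mem hT i _) (Submodule.zero_mem _) fun k a => ?_
  rw [cf_adFrob hT, map_zero]
  by_contra h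
  have := (mem_fieldIdx.1 (cf_mem hT h)).1 i
  simp at this

lemma adFrob_vf {k : Var m n} {a : Expo m n} (h1 : ∀ i, a.1 i < p ^ t i)
    (h2 : #a.2 % 2 = tau k % 2) {i : Fin m} {s : ℕ} (ha : a.1 i < p ^ s) :
    adFrob F n p i s (vf k (mono F a)) = 0 := by
  have hT := vf_mono_mem (F := F) h1 h2
  refine evenFields_ext (adFrob_mem hT i _) (Submodule.zero_mem _) fun l b => ?_
  rw [cf_adFrob hT, map_zero, cf_vf, co_mono, if_neg (c := a = _), ite_self]
  rintro rfl
  simp at ha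

lemma adFrob_mem_special (hm : 3 ≤ m) (ht : ∀ i, 1 ≤ t i) {T : Module.End F (Alg F m n)}
    (hT : T ∈ evenSpecial F n p t) (i : Fin m) (s : ℕ) :
    adFrob F n p i s T ∈ evenSpecial F n p t := by
  rw [adFrob_eq]
  generalize p ^ s = r
  induction r with
  | zero => exact hT
  | succ r ih => rw [pow_succ']; exact (evenSpecial F n p t).lie_mem (Dinl_mem hm ht i) ih

/-- The diagonal field `∑ s_l x_l D_l` in the odd variables. -/
def oddDiag (s : Fin n → F) : Module.End F (Alg F m n) := ∑ l, s l • eul F (Sum.inr l)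

omit [CharP F p] in
lemma eul_mem (ht : ∀ i, 1 ≤ t i) (r : Var m n) : eul F r ∈ evenFields F n p t := by
  rw [eul_eq_vf]
  rcases r with i | l
  · refine vf_mono_mem (fun j => single_lt ?_) rfl
    exact one_lt_pow₀ hp.out.one_lt (by have := ht i; omega)
  · exact vf_mono_mem (fun i => pow_pos hp.out.pos _) (by simp [varExpo, tau])

omit [CharP F p] in
lemma oddDiag_mem (ht : ∀ i, 1 ≤ t i) (s : Fin n → F) :
    oddDiag (m := m) s ∈ evenFields F n p t :=
  sum_mem fun _ _ => Submodule.smul_mem _ _ (eul_mem ht _)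

omit hp [CharP F p] in
lemma lie_oddDiag_inr (s : Fin n → F) (k l : Fin n) :
    ⁅oddDiag (m := m) s, vf (m := m) (Sum.inr l) (mono F (0, {k}))⁆ =
      (s k - s l) • vf (Sum.inr l) (mono F (0, {k})) := by
  have h : ∀ r, ⁅s r • eul F (Sum.inr r : Var m n), vf (m := m) (Sum.inr l) (mono F (0, {k}))⁆ =
      ((if r = k then s r else 0) - if r = l then s r else 0) •
        vf (Sum.inr l) (mono F (0, {k})) := by
    intro r
    rw [smul_lie, lie_eul_vf_mono _ _ (by simp [tau]), smul_smul]
    congr 1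
    simp only [deg, mem_singleton, Sum.inr.injEq]
    split_ifs <;> simp
  rw [oddDiag, sum_lie, sum_congr rfl fun r _ => h r, ← sum_smul, sum_sub_distrib]
  simp

omit hp [CharP F p] in
lemma lie_oddDiag_inl (s : Fin n → F) (i : Fin m) {a b : Fin n} (hab : a ≠ b) :
    ⁅oddDiag (m := m) s, vf (Sum.inl i) (mono F (0, {a, b}))⁆ =
      (s a + s b) • vf (Sum.inl i) (mono F (0, {a, b})) := by
  have h : ∀ r, ⁅s r • eul F (Sum.inr r : Var m n), vf (m := m) (Sum.inl i) (mono F (0, {a, b}))⁆ =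
      ((if r = a then s r else 0) + if r = b then s r else 0) •
        vf (Sum.inl i) (mono F (0, {a, b})) := by
    intro r
    rw [smul_lie, lie_eul_vf_mono _ _ (by simp [tau, card_pair hab]), smul_smul]
    congr 1
    simp only [deg, mem_insert, mem_singleton, reduceCtorEq, if_false]
    by_cases h1 : r = a
    · subst h1; simp [hab]
    · simp [h1]
  rw [oddDiag, sum_lie, sum_congr rfl fun r _ => h r, ← sum_smul, sum_add_distrib]
  simp

omit [CharP F p] in
lemma eq_oddDiag_of_cf (ht : ∀ i, 1 ≤ t i) {T : Module.End F (Alg F m n)}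
    (hT : T ∈ evenFields F n p t)
    (h : ∀ k a, cf k a T ≠ 0 → ∃ l, k = Sum.inr l ∧ a = (0, {l})) :
    T = oddDiag fun l => cf (Sum.inr l) (0, {l}) T := by
  refine evenFields_ext hT (oddDiag_mem ht _) fun k a => ?_
  have h1 : ∀ l, cf k a (eul F (Sum.inr l)) =
      if k = Sum.inr l ∧ a = ((0 : Fin m → ℕ), {l}) then (1 : F) else 0 := by
    intro l
    rw [eul_eq_vf, cf_vf, co_mono, ← ite_and]
    simp only [varExpo, eq_comm]
  simp only [oddDiag, map_sum, map_smul, h1, smul_eq_mul]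
  by_cases h0 : cf k a T = 0
  · rw [h0, eq_comm]
    refine sum_eq_zero fun l _ => ?_
    split_ifs with hl
    · rw [← hl.1, ← hl.2, h0, zero_mul]
    · simp
  · obtain ⟨l, rfl, rfl⟩ := h k a h0
    rw [sum_eq_single l]
    · simp
    · intro l' _ hl'; simp [hl'.symm]
    · simp

omit [CharP F p] in
-- Commuting with the D_i removes the even variables from the coefficients; among the remaining
-- monomial fields only the x_l D_l have weight zero.
lemma eq_oddDiag (hm : 3 ≤ m) (hn : 0 < n) (ht : ∀ i, 1 ≤ t i) {T : Module.End F (Alg F m n)}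
    (hT : T ∈ evenFields F n p t)
    (hD : ∀ i, ⁅D (F := F) (m := m) (n := n) (Sum.inl i), T⁆ = 0)
    (htor : ∀ (i : Fin m) l, ⁅tor F n i l, T⁆ = 0) :
    T = oddDiag fun l => cf (Sum.inr l) (0, {l}) T := by
  refine eq_oddDiag_of_cf ht hT fun k a h => ?_
  have ha : a.1 = 0 := by
    funext i
    by_contra hi
    refine h ?_
    have h2 := cf_lie_D hT i k (a.1 - Pi.single i 1, a.2)
    rw [hD, map_zero] at h2
    rw [show a = ((a.1 - Pi.single i 1 : Fin m → ℕ) + Pi.single i 1, a.2) from ?_, ← h2]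
    refine Prod.ext (funext fun j => ?_) rfl
    by_cases hj : j = i
    · subst hj; simp at hi ⊢; omega
    · simp [hj]
  obtain ⟨l, rfl, hl⟩ := sameWeight_zero (F := F) (k := k) (w := a.2) hm hn fun i l => by
    have h2 := congrArg (cf k a) (htor i l)
    rw [tor, add_lie, map_add, cf_lie_eul, cf_lie_eul, ← add_mul, map_zero, mul_eq_zero,
      or_iff_left h] at h2
    simp only [deg, ha, eq_comm (b := k), Pi.zero_apply, Nat.cast_zero] at h2 ⊢
    rw [add_zero]
    refine h2.symm.trans ?_
    split_ifs <;> push_cast <;> ring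
  exact ⟨l, rfl, Prod.ext ha hl⟩

lemma rot_mem_special (hp3 : 3 < p) {k l : Fin n} (hkl : k ≠ l) :
    vf (m := m) (Sum.inr l) (mono F (0, {k})) ∈ evenSpecial F n p t :=
  vf_inr_mem (two_ne_zero_of_three_lt hp3) (fun _ => pow_pos hp.out.pos _)
    (by simpa using hkl.symm) (by simp)

lemma pair_mem_special (hm : 3 ≤ m) (ht : ∀ i, 1 ≤ t i) (i : Fin m) {a b : Fin n} (hab : a ≠ b) :
    vf (m := m) (Sum.inl i) (mono F (0, {a, b})) ∈ evenSpecial F n p t := by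
  obtain ⟨j, hj, -⟩ := exists_third hm i i
  refine vf_inl_mem hj (fun _ => pow_pos hp.out.pos _) rfl ?_ (by rw [card_pair hab])
  simpa using one_lt_pow₀ hp.out.one_lt (by have := ht j; omega)

omit hp [CharP F p] in
lemma vf_mono_ne_zero (k : Var m n) (a : Expo m n) : vf k (mono F a) ≠ 0 := by
  intro h
  simpa [cf_vf, co_mono] using congrArg (cf k a) h

omit hp [CharP F p] in
lemma oddDiag_eq_zero (h2 : (2 : F) ≠ 0) (hn : 2 ≤ n) {s : Fin n → F}
    (hrot : ∀ k l, k ≠ l → s k = s l)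
    (hpair : ∀ a b, a ≠ b → s a + s b = 0) : oddDiag (m := m) s = 0 := by
  refine sum_eq_zero fun k _ => ?_
  obtain ⟨l, hl⟩ : ∃ l : Fin n, l ≠ k := Fintype.exists_ne_of_one_lt_card (by simp; omega) k
  have h1 := hrot l k hl
  have h3 := hpair l k hl
  rw [h1, ← two_mul, mul_eq_zero, or_iff_right h2] at h3
  rw [h3, zero_smul]

omit [CharP F p] in
-- The D_i and the torus leave Σ s_l x_l D_l; the rotations make all s_l equal and the pairs give 2
-- s_l = 0. Only elements killed by the p-powers of the D_i are tested, which is what separates the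
-- two kinds of derivations later.
lemma eq_zero_of_lie_eq_zero (h2 : (2 : F) ≠ 0) (hm : 3 ≤ m) (hn : 2 ≤ n) (ht : ∀ i, 1 ≤ t i)
    {T : Module.End F (Alg F m n)} (hT : T ∈ evenFields F n p t)
    (hD : ∀ i, ⁅T, D (F := F) (m := m) (n := n) (Sum.inl i)⁆ = 0)
    (htor : ∀ (i : Fin m) l, ⁅T, tor F n i l⁆ = 0)
    (hrot : ∀ k l, k ≠ l → ⁅T, vf (m := m) (n := n) (Sum.inr l) (mono F (0, {k}))⁆ = 0)
    (hpair : ∀ (i : Fin m) a b, a ≠ b → ⁅T, vf (n := n) (Sum.inl i) (mono F (0, {a, b}))⁆ = 0) :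
    T = 0 := by
  have h1 := eq_oddDiag hm (by omega) ht hT (fun i => by rw [← lie_skew, hD, neg_zero])
    fun i l => by rw [← lie_skew, htor, neg_zero]
  rw [h1]
  refine oddDiag_eq_zero h2 hn (fun k l hkl => ?_) fun a b hab => ?_
  · have := hrot k l hkl
    rw [h1, lie_oddDiag_inr, smul_eq_zero, or_iff_left (vf_mono_ne_zero _ _)] at this
    exact sub_eq_zero.1 this
  · have := hpair ⟨0, by omega⟩ a b hab
    rw [h1, lie_oddDiag_inl _ _ hab, smul_eq_zero, or_iff_left (vf_mono_ne_zero _ _)] at this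
    exact this

/-- The even part of `S` has trivial centraliser in the even fields. -/
lemma centralizer_eq_zero (hp3 : 3 < p) (hm : 3 ≤ m) (hn : 2 ≤ n) (ht : ∀ i, 1 ≤ t i)
    {T : Module.End F (Alg F m n)} (hT : T ∈ evenFields F n p t)
    (h : ∀ y ∈ evenSpecial F n p t, ⁅T, y⁆ = 0) : T = 0 :=
  eq_zero_of_lie_eq_zero (two_ne_zero_of_three_lt hp3) hm hn ht hT
    (fun i => h _ (Dinl_mem hm ht i)) (fun i l => h _ (ModularCartan.tor_mem ht i l))
    (fun _ _ hkl => h _ (rot_mem_special hp3 hkl))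
    fun i _ _ hab => h _ (pair_mem_special hm ht i hab)

end Centralizer

/-! ### Normalising a derivation on the D_i and on the torus -/

section TorusReduction

variable {F : Type*} [Field F] {m n p : ℕ} [hp : Fact p.Prime] [CharP F p] {t : Fin m → ℕ}
  {ψ : Module.End F (Module.End F (Alg F m n))}

lemma IsFieldDer.sub (hψ : IsFieldDer n p t ψ) {χ : Module.End F (Module.End F (Alg F m n))}
    (hχ : IsFieldDer n p t χ) : IsFieldDer n p t (ψ - χ) where
  map_mem x hx := sub_mem (hψ.map_mem x hx) (hχ.map_mem x hx)
  leib x hx y hy := by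
    simp only [LinearMap.sub_apply, hψ.leib x hx y hy, hχ.leib x hx y hy, sub_lie, lie_sub]
    abel

variable (n p t) in
lemma isFieldDer_ad {T : Module.End F (Alg F m n)}
    (hT : ∀ x ∈ evenSpecial F n p t, ⁅T, x⁆ ∈ evenFields F n p t) :
    IsFieldDer n p t (LieAlgebra.ad F _ T) where
  map_mem := hT
  leib x _ y _ := by
    rw [LieAlgebra.ad_apply, LieAlgebra.ad_apply, LieAlgebra.ad_apply]
    exact leibniz_lie T x y

variable (n p t) in
lemma isFieldDer_ad_of_mem {T : Module.End F (Alg F m n)} (hT : T ∈ evenFields F n p t) :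
    IsFieldDer n p t (LieAlgebra.ad F _ T) :=
  isFieldDer_ad n p t fun _ hx => evenFields_lie hT (evenSpecial_le_evenFields hx)

lemma lie_D_D (i j : Fin m) : ⁅D (F := F) (m := m) (n := n) (Sum.inl i),
    D (F := F) (m := m) (n := n) (Sum.inl j)⁆ = 0 := by
  rw [D_inl_eq_vf j, lie_D_vf i _ (one_homog j), D_one, map_zero]

/-- On S, [ad D_i, ψ] = -ad(ψ D_i), and each further bracket with ad D_i applies ad D_i to ψ D_i. -/
lemma ad_adD_pow (hm : 3 ≤ m) (ht : ∀ i, 1 ≤ t i) (hψ : IsFieldDer n p t ψ) (i : Fin m) (r : ℕ)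
    {y : Module.End F (Alg F m n)} (hy : y ∈ evenSpecial F n p t) :
    (LieAlgebra.ad F _ (adD F n i) ^ (r + 1)) ψ y =
      -⁅(adD F n i ^ r) (ψ (D (Sum.inl i))), y⁆ := by
  induction r generalizing y with
  | zero =>
    rw [zero_add, pow_one, pow_zero, Module.End.one_apply, LieAlgebra.ad_apply,
      LieRing.of_associative_ring_bracket, LinearMap.sub_apply, Module.End.mul_apply,
      Module.End.mul_apply, adD_apply, adD_apply, hψ.leib _ (Dinl_mem hm ht i) y hy]
    abel
  | succ r ih =>
    have hDy : adD F n i y ∈ evenSpecial F n p t :=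
      (evenSpecial F n p t).lie_mem (Dinl_mem hm ht i) hy
    rw [pow_succ', Module.End.mul_apply, LieAlgebra.ad_apply, LieRing.of_associative_ring_bracket,
      LinearMap.sub_apply, Module.End.mul_apply, Module.End.mul_apply, ih hy, ih hDy, pow_succ',
      Module.End.mul_apply]
    generalize (adD F n i ^ r) (ψ (D (Sum.inl i))) = u
    rw [map_neg, adD_apply, adD_apply, adD_apply, leibniz_lie]
    abel

/-- The obstruction to integrating ψ(D_i) in truncated coefficients. Bracketing ψ with ad D_i, p^(t
i) times, is bracketing with (ad D_i)^(p^(t i)), which is zero on even fields. So (ad D_i)^(p^(t i)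
- 1) (ψ D_i) centralises the even part of S and vanishes. -/
lemma IsFieldDer.cf_top (hψ : IsFieldDer n p t ψ) (hp3 : 3 < p) (hm : 3 ≤ m) (hn : 2 ≤ n)
    (ht : ∀ i, 1 ≤ t i) {i : Fin m} (k : Var m n) {a : Expo m n} (ha : a.1 i + 1 = p ^ t i) :
    cf k a (ψ (D (Sum.inl i))) = 0 := by
  have hD := hψ.map_mem _ (Dinl_mem hm ht i)
  have h1 : (adD F n i ^ (p ^ t i - 1)) (ψ (D (Sum.inl i))) = 0 := by
    refine centralizer_eq_zero hp3 hm hn ht (adD_pow_mem hD _ _) fun y hy => ?_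
    rw [← neg_eq_zero, ← ad_adD_pow hm ht hψ i _ hy, Nat.sub_add_cancel (by omega),
      ad_pow_prime_pow, LieRing.of_associative_ring_bracket, LinearMap.sub_apply,
      Module.End.mul_apply, Module.End.mul_apply, ← adFrob_eq,
      adFrob_top (hψ.map_mem y hy), adFrob_top (evenSpecial_le_evenFields hy), map_zero, sub_zero]
  have h2 := cf_adD_pow hD i (p ^ t i - 1) k (a.1 - Pi.single i (p ^ t i - 1), a.2)
  rw [h1, map_zero] at h2
  rw [h2]
  congr 1
  refine congrArg (fun b => cf k b) (Prod.ext (funext fun j => ?_) rfl)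
  by_cases hj : j = i
  · subst hj; simp; omega
  · simp [hj]

/-- Closedness of the family ψ(D_i), from [D_i, D_j] = 0. -/
lemma IsFieldDer.cf_D_comm (hψ : IsFieldDer n p t ψ) (hm : 3 ≤ m)
    (ht : ∀ i, 1 ≤ t i) (i j : Fin m) (k : Var m n) (α : Fin m → ℕ) (w : Finset (Fin n)) :
    cf k (α + Pi.single i 1, w) (ψ (D (Sum.inl j))) =
      cf k (α + Pi.single j 1, w) (ψ (D (Sum.inl i))) := by
  have h := hψ.leib _ (Dinl_mem hm ht i) _ (Dinl_mem hm ht j)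
  rw [lie_D_D, map_zero, ← lie_skew, eq_comm, neg_add_eq_zero] at h
  have h1 := congrArg (cf k (α, w)) h
  rw [cf_lie_D (hψ.map_mem _ (Dinl_mem hm ht i)), cf_lie_D (hψ.map_mem _ (Dinl_mem hm ht j))] at h1
  exact h1.symm

lemma sub_add_single {α : Fin m → ℕ} {i : Fin m} (h : α i ≠ 0) :
    α - Pi.single i 1 + Pi.single i 1 = α := by
  funext j
  by_cases hj : j = i
  · subst hj; simp; omega
  · simp [hj]

/-- The Poincaré lemma: modulo inner derivations, a derivation kills the `D_i`. -/
lemma IsFieldDer.exists_lie_D (hψ : IsFieldDer n p t ψ) (hp3 : 3 < p) (hm : 3 ≤ m) (hn : 2 ≤ n)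
    (ht : ∀ i, 1 ≤ t i) : ∃ E ∈ evenFields F n p t, ∀ i,
      (ψ - LieAlgebra.ad F _ E) (D (Sum.inl i)) = 0 := by
  classical
  -- The formal primitive: a coefficient is read from ψ(D_i) for any x_i occurring in the monomial,
  -- independently of the choice by closedness; the constant of integration is 0.
  let c : Var m n → Expo m n → F := fun k a =>
    if h : ∃ i, a.1 i ≠ 0 then
      cf k (a.1 - Pi.single h.choose 1, a.2) (ψ (D (Sum.inl h.choose))) else 0
  have hc : ∀ (i : Fin m) (k : Var m n) (a : Expo m n),
      c k (a.1 + Pi.single i 1, a.2) = cf k a (ψ (D (Sum.inl i))) := by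
    intro i k a
    have h : ∃ j, (a.1 + Pi.single i 1 : Fin m → ℕ) j ≠ 0 := ⟨i, by simp⟩
    simp only [c, dif_pos h]
    have hj := h.choose_spec
    generalize h.choose = j at hj
    by_cases hij : j = i
    · subst hij; simp
    · have ha : a.1 j ≠ 0 := by simpa [hij] using hj
      obtain ⟨b, hb⟩ : ∃ b : Fin m → ℕ, a.1 = b + Pi.single j 1 := ⟨_, (sub_add_single ha).symm⟩
      have h1 := hψ.cf_D_comm hm ht i j k b a.2
      rw [← hb] at h1
      rw [← Prod.mk.eta (p := a), ← h1, hb, add_right_comm, add_tsub_cancel_right]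
  have hE := ofCf_mem (F := F) (n := n) (p := p) (t := t) c
  refine ⟨-ofCf p t c, neg_mem hE, fun i => ?_⟩
  have hw := hψ.map_mem _ (Dinl_mem hm ht i)
  rw [LinearMap.sub_apply, LieAlgebra.ad_apply, sub_eq_zero, neg_lie, lie_skew]
  refine evenFields_ext hw (adD_mem hE i) fun k a => ?_
  rw [cf_lie_D hE, cf_ofCf, hc]
  split_ifs with hidx
  · rfl
  -- A primitive could leave the truncated range only through a top coefficient of ψ(D_i), and those
  -- vanish.
  · by_contra h
    obtain ⟨h1, h2⟩ := mem_fieldIdx.1 (cf_mem hw h)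
    refine hidx (mem_fieldIdx.2 ⟨lt_add_single h1 ?_, h2⟩)
    refine lt_of_le_of_ne (h1 i) fun h3 => h (hψ.cf_top hp3 hm hn ht k h3)

/-- The weight of a monomial field under a torus element. -/
def torWt (F : Type*) [Field F] (i : Fin m) (l : Fin n) (k : Var m n) (a : Expo m n) : F :=
  ((deg (Sum.inl i) a : F) - if Sum.inl i = k then 1 else 0) +
    ((deg (Sum.inr l) a : F) - if Sum.inr l = k then 1 else 0)

omit hp [CharP F p] in
lemma cf_lie_tor (T : Module.End F (Alg F m n)) (i : Fin m) (l : Fin n) (k : Var m n)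
    (a : Expo m n) : cf k a ⁅tor F n i l, T⁆ = torWt F i l k a * cf k a T := by
  rw [tor, add_lie, map_add, cf_lie_eul, cf_lie_eul, torWt, add_mul]

lemma lie_tor_vf (i : Fin m) (l : Fin n) (k : Var m n) {a : Expo m n}
    (ha : #a.2 % 2 = tau k % 2) : ⁅tor F n i l, vf k (mono F a)⁆ =
      torWt F i l k a • vf k (mono F a) := by
  rw [tor, add_lie, lie_eul_vf_mono _ _ ha, lie_eul_vf_mono _ _ ha, torWt, add_smul]

lemma lie_eul_eul (r s : Var m n) : ⁅eul F r, eul F s⁆ = 0 := by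
  rw [eul_eq_vf s, lie_eul_vf_mono]
  · have : (deg r (varExpo s) : F) = if r = s then 1 else 0 := by
      rcases r with i | k <;> rcases s with j | l <;>
        simp [deg, varExpo, Pi.single_apply]
    rw [this, sub_self, zero_smul]
  · rcases s with j | l <;> simp [varExpo, tau]

lemma lie_tor_tor (i j : Fin m) (k l : Fin n) : ⁅tor F n i k, tor F n j l⁆ = 0 := by
  simp [tor, lie_eul_eul]

lemma lie_tor_D (i j : Fin m) (l : Fin n) :
    ⁅tor F n i l, D (F := F) (m := m) (n := n) (Sum.inl j)⁆ =
      torWt F i l (Sum.inl j) ((0 : Fin m → ℕ), ∅) • D (Sum.inl j) := by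
  rw [D_inl_eq_vf]
  exact lie_tor_vf i l _ rfl

/-- An eigenvector relation for a derivation whose value on a torus element is diagonal. -/
lemma IsFieldDer.eigenvalue_eq_zero (hψ : IsFieldDer n p t ψ) (ht : ∀ i, 1 ≤ t i) {i : Fin m}
    {l : Fin n} {k : Var m n} {a : Expo m n} {μ : F} (ha : #a.2 % 2 = tau k % 2)
    (hy : vf k (mono F a) ∈ evenSpecial F n p t)
    (h : ⁅ψ (tor F n i l), vf k (mono F a)⁆ = μ • vf k (mono F a)) : μ = 0 := by
  have h1 := hψ.leib _ (ModularCartan.tor_mem ht i l) _ hy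
  rw [h, lie_tor_vf i l k ha, map_smul] at h1
  have h2 := congrArg (cf k a) h1
  rw [map_smul, map_add, map_smul, cf_lie_tor, cf_vf, if_pos rfl, co_mono, if_pos rfl,
    smul_eq_mul, smul_eq_mul, mul_one] at h2
  linear_combination -h2

/-- Modulo inner derivations, a derivation that kills the `D_i` also kills the torus. -/
lemma IsFieldDer.exists_isWeightDer (hψ : IsFieldDer n p t ψ) (hp3 : 3 < p) (hm : 3 ≤ m)
    (hn : 2 ≤ n) (ht : ∀ i, 1 ≤ t i) (hD : ∀ i, ψ (D (Sum.inl i)) = 0) :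
    ∃ E ∈ evenFields F n p t, IsWeightDer n p t (ψ - LieAlgebra.ad F _ E) := by
  classical
  have htor := fun (i : Fin m) (l : Fin n) => ModularCartan.tor_mem (F := F) (p := p) ht i l
  have hcomm : ∀ i l j l' k a, torWt F i l k a * cf k a (ψ (tor F n j l')) =
      torWt F j l' k a * cf k a (ψ (tor F n i l)) := by
    intro i l j l' k a
    have h := hψ.leib _ (htor i l) _ (htor j l')
    rw [lie_tor_tor, map_zero, ← lie_skew, eq_comm, neg_add_eq_zero] at h
    rw [← cf_lie_tor, ← cf_lie_tor, h]
  -- Nonzero weights are divided out, using any torus element of nonzero weight; `hcomm` makes the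
  -- choice irrelevant. Restricting to monomials free of even variables keeps the values on the D_i
  -- unchanged.
  let c : Var m n → Expo m n → F := fun k a =>
    if h : a.1 = 0 ∧ ∃ x : Fin m × Fin n, torWt F x.1 x.2 k a ≠ 0 then
      -(torWt F h.2.choose.1 h.2.choose.2 k a)⁻¹ *
        cf k a (ψ (tor F n h.2.choose.1 h.2.choose.2)) else 0
  have hc : ∀ i l k a, a.1 = 0 → (∃ x : Fin m × Fin n, torWt F x.1 x.2 k a ≠ 0) →
      torWt F i l k a * c k a = -cf k a (ψ (tor F n i l)) := by
    intro i l k a h0 hx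
    simp only [c, dif_pos (show _ ∧ _ from ⟨h0, hx⟩)]
    have h1 := hx.choose_spec
    have h2 := hcomm i l hx.choose.1 hx.choose.2 k a
    field_simp
    linear_combination -h2
  have hE := ofCf_mem (F := F) (n := n) (p := p) (t := t) c
  set E := ofCf p t c with hEdef
  have hχ := hψ.sub (isFieldDer_ad_of_mem n p t hE)
  have hDE : ∀ i, ⁅D (F := F) (m := m) (n := n) (Sum.inl i), E⁆ = 0 := by
    intro i
    refine evenFields_ext (adD_mem hE i) (Submodule.zero_mem _) fun k a => ?_
    rw [cf_lie_D hE, hEdef, cf_ofCf, map_zero, ite_eq_right_iff]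
    intro _
    refine dif_neg fun h => ?_
    have := congrFun h.1 i
    simp at this
  have hχD : ∀ i, (ψ - LieAlgebra.ad F _ E) (D (Sum.inl i)) = 0 := by
    intro i
    rw [LinearMap.sub_apply, hD, LieAlgebra.ad_apply, ← lie_skew, hDE, neg_zero, sub_zero]
  refine ⟨E, hE, hχ, fun i => ⟨Dinl_mem hm ht i, hχD i⟩, fun i l => ⟨htor i l, ?_⟩⟩
  have hmem := hχ.map_mem _ (htor i l)
  have hDv : ∀ j, ⁅D (F := F) (m := m) (n := n) (Sum.inl j),
      (ψ - LieAlgebra.ad F _ E) (tor F n i l)⁆ = 0 := by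
    intro j
    have h := hχ.leib _ (Dinl_mem hm ht j) _ (htor i l)
    rw [hχD, zero_lie, zero_add, ← lie_skew, lie_tor_D, map_neg, map_smul, hχD, smul_zero,
      neg_zero] at h
    exact h.symm
  -- What remains of ψ on the torus has weight zero, hence is diagonal in the odd variables.
  have h1 := eq_oddDiag hm (by omega) ht hmem hDv fun j l' => by
    refine evenFields_ext (evenFields_lie (evenSpecial_le_evenFields (htor j l')) hmem)
      (Submodule.zero_mem _) fun k a => ?_
    rw [cf_lie_tor, map_zero, mul_eq_zero, or_iff_not_imp_left]
    intro hwt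
    by_contra hne
    have ha : a.1 = 0 := by
      funext q
      by_contra hq
      have h2 := cf_lie_D hmem q k (a.1 - Pi.single q 1, a.2)
      rw [hDv, map_zero] at h2
      dsimp only at h2
      rw [sub_add_single hq] at h2
      exact hne h2.symm
    refine hne ?_
    rw [LinearMap.sub_apply, map_sub, LieAlgebra.ad_apply, ← lie_skew, map_neg, cf_lie_tor, hEdef,
      cf_ofCf, if_pos (cf_mem hmem hne), hc i l k a ha ⟨(j, l'), hwt⟩]
    ring
  -- The rotations and pairs are eigenvectors of this diagonal field, and their eigenvalues must
  -- vanish.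
  have h3 := fun (k : Var m n) (a : Expo m n) (μ : F) =>
    hχ.eigenvalue_eq_zero ht (i := i) (l := l) (k := k) (a := a) (μ := μ)
  rw [h1] at h3
  refine h1.trans (oddDiag_eq_zero (two_ne_zero_of_three_lt hp3) hn (fun k l' hkl => ?_)
    fun a b hab => ?_)
  · exact sub_eq_zero.1 (h3 _ _ _ (by simp [tau]) (rot_mem_special hp3 hkl) (lie_oddDiag_inr _ _ _))
  · exact h3 _ _ _ (by simp [tau, card_pair hab]) (pair_mem_special hm ht i hab)
      (lie_oddDiag_inl _ i hab)

end TorusReduction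

/-! ### Normalising on rotations, pairs and p-powers -/

section DiagonalReduction

variable {F : Type*} [Field F] {m n p : ℕ} [hp : Fact p.Prime] [CharP F p] {t : Fin m → ℕ}
  {ψ : Module.End F (Module.End F (Alg F m n))}

/-- ψ preserves weights, so it acts by a scalar when the weight space among fields free of even
variables is one-dimensional. -/
lemma IsWeightDer.eq_smul (hψ : IsWeightDer n p t ψ) {k : Var m n} {w : Finset (Fin n)}
    (ht : #w % 2 = tau k % 2) (hy : vf k (mono F (0, w)) ∈ evenSpecial F n p t)
    (h : ∀ k' w', SameWeight (fun r => (deg r ((0 : Fin m → ℕ), w) : F) - if r = k then 1 else 0)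
      k' w' → k' = k ∧ w' = w) :
    ∃ c : F, ψ (vf k (mono F (0, w))) = c • vf k (mono F (0, w)) := by
  have hy' := evenSpecial_le_evenFields hy
  refine ⟨cf k (0, w) (ψ (vf k (mono F (0, w)))), evenFields_ext (hψ.map_mem _ hy)
    (Submodule.smul_mem _ _ hy') fun k' a => ?_⟩
  rw [map_smul, cf_vf, co_mono, smul_eq_mul, ← ite_and]
  split_ifs with h1
  · rw [← h1.1, ← h1.2, mul_one]
  · rw [mul_zero]
    by_contra h2
    obtain ⟨h3, h4⟩ := hψ.sameWeight hy (fun r => lie_eul_vf_mono r k ht) (fun i => by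
      rw [lie_D_vf i k (mono_homog _ ht), D_inl_of_eq_zero rfl, map_zero]
      exact Submodule.zero_mem _) h2
    obtain ⟨h5, h6⟩ := h k' a.2 h4
    exact h1 ⟨h5.symm, Prod.ext h3.symm h6.symm⟩

omit hp [CharP F p] in
lemma sameWeight_rot (h2 : (2 : F) ≠ 0) (hm : 3 ≤ m) {k l : Fin n} (hkl : k ≠ l) {k' : Var m n}
    {w' : Finset (Fin n)} (h : SameWeight (fun r => (deg r ((0 : Fin m → ℕ), {k}) : F) -
      if r = Sum.inr l then 1 else 0) k' w') : k' = Sum.inr l ∧ w' = {k} := by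
  have h1 : (1 : F) ≠ 0 := one_ne_zero
  have hl := fun i => h i l
  simp only [deg, Pi.zero_apply, Nat.cast_zero, reduceCtorEq, if_false, sub_zero, mem_singleton,
    hkl.symm, zero_add, if_true, zero_sub] at hl
  have hk' : k' = Sum.inr l := by
    rcases k' with i | q
    · obtain ⟨j, hj, -⟩ := exists_third hm i i
      have e := hl j
      simp only [reduceCtorEq, if_false, Sum.inl.injEq, hj.symm, sub_zero] at e
      split_ifs at e
      · exact absurd (by linear_combination -e) h2
      · exact absurd (by linear_combination -e) h1
    · have e := hl ⟨0, by omega⟩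
      simp only [reduceCtorEq, if_false, sub_zero, Sum.inr.injEq] at e
      by_contra hq
      have hq' : q ≠ l := fun h' => hq (congrArg _ h')
      rw [if_neg hq'] at e
      split_ifs at e
      · exact absurd (by linear_combination -e) h2
      · exact absurd (by linear_combination -e) h1
  subst hk'
  refine ⟨rfl, ?_⟩
  ext q
  have e := h ⟨0, by omega⟩ q
  simp only [deg, Pi.zero_apply, Nat.cast_zero, reduceCtorEq, if_false, sub_zero, mem_singleton,
    zero_add, Sum.inr.injEq, eq_comm (a := l)] at e
  rw [mem_singleton]
  generalize (if q = l then (1 : F) else 0) = x at e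
  rcases em (q = k) with h3 | h3 <;> rcases em (q ∈ w') with h4 | h4
  · exact iff_of_true h4 h3
  · rw [if_pos h3, if_neg h4] at e
    exact absurd (by push_cast at e; linear_combination e) h1
  · rw [if_neg h3, if_pos h4] at e
    exact absurd (by push_cast at e; linear_combination -e) h1
  · exact iff_of_false h4 h3

omit hp [CharP F p] in
lemma sameWeight_pair (hn : 0 < n) (hm : 3 ≤ m) {i : Fin m} {w : Finset (Fin n)}
    {k' : Var m n}
    {w' : Finset (Fin n)} (h : SameWeight (fun r => (deg r ((0 : Fin m → ℕ), w) : F) -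
      if r = Sum.inl i then 1 else 0) k' w') : k' = Sum.inl i ∧ w' = w := by
  have h1 : (1 : F) ≠ 0 := one_ne_zero
  have h' : ∀ j l, (-(if j = i then (1 : F) else 0)) + (if l ∈ w then 1 else 0) =
      (if l ∈ w' then 1 else 0) - (if k' = Sum.inr l then 1 else 0) -
        (if k' = Sum.inl j then 1 else 0) := by
    intro j l
    rw [← h j l]
    simp [deg]
  clear h
  rcases k' with q | q
  · simp only [reduceCtorEq, if_false, Sum.inl.injEq, sub_zero] at h' ⊢
    obtain ⟨j, hji, hjq⟩ := exists_third hm i q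
    have hw : w' = w := by
      ext l
      have e := h' j l
      rw [if_neg hji, if_neg hjq.symm] at e
      by_cases h3 : l ∈ w <;> by_cases h4 : l ∈ w' <;> simp_all
    refine ⟨?_, hw⟩
    subst hw
    by_contra hqi
    have e := h' i ⟨0, hn⟩
    rw [if_pos rfl, if_neg hqi] at e
    exact h1 (by linear_combination -e)
  · obtain ⟨j, hji, -⟩ := exists_third hm i i
    have e1 := h' i q
    have e2 := h' j q
    simp [hji] at e1 e2
    exact absurd (by linear_combination e2 - e1) h1

omit hp [CharP F p] in
lemma lie_rot_rot (k l q : Fin n) :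
    ⁅vf (m := m) (Sum.inr l) (mono F (0, {k})), vf (m := m) (Sum.inr q) (mono F (0, {l}))⁆ =
      vf (Sum.inr q) (mono F (0, {k})) -
        if q = k then vf (Sum.inr l) (mono F (0, {l})) else 0 := by
  have hX : ∀ r : Fin n, mono F ((0 : Fin m → ℕ), {r}) = X F (Sum.inr r) := fun _ => rfl
  rw [lie_vf (mono_homog _ (by simp [tau])) (mono_homog _ (by simp [tau])), hX, hX, vf_apply_X,
    vf_apply_X, if_pos rfl]
  simp only [Sum.inr.injEq]
  split_ifs <;> simp

omit hp [CharP F p] in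
lemma lie_oddDiag_D (s : Fin n → F) (i : Fin m) :
    ⁅oddDiag (m := m) s, D (F := F) (m := m) (n := n) (Sum.inl i)⁆ = 0 := by
  rw [oddDiag, sum_lie]
  refine sum_eq_zero fun l _ => ?_
  rw [smul_lie, D_inl_eq_vf, one, lie_eul_vf_mono _ _ rfl]
  simp [deg]

omit hp [CharP F p] in
lemma lie_oddDiag_tor (s : Fin n → F) (i : Fin m) (l : Fin n) :
    ⁅oddDiag (m := m) s, tor F n i l⁆ = 0 := by
  rw [oddDiag, sum_lie]
  refine sum_eq_zero fun l _ => ?_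
  simp [tor, lie_eul_eul]

/-- Modulo inner derivations, a derivation that kills the `D_i` and the torus is reduced. -/
lemma IsWeightDer.exists_isReducedDer (hψ : IsWeightDer n p t ψ) (hp3 : 3 < p) (hm : 3 ≤ m)
    (hn : 2 ≤ n) (ht : ∀ i, 1 ≤ t i) :
    ∃ E ∈ evenFields F n p t, IsReducedDer n p t (ψ - LieAlgebra.ad F _ E) := by
  have h2 := two_ne_zero_of_three_lt (F := F) hp3
  have hrot := fun (k l : Fin n) (h : k ≠ l) => rot_mem_special (F := F) (m := m) (t := t) hp3 h
  have hex : ∀ k l : Fin n, ∃ c : F, k ≠ l → ψ (vf (Sum.inr l) (mono F (0, {k}))) =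
      c • vf (Sum.inr l) (mono F (0, {k})) := by
    intro k l
    by_cases h : k = l
    · exact ⟨0, fun h' => absurd h h'⟩
    · obtain ⟨c, hc⟩ := hψ.eq_smul (by simp [tau]) (hrot k l h) fun k' w' =>
        sameWeight_rot h2 hm h
      exact ⟨c, fun _ => hc⟩
  choose μ hμ using hex
  -- [x_k D_l, x_l D_k] is a difference of torus elements, on which ψ vanishes.
  have hanti : ∀ k l, k ≠ l → μ k l + μ l k = 0 := by
    intro k l hkl
    have h := hψ.leib _ (hrot k l hkl) _ (hrot l k hkl.symm)
    rw [hμ k l hkl, hμ l k hkl.symm, smul_lie, lie_smul, ← add_smul, lie_rot_rot, if_pos rfl] at h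
    have h3 : vf (m := m) (Sum.inr k) (mono F (0, {k})) - vf (Sum.inr l) (mono F (0, {l})) =
        tor F n ⟨0, by omega⟩ k - tor F n ⟨0, by omega⟩ l := by
      simp only [tor, eul_eq_vf, varExpo]; abel
    rw [h3, map_sub, (hψ.tor_mem _ _).2, (hψ.tor_mem _ _).2, sub_zero, ← h3] at h
    have h4 := congrArg (cf (Sum.inr k) (0, {k})) h
    simpa [cf_vf, co_mono, hkl.symm] using h4.symm
  have hcoc : ∀ k l q, k ≠ l → l ≠ q → k ≠ q → μ k l + μ l q = μ k q := by
    intro k l q hkl hlq hkq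
    have h := hψ.leib _ (hrot k l hkl) _ (hrot l q hlq)
    rw [hμ k l hkl, hμ l q hlq, smul_lie, lie_smul, ← add_smul, lie_rot_rot, if_neg hkq.symm,
      sub_zero, hμ k q hkq] at h
    have h4 := congrArg (cf (Sum.inr q) (0, {k})) h
    simpa [cf_vf, co_mono] using h4.symm
  let i0 : Fin m := ⟨0, by omega⟩
  let l0 : Fin n := ⟨0, by omega⟩
  let l1 : Fin n := ⟨1, by omega⟩
  have hl : l0 ≠ l1 := by simp [l0, l1]
  obtain ⟨c, hc⟩ := hψ.eq_smul (by simp [tau, card_pair hl]) (pair_mem_special hm ht i0 hl)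
    fun k' w' => sameWeight_pair (by omega) hm
  -- The scalars form an additive cocycle, hence a coboundary s k - s l, with s normalised to vanish
  -- at l0.
  let s : Fin n → F := fun k => if k = l0 then 0 else μ k l0
  have hs : ∀ k l, k ≠ l → μ k l = s k - s l := by
    intro k l hkl
    simp only [s]
    by_cases hk : k = l0
    · subst hk
      rw [if_pos rfl, if_neg hkl.symm]
      linear_combination hanti _ _ hkl
    · rw [if_neg hk]
      by_cases hl : l = l0
      · rw [if_pos hl, hl, sub_zero]
      · rw [if_neg hl]
        linear_combination hcoc k l l0 hkl hl hk
  -- A common shift of s changes no difference s k - s l, and this shift matches the scalar on the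
  -- chosen pair.
  let σ : F := (c - s l0 - s l1) / 2
  have hE := oddDiag_mem (m := m) (p := p) ht fun k => s k + σ
  refine ⟨_, hE, ⟨hψ.toIsFieldDer.sub (isFieldDer_ad_of_mem n p t hE),
    fun i => ⟨(hψ.D_mem i).1, ?_⟩, fun i l => ⟨(hψ.tor_mem i l).1, ?_⟩⟩,
    fun k l hkl => ⟨hrot k l hkl, ?_⟩, i0, l0, l1, hl, pair_mem_special hm ht i0 hl, ?_⟩
  · exact sub_eq_zero.2 ((hψ.D_mem i).2.trans (lie_oddDiag_D _ i).symm)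
  · exact sub_eq_zero.2 ((hψ.tor_mem i l).2.trans (lie_oddDiag_tor _ i l).symm)
  · refine sub_eq_zero.2 ((hμ k l hkl).trans ?_)
    rw [LieAlgebra.ad_apply, lie_oddDiag_inr, hs k l hkl]
    congr 1; ring
  · refine sub_eq_zero.2 (hc.trans ?_)
    rw [LieAlgebra.ad_apply, lie_oddDiag_inl _ _ hl]
    congr 1
    simp only [σ]
    field_simp
    ring

/-- The exponents of the nontrivial `p`-powers of the `D_i`. -/
abbrev FrobIdx (t : Fin m → ℕ) : Type := Σ i : Fin m, Fin (t i - 1)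

variable (n p) in
/-- The linear combinations of the `D_i ^ (p ^ s)`, `1 ≤ s < t_i`. -/
def frobSum (ν : FrobIdx t → F) : Module.End F (Alg F m n) :=
  ∑ x, ν x • D (Sum.inl x.1) ^ p ^ (x.2.1 + 1)

omit hp [CharP F p] in
lemma lie_frobSum (ν : FrobIdx t → F) (y : Module.End F (Alg F m n)) :
    ⁅frobSum n p ν, y⁆ = ∑ x : FrobIdx t, ν x • adFrob F n p x.1 (x.2.1 + 1) y := by
  simp only [frobSum, sum_lie, smul_lie, adFrob_apply]

lemma lie_frobSum_mem_special (hm : 3 ≤ m) (ht : ∀ i, 1 ≤ t i) (ν : FrobIdx t → F)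
    {y : Module.End F (Alg F m n)} (hy : y ∈ evenSpecial F n p t) :
    ⁅frobSum n p ν, y⁆ ∈ evenSpecial F n p t := by
  rw [lie_frobSum]
  exact sum_mem fun x _ => (evenSpecial F n p t).smul_mem _ (adFrob_mem_special hm ht hy _ _)

/-- The powers have s ≥ 1, so they lower an exponent by at least p. Everything normalised so far has
exponents at most 1. -/
lemma lie_frobSum_vf (ν : FrobIdx t → F) {k : Var m n} {a : Expo m n} (h1 : ∀ i, a.1 i < p ^ t i)
    (h2 : #a.2 % 2 = tau k % 2) (h3 : ∀ i, a.1 i ≤ 1) : ⁅frobSum n p ν, vf k (mono F a)⁆ = 0 := by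
  rw [lie_frobSum]
  refine sum_eq_zero fun x _ => ?_
  rw [adFrob_vf h1 h2, smul_zero]
  exact (h3 _).trans_lt (one_lt_pow₀ hp.out.one_lt (by omega))

lemma lie_frobSum_D (ν : FrobIdx t → F) (i : Fin m) :
    ⁅frobSum n p ν, D (F := F) (m := m) (n := n) (Sum.inl i)⁆ = 0 := by
  rw [D_inl_eq_vf]
  exact lie_frobSum_vf ν (fun _ => pow_pos hp.out.pos _) rfl (by simp)

lemma lie_frobSum_tor (ht : ∀ i, 1 ≤ t i) (ν : FrobIdx t → F) (i : Fin m) (l : Fin n) :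
    ⁅frobSum n p ν, tor F n i l⁆ = 0 := by
  rw [tor, lie_add, eul_eq_vf, eul_eq_vf, lie_frobSum_vf ν _ rfl,
    lie_frobSum_vf ν (fun _ => pow_pos hp.out.pos _), add_zero]
  · simp [varExpo, tau]
  · simp [varExpo]
  · intro j
    simp only [varExpo, Pi.single_apply]; split_ifs <;> simp
  · exact fun j => single_lt (one_lt_pow₀ hp.out.one_lt (by have := ht i; omega))

lemma lie_frobSum_rot (ν : FrobIdx t → F) (k l : Fin n) :
    ⁅frobSum n p ν, vf (m := m) (n := n) (Sum.inr l) (mono F (0, {k}))⁆ = 0 :=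
  lie_frobSum_vf ν (fun _ => pow_pos hp.out.pos _) (by simp [tau]) (by simp)

lemma lie_frobSum_pair (ν : FrobIdx t → F) (i : Fin m) {a b : Fin n} (hab : a ≠ b) :
    ⁅frobSum n p ν, vf (m := m) (n := n) (Sum.inl i) (mono F (0, {a, b}))⁆ = 0 :=
  lie_frobSum_vf ν (fun _ => pow_pos hp.out.pos _) (by simp [tau, card_pair hab]) (by simp)

/-- Among the listed powers, only D_q^(p^s) takes x_q^(p^s) to 1, so this coefficient isolates one
entry of ν. -/
lemma cf_lie_frobSum (ν : FrobIdx t → F) (x : FrobIdx t) (j : Fin m) :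
    cf (Sum.inl j) (0, ∅) ⁅frobSum (F := F) n p ν,
      vf (n := n) (Sum.inl j) (mono F (Pi.single x.1 (p ^ (x.2.1 + 1)), ∅))⁆ = ν x := by
  have hlt : ∀ i, (Pi.single x.1 (p ^ (x.2.1 + 1)) : Fin m → ℕ) i < p ^ t i := fun i =>
    single_lt (Nat.pow_lt_pow_right hp.out.one_lt (by have := x.2.2; omega))
  rw [lie_frobSum, map_sum, sum_eq_single x]
  · rw [map_smul, cf_adFrob (vf_mono_mem hlt rfl), cf_vf, if_pos rfl, co_mono]
    simp
  · intro y _ hyx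
    rw [map_smul, cf_adFrob (vf_mono_mem hlt rfl), cf_vf, if_pos rfl, co_mono, if_neg, smul_zero]
    rw [zero_add, Prod.mk.injEq]
    rintro ⟨h, -⟩
    refine hyx ?_
    obtain ⟨i, s⟩ := x
    obtain ⟨j, r⟩ := y
    dsimp only at h
    have hji : j = i := by
      by_contra hne
      have := congrFun h i
      simp [Ne.symm hne] at this
      exact hp.out.ne_zero this
    subst hji
    have h5 := Nat.pow_right_injective hp.out.two_le (Pi.single_injective j h)
    rw [Sigma.mk.injEq]
    exact ⟨rfl, heq_of_eq (Fin.ext (by omega))⟩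
  · simp

/-- One direction j ≠ q is fixed for each q and ν is read off there; the earlier normalisations
survive because `frobSum` kills those elements. -/
lemma IsReducedDer.exists_isNormalDer (hψ : IsReducedDer n p t ψ) (hm : 3 ≤ m)
    (ht : ∀ i, 1 ≤ t i) :
    ∃ ν : FrobIdx t → F, IsNormalDer n p t (ψ - LieAlgebra.ad F _ (frobSum n p ν)) := by
  have hex : ∀ i : Fin m, ∃ j, j ≠ i := fun i => (exists_third hm i i).imp fun _ h => h.1
  choose j hj using hex
  let ν : FrobIdx t → F := fun x => cf (Sum.inl (j x.1)) (0, ∅)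
    (ψ (vf (Sum.inl (j x.1)) (mono F (Pi.single x.1 (p ^ (x.2.1 + 1)), ∅))))
  refine ⟨ν, ⟨⟨hψ.toIsFieldDer.sub (isFieldDer_ad n p t fun x hx => evenSpecial_le_evenFields
    (lie_frobSum_mem_special hm ht ν hx)), fun i => ⟨(hψ.D_mem i).1, ?_⟩,
    fun i l => ⟨(hψ.tor_mem i l).1, ?_⟩⟩, fun k l hkl => ⟨(hψ.rot_mem k l hkl).1, ?_⟩, ?_⟩, ?_⟩
  · exact sub_eq_zero.2 ((hψ.D_mem i).2.trans (lie_frobSum_D ν i).symm)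
  · exact sub_eq_zero.2 ((hψ.tor_mem i l).2.trans (lie_frobSum_tor ht ν i l).symm)
  · exact sub_eq_zero.2 ((hψ.rot_mem k l hkl).2.trans (lie_frobSum_rot ν k l).symm)
  · obtain ⟨i, a, b, hab, h⟩ := hψ.pair_mem
    exact ⟨i, a, b, hab, h.1, sub_eq_zero.2 (h.2.trans (lie_frobSum_pair ν i hab).symm)⟩
  · intro q s hs hst
    obtain ⟨r, rfl⟩ := Nat.exists_eq_add_of_le' hs
    refine ⟨j q, hj q, ?_⟩
    rw [LinearMap.sub_apply, map_sub, LieAlgebra.ad_apply,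
      cf_lie_frobSum ν ⟨q, ⟨r, by omega⟩⟩ (j q)]
    exact sub_self _

/-- A derivation into the even fields is induced by an even field and `p`-powers of the `D_i`. -/
theorem IsFieldDer.exists_eq_lie (hψ : IsFieldDer n p t ψ) (hp3 : 3 < p) (hm : 3 ≤ m)
    (hn : 2 ≤ n) (ht : ∀ i, 1 ≤ t i) : ∃ E ∈ evenFields F n p t, ∃ ν : FrobIdx t → F,
      ∀ y ∈ evenSpecial F n p t, ψ y = ⁅E, y⁆ + ⁅frobSum n p ν, y⁆ := by
  obtain ⟨E1, hE1, h1⟩ := hψ.exists_lie_D hp3 hm hn ht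
  have hψ1 := hψ.sub (isFieldDer_ad_of_mem n p t hE1)
  obtain ⟨E2, hE2, hψ2⟩ := hψ1.exists_isWeightDer hp3 hm hn ht h1
  obtain ⟨E3, hE3, hψ3⟩ := hψ2.exists_isReducedDer hp3 hm hn ht
  obtain ⟨ν, hψ4⟩ := hψ3.exists_isNormalDer hm ht
  refine ⟨E1 + E2 + E3, add_mem (add_mem hE1 hE2) hE3, ν, fun y hy => ?_⟩
  have h := hψ4.eq_zero hp3 hm hn ht hy
  simp only [LinearMap.sub_apply, LieAlgebra.ad_apply] at h
  rw [sub_eq_zero] at h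
  rw [← h, add_lie, add_lie]
  abel

end DiagonalReduction

/-! ### The divergence of even fields -/

section Divergence

variable {F : Type*} [Field F] {m n p : ℕ} {t : Fin m → ℕ}

variable (F m n) in
/-- The divergence of a field. -/
def divg : Module.End F (Alg F m n) →ₗ[F] Alg F m n :=
  ∑ k, (-1 : F) ^ tau k • D k ∘ₗ LinearMap.applyₗ (X F k)

lemma divg_apply (T : Module.End F (Alg F m n)) :
    divg F m n T = ∑ k, (-1 : F) ^ tau k • D k (T (X F k)) := by
  simp [divg]

lemma divg_vf (k : Var m n) (f : Alg F m n) :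
    divg F m n (vf k f) = (-1 : F) ^ tau k • D k f := by
  rw [divg_apply, sum_eq_single k]
  · rw [vf_apply_X, if_pos rfl]
  · intro l _ hl
    rw [vf_apply_X, if_neg hl.symm, map_zero, smul_zero]
  · simp

lemma divg_lie_D {T : Module.End F (Alg F m n)} (hT : T ∈ evenFields F n p t) (i : Fin m) :
    divg F m n ⁅D (F := F) (m := m) (n := n) (Sum.inl i), T⁆ = D (Sum.inl i) (divg F m n T) := by
  have h1 := evenFields_one hT
  rw [divg_apply, divg_apply, map_sum]
  refine sum_congr rfl fun k _ => ?_
  have h2 := LinearMap.congr_fun (D_comm (F := F) (Sum.inl i) k) (T (X F k))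
  simp only [LinearMap.comp_apply, tau, zero_mul, pow_zero, one_smul] at h2
  rw [lie_apply, D_X, map_smul, h2]
  split_ifs <;> simp [h1]

lemma D_eul (r u : Var m n) (f : Alg F m n) :
    D u (eul F r f) = eul F r (D u f) + (if r = u then (1 : F) else 0) • D u f := by
  have h : D u ∘ₗ eul F r = eul F r ∘ₗ D u + (if r = u then (1 : F) else 0) • D u := by
    refine ext_mono fun a => ?_
    rw [LinearMap.comp_apply, LinearMap.add_apply, LinearMap.comp_apply, LinearMap.smul_apply,
      eul_D, eul_mono, map_smul, ← add_smul, sub_add_cancel]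
  exact LinearMap.congr_fun h f

lemma divg_lie_eul (T : Module.End F (Alg F m n)) (r : Var m n) :
    divg F m n ⁅eul F r, T⁆ = eul F r (divg F m n T) := by
  rw [divg_apply, divg_apply, map_sum]
  refine sum_congr rfl fun k _ => ?_
  rw [lie_apply, eul_X, map_smul, map_sub, D_eul, map_smul, map_smul, add_sub_cancel_right]

lemma divg_mem {T : Module.End F (Alg F m n)} (hT : T ∈ evenFields F n p t) :
    divg F m n T ∈ trunc F n p t ⊓ homog F m n 0 := by
  rw [divg_apply]
  refine sum_mem fun k _ => Submodule.smul_mem _ _ ?_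
  obtain ⟨h1, h2⟩ := evenFields_apply_X hT k
  refine ⟨D_trunc k h1, ?_⟩
  rw [homog_congr (q' := tau k + tau k) (by omega)]
  exact D_homog k h2

lemma co_D_inr_of_mem {l : Fin n} {a : Expo m n} (h : l ∈ a.2) (f : Alg F m n) :
    co a (D (Sum.inr l) f) = 0 := by
  have : co a ∘ₗ D (F := F) (Sum.inr l) = 0 := by
    refine ext_mono fun b => ?_
    rw [LinearMap.comp_apply, D_inr_mono, LinearMap.zero_apply]
    split_ifs with hb
    · rw [map_smul, co_mono, if_neg, smul_zero]
      rintro rfl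
      simp at h
    · rw [map_zero]
  exact LinearMap.congr_fun this f

/-- The top monomial does not occur in a divergence. -/
lemma co_divg_top {T : Module.End F (Alg F m n)} (hT : T ∈ evenFields F n p t) {a : Expo m n}
    (h1 : ∀ i, a.1 i + 1 = p ^ t i) (h2 : a.2 = univ) : co a (divg F m n T) = 0 := by
  rw [divg_apply, map_sum]
  refine sum_eq_zero fun k _ => ?_
  rw [map_smul]
  rcases k with i | l
  · rw [co_D_inl]
    by_contra h
    have := co_trunc (evenFields_apply_X hT (Sum.inl i)).1 (right_ne_zero_of_mul h) i
    simp [h1] at this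
  · rw [co_D_inr_of_mem (by simp [h2]), smul_zero]

variable (n p t) in
/-- The nonconstant monomials that occur in divergences of even truncated fields. -/
def divIdx : Finset (Expo m n) :=
  {a ∈ Fintype.piFinset (fun i => range (p ^ t i)) ×ˢ univ | #a.2 % 2 = 0 ∧ a ≠ (0, ∅) ∧
    ¬ ((∀ i, a.1 i + 1 = p ^ t i) ∧ a.2 = univ)}

lemma mem_divIdx {a : Expo m n} : a ∈ divIdx n p t ↔ (∀ i, a.1 i < p ^ t i) ∧ #a.2 % 2 = 0 ∧
    a ≠ (0, ∅) ∧ ¬ ((∀ i, a.1 i + 1 = p ^ t i) ∧ a.2 = univ) := by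
  simp [divIdx]

variable (F n p t) in
/-- The nonconstant coefficients of the divergence. -/
def divCoeffs : evenFields F n p t →ₗ[F] (divIdx n p t → F) :=
  LinearMap.pi fun a => co a.1 ∘ₗ divg F m n ∘ₗ (evenFields F n p t).subtype

lemma divCoeffs_apply (T : evenFields F n p t) (a : divIdx n p t) :
    divCoeffs F n p t T a = co a.1 (divg F m n T) := rfl

/-- A monomial can be integrated in an even variable with non-maximal exponent, or else in a missing
odd variable; only the top monomial has neither. -/
lemma divCoeffs_surjective : Function.Surjective (divCoeffs F (m := m) n p t) := by
  classical
  rw [← LinearMap.range_eq_top, eq_top_iff]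
  rintro f -
  rw [pi_eq_sum_univ' f]
  refine sum_mem fun a _ => Submodule.smul_mem _ _ ?_
  obtain ⟨⟨α, u⟩, ha⟩ := a
  obtain ⟨h1, h2, -, h4⟩ := mem_divIdx.1 ha
  dsimp only at h1 h2 h4
  obtain ⟨T, hT, c, hc, hdiv⟩ : ∃ T ∈ evenFields F n p t, ∃ c : F, c ≠ 0 ∧
      divg F m n T = c • mono F (α, u) := by
    by_cases h5 : ∀ i, α i + 1 = p ^ t i
    · obtain ⟨l, hl⟩ : ∃ l, l ∉ u := by
        by_contra! h6
        exact h4 ⟨h5, eq_univ_iff_forall.2 h6⟩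
      obtain ⟨c, hc, hD⟩ := D_inr_insert (F := F) α hl
      refine ⟨vf (Sum.inr l) (mono F (α, insert l u)), vf_mono_mem h1 ?_, -c, neg_ne_zero.2 hc, ?_⟩
      · rw [card_insert_of_notMem hl]; simp only [tau]; omega
      · rw [divg_vf, hD]; simp [tau]
    · push Not at h5
      obtain ⟨i, hi⟩ := h5
      refine ⟨vf (Sum.inl i) (mono F (α + Pi.single i 1, u)), vf_mono_mem
        (lt_add_single h1 (by have := h1 i; omega)) h2, 1, one_ne_zero, ?_⟩
      rw [divg_vf, D_inl_add]; simp [tau]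
  refine ⟨c⁻¹ • ⟨T, hT⟩, funext fun b => ?_⟩
  rw [map_smul, Pi.smul_apply, divCoeffs_apply, hdiv, map_smul, co_mono, smul_eq_mul, smul_eq_mul,
    inv_mul_cancel_left₀ hc]
  simp only [Pi.single_apply, Subtype.ext_iff, eq_comm]

lemma mem_ker_divCoeffs {T : evenFields F n p t} :
    T ∈ LinearMap.ker (divCoeffs F n p t) ↔ ∃ c : F, divg F m n T = c • one F m n := by
  rw [LinearMap.mem_ker]
  constructor
  · intro h
    refine ⟨co (0, ∅) (divg F m n T), ext_co fun a => ?_⟩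
    rw [map_smul, one, co_mono, smul_eq_mul]
    split_ifs with ha
    · rw [ha, mul_one]
    · rw [mul_zero]
      by_contra h1
      obtain ⟨h2, h3⟩ := divg_mem T.2
      exact h1 (congrFun h ⟨a, mem_divIdx.2 ⟨co_trunc h2 h1, co_homog h3 h1, Ne.symm ha,
        fun h4 => h1 (co_divg_top T.2 h4.1 h4.2)⟩⟩)
  · rintro ⟨c, hc⟩
    funext a
    rw [divCoeffs_apply, hc, map_smul, one, co_mono, if_neg (mem_divIdx.1 a.2).2.2.1.symm,
      smul_zero, Pi.zero_apply]

/-- The coefficients of an even field. -/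
def fieldCoeffs : evenFields F n p t →ₗ[F] (fieldIdx n p t → F) :=
  LinearMap.pi fun x => cf x.1.1 x.1.2 ∘ₗ (evenFields F n p t).subtype

lemma fieldCoeffs_apply (T : evenFields F n p t) (x : fieldIdx n p t) :
    fieldCoeffs T x = cf x.1.1 x.1.2 (T : Module.End F (Alg F m n)) := rfl

lemma fieldCoeffs_bijective : Function.Bijective (fieldCoeffs (F := F) (n := n) (p := p) (t := t)) := by
  constructor
  · intro S T h
    refine Subtype.ext (evenFields_ext S.2 T.2 fun k a => ?_)
    by_cases hx : (k, a) ∈ fieldIdx n p t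
    · exact congrFun h ⟨(k, a), hx⟩
    · rw [not_imp_comm.1 (cf_mem S.2) hx, not_imp_comm.1 (cf_mem T.2) hx]
  · intro c
    refine ⟨⟨ofCf p t fun k a => if h : (k, a) ∈ fieldIdx n p t then c ⟨(k, a), h⟩ else 0,
      ofCf_mem _⟩, funext fun x => ?_⟩
    rw [fieldCoeffs_apply, cf_ofCf, if_pos x.2, dif_pos x.2]

/-- The even fields are determined by their coefficients. -/
def evenFieldsEquiv : evenFields F n p t ≃ₗ[F] (fieldIdx n p t → F) :=
  .ofBijective fieldCoeffs fieldCoeffs_bijective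

instance : Module.Finite F (evenFields F n p t) :=
  Module.Finite.equiv (evenFieldsEquiv (F := F) (p := p) (t := t)).symm

lemma finrank_ker_divCoeffs :
    Module.finrank F (LinearMap.ker (divCoeffs F n p t)) + #(divIdx n p t) =
      #(fieldIdx n p t) := by
  have h1 := LinearMap.finrank_range_add_finrank_ker (divCoeffs F n p t)
  rw [LinearMap.range_eq_top.2 divCoeffs_surjective, finrank_top,
    (evenFieldsEquiv (F := F) (p := p) (t := t)).finrank_eq, Module.finrank_fintype_fun_eq_card,
    Module.finrank_fintype_fun_eq_card, Fintype.card_coe, Fintype.card_coe] at h1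
  rw [add_comm, h1]

/-! ### Fields normalising the even part of S -/

section Normalizer

variable [hp : Fact p.Prime] [CharP F p]

lemma divg_evenSpecial {T : Module.End F (Alg F m n)} (hT : T ∈ evenSpecial F n p t) :
    divg F m n T = 0 := by
  obtain ⟨e, -, -, h, rfl⟩ := exists_coeffs (mem_span_evenGens hT.1 hT.2)
  have h1 : (∑ k, mul (e k) ∘ₗ D k : Module.End F (Alg F m n)) = ∑ k, vf k (e k) := rfl
  rw [h1, map_sum, ← h]
  exact sum_congr rfl fun k _ => divg_vf k _

omit hp [CharP F p] in
lemma evenFields_le_evenEnd : evenFields F n p t ≤ evenEnd F m n := by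
  refine Submodule.span_le.2 ?_
  rintro _ ⟨k, f, -, hf, rfl⟩ q g hg
  rw [vf_apply, homog_congr (q' := tau k + (tau k + q)) (by omega)]
  exact mul_homog hf (D_homog k hg)

/-- The computation for closure of S uses only that the left factor has zero divergence and even
truncated coefficients; membership of T in S is not needed. -/
lemma lie_mem_of_divg_eq_zero {T : Module.End F (Alg F m n)} (hT : T ∈ evenFields F n p t)
    (h : divg F m n T = 0) {y : Module.End F (Alg F m n)} (hy : y ∈ evenSpecial F n p t) :
    ⁅T, y⁆ ∈ evenSpecial F n p t := by
  refine evenSpecial_induction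
    (N := (evenSpecial F n p t).toSubmodule.comap (LieAlgebra.ad F _ T)) (fun u v a h1 h2 => ?_) hy
  have hD := Drs_mono_mem (F := F) (t := t) (u := u) (v := v) h1 h2
  refine ⟨?_, evenFields_le_evenEnd (evenFields_lie hT (evenSpecial_le_evenFields hD))⟩
  have h3 := bracket_mem (e := fun k => T (X F k)) (fun k => (evenFields_apply_X hT k).2)
    (fun k => (evenFields_apply_X hT k).1) ((divg_apply T).symm.trans h) u v (mono_trunc h1)
    (mono_homog _ h2)
  have h4 : (∑ k, mul (T (X F k)) ∘ₗ D k : Module.End F (Alg F m n)) = T :=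
    (evenFields_eq_sum hT).symm
  rwa [h4] at h3

lemma divg_eul_inl (i : Fin m) : divg F m n (eul F (Sum.inl i)) = one F m n := by
  rw [eul_eq_vf, divg_vf, varExpo, D_inl_single_self]
  simp [tau, one]

lemma lie_eul_mem (r : Var m n) {y : Module.End F (Alg F m n)} (hy : y ∈ evenSpecial F n p t) :
    ⁅eul F r, y⁆ ∈ evenSpecial F n p t := by
  refine evenSpecial_induction (N := (evenSpecial F n p t).toSubmodule.comap
    (LieAlgebra.ad F _ (eul F r))) (fun u v a h1 h2 => ?_) hy
  rw [Submodule.mem_comap, LieAlgebra.ad_apply, lie_eul_Drs r u v h2]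
  exact Submodule.smul_mem _ _ (Drs_mono_mem h1 h2)

/-- An even field normalises the even part of `S` if and only if its divergence is constant. -/
lemma mem_ker_divCoeffs_iff (hm : 3 ≤ m) (ht : ∀ i, 1 ≤ t i) {T : evenFields F n p t} :
    T ∈ LinearMap.ker (divCoeffs F n p t) ↔
      ∀ y ∈ evenSpecial F n p t, ⁅(T : Module.End F (Alg F m n)), y⁆ ∈ evenSpecial F n p t := by
  rw [mem_ker_divCoeffs]
  constructor
  · rintro ⟨c, hc⟩ y hy
    -- Subtracting c x_i D_i makes the divergence zero, and x_i D_i itself normalises.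
    let i : Fin m := ⟨0, by omega⟩
    have h1 := lie_mem_of_divg_eq_zero
      (sub_mem T.2 (Submodule.smul_mem _ c (eul_mem ht (Sum.inl i))))
      (by rw [map_sub, map_smul, divg_eul_inl, hc, sub_self]) hy
    rw [sub_lie, smul_lie] at h1
    have h2 := add_mem h1 ((evenSpecial F n p t).smul_mem c (lie_eul_mem (Sum.inl i) hy))
    rwa [sub_add_cancel] at h2
  · intro h
    -- With y = D_i this says that D_i kills div T, so no even variable occurs in it; with y in the
    -- torus it excludes the odd variables.
    have h' : ∀ y ∈ evenSpecial F n p t, divg F m n ⁅y, (T : Module.End F (Alg F m n))⁆ = 0 := by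
      intro y hy
      rw [← lie_skew, map_neg, divg_evenSpecial (h y hy), neg_zero]
    refine ⟨co (0, ∅) (divg F m n T), ext_co fun a => ?_⟩
    rw [map_smul, one, co_mono, smul_eq_mul]
    split_ifs with ha
    · rw [ha, mul_one]
    · rw [mul_zero]
      have h1 : ∀ i, a.1 i ≠ 0 → co a (divg F m n T) = 0 := by
        intro i hi
        have h2 := congrArg (co (a.1 - Pi.single i 1, a.2)) (h' _ (Dinl_mem hm ht i))
        rw [divg_lie_D T.2, co_D_inl, map_zero] at h2
        dsimp only at h2
        rwa [sub_add_single hi] at h2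
      by_cases h0 : a.1 = 0
      · obtain ⟨l, hl⟩ : a.2.Nonempty := by
          rw [nonempty_iff_ne_empty]
          exact fun h3 => ha (Prod.ext h0.symm h3.symm)
        have h2 := congrArg (co a) (h' _ (ModularCartan.tor_mem ht ⟨0, by omega⟩ l))
        rw [tor, add_lie, map_add, divg_lie_eul, divg_lie_eul, map_add, co_eul, co_eul,
          map_zero] at h2
        simpa [deg, h0, hl] using h2
      · obtain ⟨i, hi⟩ := Function.ne_iff.1 h0
        exact h1 i hi

end Normalizer

end Divergence

/-! ### Counting monomials -/

section Dimension

/-- Toggling one fixed element exchanges the two parities. -/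
lemma card_filter_parity {n : ℕ} (hn : 0 < n) (q : ℕ) :
    #{w : Finset (Fin n) | #w % 2 = q % 2} = 2 ^ (n - 1) := by
  have hflip : ∀ r, #{w : Finset (Fin n) | #w % 2 = r % 2} ≤
      #{w : Finset (Fin n) | #w % 2 = (r + 1) % 2} := by
    intro r
    let x : Fin n := ⟨0, hn⟩
    refine card_le_card_of_injOn (fun w => symmDiff w {x}) (fun w hw => ?_)
      fun u _ w _ h => symmDiff_left_injective {x} h
    rw [mem_coe, mem_filter_univ] at hw ⊢
    dsimp only
    by_cases hx : x ∈ w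
    · have h : symmDiff w {x} = w.erase x := by
        ext y; by_cases hy : y = x <;> simp [mem_symmDiff, hy, hx]
      have := card_erase_add_one hx
      rw [h]; omega
    · have h : symmDiff w {x} = insert x w := by
        ext y; by_cases hy : y = x <;> simp [mem_symmDiff, hy, hx]
      rw [h, card_insert_of_notMem hx]; omega
  have h1 := card_filter_add_card_filter_not (s := (univ : Finset (Finset (Fin n))))
    (fun w => #w % 2 = q % 2)
  have h4 : ({w | ¬ #w % 2 = q % 2} : Finset (Finset (Fin n))) =
      ({w | #w % 2 = (q + 1) % 2} : Finset (Finset (Fin n))) :=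
    filter_congr fun w _ => by omega
  rw [h4, card_univ, Fintype.card_finset, Fintype.card_fin] at h1
  have h2 := hflip q
  have h3 := hflip (q + 1)
  rw [show (q + 1 + 1) % 2 = q % 2 by omega] at h3
  obtain ⟨k, rfl⟩ := Nat.exists_eq_add_of_le' hn
  rw [pow_succ] at h1
  simp only [Nat.add_sub_cancel]
  omega

variable {F : Type*} [Field F] {m n p : ℕ} {t : Fin m → ℕ}

lemma card_truncExpo (p : ℕ) (t : Fin m → ℕ) :
    #(Fintype.piFinset fun i => range (p ^ t i)) = p ^ ∑ i, t i := by
  simp [prod_pow_eq_pow_sum]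

lemma card_fieldIdx (hn : 0 < n) :
    #(fieldIdx n p t) = (m + n) * (2 ^ (n - 1) * p ^ ∑ i, t i) := by
  rw [fieldIdx, card_filter, sum_product]
  simp_rw [sum_product, ← card_filter, card_filter_parity hn, sum_const, card_truncExpo]
  rw [card_univ, Fintype.card_sum, Fintype.card_fin, Fintype.card_fin]
  simp only [smul_eq_mul]
  ring

/-- The constant monomial is always removed, the top one only when n is even, since otherwise it is
odd. A positive t_i keeps the two distinct. -/
lemma card_divIdx (hp : 1 < p) (ht : ∃ i, 1 ≤ t i) (hn : 0 < n) :
    #(divIdx n p t) + (if Even n then 2 else 1) = 2 ^ (n - 1) * p ^ ∑ i, t i := by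
  have hpos : ∀ i, 0 < p ^ t i := fun i => pow_pos (by omega) _
  let A : Finset (Expo m n) :=
    {a ∈ Fintype.piFinset (fun i => range (p ^ t i)) ×ˢ univ | #a.2 % 2 = 0}
  have hA : #A = 2 ^ (n - 1) * p ^ ∑ i, t i := by
    rw [card_filter, sum_product]
    simp_rw [← card_filter, sum_const, card_truncExpo]
    rw [card_filter_parity hn 0, smul_eq_mul, mul_comm]
  let top : Expo m n := (fun i => p ^ t i - 1, univ)
  have htop : top ≠ (0, ∅) := by
    obtain ⟨i, hi⟩ := ht
    intro h
    have h1 := congrFun (congrArg Prod.fst h) i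
    have h2 := one_lt_pow₀ hp (show t i ≠ 0 by omega)
    simp only [top, Pi.zero_apply] at h1
    omega
  have htop' : ∀ a : Expo m n, ((∀ i, a.1 i + 1 = p ^ t i) ∧ a.2 = univ) ↔ a = top := by
    intro a
    constructor
    · rintro ⟨h1, h2⟩
      exact Prod.ext (funext fun i => by have := h1 i; simp only [top]; omega) h2
    · rintro rfl
      exact ⟨fun i => Nat.sub_add_cancel (hpos i), rfl⟩
  have h0 : ((0, ∅) : Expo m n) ∈ A := by
    simp only [A, mem_filter, mem_product, Fintype.mem_piFinset, mem_range]
    exact ⟨⟨hpos, mem_univ _⟩, rfl⟩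
  have hJ : divIdx n p t = (A.erase (0, ∅)).erase top := by
    ext a
    rw [mem_divIdx, htop', mem_erase, mem_erase]
    simp only [A, mem_filter, mem_product, Fintype.mem_piFinset, mem_range, mem_univ, and_true]
    tauto
  have h1 := card_erase_add_one h0
  rw [hJ, ← hA]
  have hmem : top ∈ A.erase (0, ∅) ↔ Even n := by
    simp only [A, mem_erase, mem_filter, mem_product, Fintype.mem_piFinset, mem_range, mem_univ,
      and_true, top, card_univ, Fintype.card_fin, Nat.even_iff]
    exact ⟨fun h => h.2.2, fun h => ⟨htop, fun i => Nat.sub_lt (hpos i) one_pos, h⟩⟩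
  split_ifs with he
  · have h2 := card_erase_add_one (hmem.2 he)
    omega
  · rw [erase_eq_of_notMem (hmem.not.2 he)]
    exact h1

end Dimension

/-! ### The derivation algebra and its dimension -/

section Derivations

variable {F : Type*} [Field F] {m n p : ℕ} [hp : Fact p.Prime] [CharP F p] {t : Fin m → ℕ}

variable (F n p t) in
/-- The endomorphisms that normalise the even part of `S`. -/
def normalizer : Submodule F (Module.End F (Alg F m n)) where
  carrier := {T | ∀ y ∈ evenSpecial F n p t, ⁅T, y⁆ ∈ evenSpecial F n p t}
  add_mem' hS hT y hy := by rw [add_lie]; exact add_mem (hS y hy) (hT y hy)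
  zero_mem' y _ := by rw [zero_lie]; exact (evenSpecial F n p t).zero_mem
  smul_mem' c _ hT y hy := by rw [smul_lie]; exact (evenSpecial F n p t).smul_mem c (hT y hy)

variable (F n p t) in
/-- The derivation of the even part of `S` induced by a normalising endomorphism. -/
def normalizerDer : normalizer F n p t →ₗ[F]
    LieDerivation F (evenSpecial F n p t) (evenSpecial F n p t) where
  toFun T :=
    { toFun := fun y => ⟨⁅T.1, y.1⁆, T.2 y.1 y.2⟩
      map_add' := fun x y => Subtype.ext (lie_add T.1 x.1 y.1)
      map_smul' := fun c y => Subtype.ext (lie_smul c T.1 y.1)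
      leibniz' := fun x y => Subtype.ext <| by
        change ⁅T.1, ⁅x.1, y.1⁆⁆ = ⁅x.1, ⁅T.1, y.1⁆⁆ - ⁅y.1, ⁅T.1, x.1⁆⁆
        rw [leibniz_lie, ← lie_skew y.1 ⁅T.1, x.1⁆]
        abel }
  map_add' S T := LieDerivation.ext fun y => Subtype.ext (add_lie S.1 T.1 y.1)
  map_smul' c T := LieDerivation.ext fun y => Subtype.ext (smul_lie c T.1 y.1)

variable (F n p) in
/-- The derivation induced by an even field of constant divergence and by `p`-powers of the
`D_i`. -/
def derOf (hm : 3 ≤ m) (ht : ∀ i, 1 ≤ t i) :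
    LinearMap.ker (divCoeffs F n p t) × (FrobIdx t → F) →ₗ[F]
      LieDerivation F (evenSpecial F n p t) (evenSpecial F n p t) :=
  normalizerDer F n p t ∘ₗ LinearMap.codRestrict _
    (LinearMap.coprod
      ((evenFields F n p t).subtype ∘ₗ (LinearMap.ker (divCoeffs F n p t)).subtype)
      (Fintype.linearCombination F fun x : FrobIdx t =>
        D (F := F) (m := m) (n := n) (Sum.inl x.1) ^ p ^ (x.2.1 + 1)))
    fun x => add_mem (fun y hy => (mem_ker_divCoeffs_iff hm ht).1 x.1.2 y hy)
      fun _ hy => lie_frobSum_mem_special hm ht x.2 hy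

lemma derOf_apply (hm : 3 ≤ m) (ht : ∀ i, 1 ≤ t i)
    (x : LinearMap.ker (divCoeffs F n p t) × (FrobIdx t → F)) (y : evenSpecial F n p t) :
    (derOf F n p hm ht x y : Module.End F (Alg F m n)) =
      ⁅(x.1.1 : Module.End F (Alg F m n)), (y : Module.End F (Alg F m n))⁆ +
        ⁅frobSum n p x.2, (y : Module.End F (Alg F m n))⁆ :=
  add_lie _ _ _

/-- E is tested on elements that the p-powers kill, which gives E = 0; the fields x_q^(p^s) D_j then
return ν. -/
lemma derOf_injective (hp3 : 3 < p) (hm : 3 ≤ m) (hn : 2 ≤ n) (ht : ∀ i, 1 ≤ t i) :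
    Function.Injective (derOf F n p hm ht) := by
  refine (injective_iff_map_eq_zero _).2 fun x hx => ?_
  obtain ⟨⟨⟨E, hE⟩, hker⟩, ν⟩ := x
  have h : ∀ y ∈ evenSpecial F n p t, ⁅E, y⁆ + ⁅frobSum n p ν, y⁆ = 0 := fun y hy => by
    have h1 := derOf_apply hm ht (⟨⟨E, hE⟩, hker⟩, ν) ⟨y, hy⟩
    rw [hx, LieDerivation.zero_apply] at h1
    exact h1.symm
  have h0 : ∀ y ∈ evenSpecial F n p t, ⁅frobSum n p ν, y⁆ = 0 → ⁅E, y⁆ = 0 := fun y hy hy' => by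
    simpa [hy'] using h y hy
  have hE0 : E = 0 := eq_zero_of_lie_eq_zero (two_ne_zero_of_three_lt hp3) hm hn ht hE
    (fun i => h0 _ (Dinl_mem hm ht i) (lie_frobSum_D ν i))
    (fun i l => h0 _ (ModularCartan.tor_mem ht i l) (lie_frobSum_tor ht ν i l))
    (fun _ _ hkl => h0 _ (rot_mem_special hp3 hkl) (lie_frobSum_rot ν _ _))
    fun i _ _ hab => h0 _ (pair_mem_special hm ht i hab) (lie_frobSum_pair ν i hab)
  subst hE0
  have hν : ν = 0 := by
    funext x
    obtain ⟨j, hj, -⟩ := exists_third hm x.1 x.1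
    obtain ⟨q, hqx, hqj⟩ := exists_third hm x.1 j
    have hy : vf (Sum.inl j) (mono F (Pi.single x.1 (p ^ (x.2.1 + 1)), ∅)) ∈
        evenSpecial F n p t := by
      refine vf_inl_mem hqj (fun i => single_lt
        (Nat.pow_lt_pow_right hp.out.one_lt (by have := x.2.2; omega))) (by simp [hj]) ?_ rfl
      simpa [hqx] using one_lt_pow₀ hp.out.one_lt (by have := ht q; omega)
    have h1 := h _ hy
    rw [zero_lie, zero_add] at h1
    rw [← cf_lie_frobSum ν x j, h1, map_zero, Pi.zero_apply]
  subst hν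
  exact Prod.ext (Subtype.ext (Subtype.ext rfl)) rfl

lemma derOf_surjective (hp3 : 3 < p) (hm : 3 ≤ m) (hn : 2 ≤ n) (ht : ∀ i, 1 ≤ t i) :
    Function.Surjective (derOf F n p hm ht) := by
  intro δ
  -- The extension to all endomorphisms is arbitrary; only its values on the even part of S matter.
  obtain ⟨ψ, hψ⟩ := LinearMap.exists_extend
    ((evenSpecial F n p t).toSubmodule.subtype ∘ₗ δ.toLinearMap)
  have hψ' : ∀ (y : Module.End F (Alg F m n)) (hy : y ∈ evenSpecial F n p t),
      ψ y = δ ⟨y, hy⟩ := fun y hy => LinearMap.congr_fun hψ ⟨y, hy⟩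
  have hder : IsFieldDer n p t ψ := by
    refine ⟨fun y hy => ?_, fun x hx y hy => ?_⟩
    · rw [hψ' y hy]; exact evenSpecial_le_evenFields (δ _).2
    · rw [hψ' x hx, hψ' y hy, hψ' _ ((evenSpecial F n p t).lie_mem hx hy)]
      have h := congrArg Subtype.val (δ.apply_lie_eq_sub ⟨x, hx⟩ ⟨y, hy⟩)
      refine h.trans ?_
      change ⁅x, (δ ⟨y, hy⟩).1⁆ - ⁅y, (δ ⟨x, hx⟩).1⁆ = _
      rw [← lie_skew y]
      abel
  obtain ⟨E, hE, ν, h⟩ := hder.exists_eq_lie hp3 hm hn ht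
  -- Both δ and the p-powers preserve the even part of S, so E normalises it and has constant
  -- divergence.
  have hker : (⟨E, hE⟩ : evenFields F n p t) ∈ LinearMap.ker (divCoeffs F n p t) := by
    refine (mem_ker_divCoeffs_iff hm ht).2 fun y hy => ?_
    have h1 := h y hy
    rw [hψ' y hy, ← sub_eq_iff_eq_add] at h1
    rw [← h1]
    exact (evenSpecial F n p t).toSubmodule.sub_mem (δ _).2 (lie_frobSum_mem_special hm ht ν hy)
  refine ⟨(⟨⟨E, hE⟩, hker⟩, ν), LieDerivation.ext fun y => Subtype.ext ?_⟩
  rw [derOf_apply, ← h y.1 y.2, hψ' y.1 y.2]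

/-- The dimension of the derivation algebra of the even part of `S`. -/
theorem finrank_derivation (hp3 : 3 < p) (hm : 3 ≤ m) (hn : 2 ≤ n) (ht : ∀ i, 1 ≤ t i) :
    Module.finrank F (LieDerivation F (evenSpecial F n p t) (evenSpecial F n p t)) + m =
      (m + n - 1) * (2 ^ (n - 1) * p ^ ∑ i, t i) + (if Even n then 2 else 1) + ∑ i, t i := by
  have h1 := (LinearEquiv.ofBijective (derOf F n p hm ht)
    ⟨derOf_injective hp3 hm hn ht, derOf_surjective hp3 hm hn ht⟩).finrank_eq
  have : Module.Free F (LinearMap.ker (divCoeffs F n p t)) := 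
    @Module.Free.of_divisionRing F _ _ (Submodule.addCommGroup _) _
  rw [Module.finrank_prod, Module.finrank_fintype_fun_eq_card, Fintype.card_sigma] at h1
  simp only [Fintype.card_fin] at h1
  -- The number of p-powers is Σ(t_i - 1); adding m avoids truncated subtraction.
  have h2 : ∑ i, (t i - 1) + m = ∑ i, t i := by
    have h : ∑ i, t i = ∑ i, ((t i - 1) + 1) :=
      sum_congr rfl fun i _ => (Nat.sub_add_cancel (ht i)).symm
    rw [h, sum_add_distrib]
    simp
  have h3 := finrank_ker_divCoeffs (F := F) (n := n) (p := p) (t := t)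
  have h4 := card_divIdx (n := n) (p := p) hp.out.one_lt ⟨⟨0, by omega⟩, ht _⟩ (by omega)
  rw [card_fieldIdx (by omega)] at h3
  obtain ⟨k, hk⟩ : ∃ k, m + n = k + 1 := ⟨m + n - 1, by omega⟩
  rw [hk, add_mul, one_mul] at h3
  rw [hk, Nat.add_sub_cancel]
  omega

end Derivations

end ModularCartan

end

theorem corollary5p2p4 {F : Type*} [Field F] (p : ℕ) [Fact p.Prime] [CharP F p] (hp : 3 < p)
    (m n : ℕ) (hm : 3 ≤ m) (hn : 3 ≤ n) (t : Fin m → ℕ) (ht : ∀ i, 1 ≤ t i) :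
    (Even n →
      (Module.finrank F (LieDerivation F (ModularCartan.evenSpecial F n p t)
        (ModularCartan.evenSpecial F n p t)) : ℤ) =
        ((m : ℤ) + n - 1) * 2 ^ (n - 1) * (p : ℤ) ^ (∑ i, t i) + (∑ i, (t i : ℤ)) - m + 2) ∧
    (Odd n →
      (Module.finrank F (LieDerivation F (ModularCartan.evenSpecial F n p t)
        (ModularCartan.evenSpecial F n p t)) : ℤ) =
        ((m : ℤ) + n - 1) * 2 ^ (n - 1) * (p : ℤ) ^ (∑ i, t i) + (∑ i, (t i : ℤ)) - m + 1) := by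
  have h := ModularCartan.finrank_derivation (F := F) (t := t) hp hm (by omega : 2 ≤ n) ht
  have h' := congrArg (Nat.cast (R := ℤ)) h
  have h1 : ((m + n - 1 : ℕ) : ℤ) = (m : ℤ) + n - 1 := by omega
  constructor
  · intro he
    rw [if_pos he] at h'
    push_cast [h1] at h'
    linear_combination h'
  · intro ho
    rw [if_neg (Nat.not_even_iff_odd.2 ho)] at h'
    push_cast [h1] at h'
    linear_combination h'
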